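/- **Setting.** Fix real numbers $\lambda>0$, $0\le r_e<\tau$, $z\ge 0$ with $z>0$ or $r_e>0$, $P_t,f,c_0>0$, $\alpha>2$, and integers $m\ge 1$, $N$, $k_{\max}\ge 0$ with $k_{\max}\le N\sqrt3/4-1$. Let $\Psi=\{X_i\}$ be a Poisson point process of density $\lambda$ on the annulus $\{x\in\mathbb R^2: r_e\le |x|\le\tau\}$ (the base stations; the passive user is at the origin). Given $\Psi$, attach to the points independent marks $\xi_i$, uniform on $[-\pi/3,\pi/3)$, and $h_i$, where $|h_i|^2$ is gamma distributed with shape $m$ and scale $1/m$; all marks are independent of each other and of $\Psi$. The exposure is $$\mathcal S=\sum_{i}\bar S_r(|X_i|)\,G(\xi_i)\,|h_i|^2,\qquad \bar S_r(r)=\frac{P_t\,\kappa\, l(r)}{4\pi},\quad l(r)=\kappa^{-1}(r^2+z^2)^{-\alpha/2},\quad \kappa=(4\pi f/c_0)^2,$$ with the multi-cosine gain $G(\varphi)=\cos^2(N\pi\varphi/4)$ for $|\varphi|\le 2/N$, $G(\varphi)=\chi_k\sin^2(N\pi\varphi/2)$ for $2k/N\le|\varphi|\le(2k+2)/N$, $1\le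 k\le k_{\max}$, and $G(\varphi)=0$ for $|\varphi|>(2k_{\max}+2)/N$. Here $\chi_0=1$ and $\chi_k=\frac{\sin^2(Nx_k)}{N^2\sin^2 x_k}$, where $x_k$ is the $k$-th positive solution of $N\tan x=\tan(Nx)$ (the one in $(k\pi/N,(k+1)\pi/N)$). Put $F_{emf}(T)=\mathbb P[\mathcal S<T]$, $F_{emf}(T|\Psi)=\mathbb P[\mathcal S<T\mid\Psi]$, $\phi_E(q|\Psi)=\mathbb E[e^{jq\mathcal S}\mid\Psi]$, $\mathcal M_2(T)=\mathbb E_\Psi[F_{emf}(T|\Psi)^2]$. **Theorem.** (i) For all $q,q'>0$, $$\mathbb E_\Psi[\phi_E(q|\Psi)\phi_E(q'|\Psi)]=\gamma_+(q,q'),\qquad \mathbb E_\Psi[\phi_E(q|\Psi)\overline{\phi_E(q'|\Psi)}]=\gamma_-(q,q'),$$ where, with $K=1+k_{\max}$, $c_l=\binom{-1/2}{l}\binom{m-1}{l}$, $x_k(q)=x_k(q;r)=jq\chi_k\bar S_r(r)/m$ and $[g(r)]_{r_e}^{\tau}=g(\tau)-g(r_e)$, $$\gamma_\pm(q,q')=\exp\Bigg(\frac{12\lambda}{N}\Bigg[K\Big(\frac{3K}{N\pi}-1\Big)r^2-\sum_{k=0}^{k_{\max}}\sum_{l=0}^{m-1}c_l\Bigg(\pm\frac{6(r^2+z^2)}{N\pi}\sum_{p=0}^{k_{\max}}\sum_{l'=0}^{m-1}c_{l'}A_{k,p,l,l'}^{\pm}+\frac{2(r^2+z^2)\big(1-\frac{6K}{N\pi}\big)}{4+\alpha(2m-2l-1)}\big(B_{k,l}(q)+B_{k,l}(\pm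 q')\big)\Bigg)\Bigg]_{r_e}^{\tau}\Bigg),$$ $$A^{\pm}_{k,p,l,l'}=\frac{F_1\!\left(2m-1-l-l'+\frac2\alpha;\,m-\frac12,\,m-\frac12;\,2m-l-l'+\frac2\alpha;\,\frac1{x_k(q)},\,\frac1{x_p(\pm q')}\right)}{(2+\alpha(2m-1-l-l'))\,x_k(q)^{m-l-1/2}\,x_p(\pm q')^{m-l'-1/2}},$$ $$B_{k,l}(q)=\frac{{}_2F_1\!\left(1-l+\frac2\alpha,\,1;\,\frac12-l+m+\frac2\alpha;\,\frac1{x_k(q)}\right)}{x_k(q)^{1-l}\,(1-x_k(q))^{m-3/2}},$$ with principal powers, and with ${}_2F_1$ and the first Appell function $F_1$ given by their Euler integrals. (ii) For every $T_e>0$, $$\mathcal M_2(T_e)=-\tfrac14+F_{emf}(T_e)+\pi^{-2}\,\Omega(T_e),\qquad \Omega(T_e)=\int_0^\infty\!\!\int_0^\infty\omega(T_e,q,q')\,q^{-1}q'^{-1}\,dq\,dq',$$ $$\omega(T_e,q,q')=\tfrac12\operatorname{Re}\!\left[\gamma_-(q,q')e^{-jT_e(q-q')}-\gamma_+(q,q')e^{-jT_e(q+q')}\right],$$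 where the integral is improper: the integrand is integrable over each bounded rectangle $(0,A]\times(0,B]$, and $\Omega(T_e)$ is the limit of these integrals as $A,B\to\infty$ independently. -/

import Mathlib

open MeasureTheory ProbabilityTheory Filter
open scoped Topology ENNReal

namespace EMFE

/-- The plane containing the base stations; the passive user sits at the origin. -/
abbrev Plane : Type := EuclideanSpace ℝ (Fin 2)

/-! ### Finite random point configurations and Poisson point processes -/

section PointProcess

variable {Ω E : Type*}

open Classical in
/-- The number of points of the configuration `{X i ω : i < n ω}` lying in `B`. -/
noncomputable def count (n : Ω → ℕ) (X : ℕ → Ω → E) (B : Set E) (ω : Ω) : ℕ :=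
  ((Finset.range (n ω)).filter (fun i => X i ω ∈ B)).card

/-- The σ-algebra generated by the point process `{X i : i < n}`, that is, by its counting
variables on measurable sets. -/
@[reducible] noncomputable def pointSigma [MeasurableSpace E] (n : Ω → ℕ) (X : ℕ → Ω → E) : MeasurableSpace Ω :=
  ⨆ (B : Set E) (_ : MeasurableSet B), MeasurableSpace.comap (count n X B) ⊤

/-- `{X i : i < n}` is (an enumeration of) a Poisson point process with finite intensity
measure `L`: the numbers of points in pairwise disjoint measurable sets are independent, and the
number of points in `B` is Poisson distributed with mean `L B`. -/
structure IsPoissonProcess [MeasurableSpace Ω] [MeasurableSpace E] (μ : Measure Ω)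
    (L : Measure E) (n : Ω → ℕ) (X : ℕ → Ω → E) : Prop where
  measurable_card : Measurable n
  measurable_point : ∀ i, Measurable (X i)
  finite_intensity : L Set.univ < ∞
  hasLaw_count : ∀ B : Set E, MeasurableSet B →
    HasLaw (count n X B) (poissonMeasure (L B).toNNReal) μ
  indep_count : ∀ (k : ℕ) (B : Fin k → Set E), (∀ j, MeasurableSet (B j)) →
    Pairwise (fun i j => Disjoint (B i) (B j)) → iIndepFun (fun j => count n X (B j)) μ

end PointProcess

/-! ### Special functions -/

/-- The generalized binomial coefficient `x (x - 1) ⋯ (x - l + 1) / l!`. -/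
noncomputable def genBinom (x : ℝ) (l : ℕ) : ℝ :=
  (∏ i ∈ Finset.range l, (x - (i : ℝ))) / (Nat.factorial l : ℝ)

/-- Gauss' hypergeometric function `₂F₁(a, b; c; w)`, principal branch, through Euler's integral
(for `0 < b < c` and `w ∉ [1, ∞)`). -/
noncomputable def gaussF (a b c : ℝ) (w : ℂ) : ℂ :=
  ((Real.Gamma c / (Real.Gamma b * Real.Gamma (c - b)) : ℝ) : ℂ) *
    ∫ t in (0 : ℝ)..1, ((t ^ (b - 1) * (1 - t) ^ (c - b - 1) : ℝ) : ℂ) /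
      (1 - (t : ℂ) * w) ^ (a : ℂ)

/-- The first Appell function `F₁(a; b₁, b₂; c; w₁, w₂)`, principal branch, through Euler's
integral (for `0 < a < c` and `w₁, w₂ ∉ [1, ∞)`). -/
noncomputable def appellF (a b₁ b₂ c : ℝ) (w₁ w₂ : ℂ) : ℂ :=
  ((Real.Gamma c / (Real.Gamma a * Real.Gamma (c - a)) : ℝ) : ℂ) *
    ∫ t in (0 : ℝ)..1, ((t ^ (a - 1) * (1 - t) ^ (c - a - 1) : ℝ) : ℂ) /
      ((1 - (t : ℂ) * w₁) ^ (b₁ : ℂ) * (1 - (t : ℂ) * w₂) ^ (b₂ : ℂ))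

/-- `W` is the improper double integral of `f` over `(0, ∞)²`: `f` is integrable on every
bounded rectangle `(0, A] × (0, B]` and the integrals converge to `W` as `A, B → ∞`
independently. -/
def HasImproperDoubleIntegral (f : ℝ → ℝ → ℝ) (W : ℝ) : Prop :=
  (∀ A B : ℝ, IntegrableOn (fun p : ℝ × ℝ => f p.1 p.2)
    (Set.Ioc 0 A ×ˢ Set.Ioc 0 B) volume) ∧
  Tendsto (fun b : ℝ × ℝ => ∫ p in Set.Ioc 0 b.1 ×ˢ Set.Ioc 0 b.2, f p.1 p.2)
    (atTop ×ˢ atTop) (𝓝 W)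

/-! ### The network -/

/-- The deterministic parameters of the network. -/
structure Params where
  /-- density of base stations -/
  lam : ℝ
  /-- exclusion radius -/
  rE : ℝ
  /-- radius of the network area -/
  tau : ℝ
  /-- height of the base stations relative to the users -/
  z : ℝ
  /-- maximum transmit power -/
  Pt : ℝ
  /-- carrier frequency -/
  freq : ℝ
  /-- speed of light -/
  c0 : ℝ
  /-- path loss exponent -/
  alpha : ℝ
  /-- (integer) shape parameter of the Nakagami fading -/
  m : ℕ
  /-- number of antennas of each array -/
  N : ℕ
  /-- index of the last side lobe that is kept in the gain model -/
  kmax : ℕ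
  lam_pos : 0 < lam
  rE_nonneg : 0 ≤ rE
  rE_lt_tau : rE < tau
  z_nonneg : 0 ≤ z
  z_or_rE_pos : 0 < z ∨ 0 < rE
  Pt_pos : 0 < Pt
  freq_pos : 0 < freq
  c0_pos : 0 < c0
  two_lt_alpha : 2 < alpha
  one_le_m : 1 ≤ m
  /-- the side lobes stay inside the sector of the array -/
  kmax_le : (kmax : ℝ) ≤ (N : ℝ) * √3 / 4 - 1

namespace Params

variable (P : Params)

/-- `κ = (4 π f / c₀)²`. -/
noncomputable def kappa : ℝ := (4 * Real.pi * P.freq / P.c0) ^ 2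

/-- Path loss at horizontal distance `r`. -/
noncomputable def pathLoss (r : ℝ) : ℝ := P.kappa⁻¹ * (r ^ 2 + P.z ^ 2) ^ (-P.alpha / 2)

/-- `S̄ᵣ(r) = Pₜ l(r) κ / (4 π)`. -/
noncomputable def Sbar (r : ℝ) : ℝ := P.Pt * P.pathLoss r * P.kappa / (4 * Real.pi)

/-- The `k`-th positive solution `x_k` of `N tan x = tan (N x)`. It is the only solution between
the consecutive zeros `k π / N` and `(k + 1) π / N` of the array factor
`sin² (N x) / (N² sin² x)`, and the location of the maximum of the `k`-th side lobe. -/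
noncomputable def lobePoint (k : ℕ) : ℝ :=
  sInf {x : ℝ | x ∈ Set.Ioo ((k : ℝ) * Real.pi / P.N) (((k : ℝ) + 1) * Real.pi / P.N) ∧
    (P.N : ℝ) * Real.tan x = Real.tan (P.N * x)}

/-- The level `χ_k` of the `k`-th lobe, with `χ₀ = 1` for the main lobe. -/
noncomputable def chi (k : ℕ) : ℝ :=
  if k = 0 then 1
  else Real.sin (P.N * P.lobePoint k) ^ 2 / ((P.N : ℝ) ^ 2 * Real.sin (P.lobePoint k) ^ 2)

/-- The multi-cosine antenna gain at angle `x ∈ [-π/3, π/3)` from the boresight: main lobe for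
`|x| ≤ 2/N`, side lobe `k` for `2k/N ≤ |x| ≤ (2k+2)/N` and `1 ≤ k ≤ kmax`, and `0` beyond. -/
noncomputable def gain (x : ℝ) : ℝ :=
  if |x| ≤ 2 / P.N then Real.cos (P.N * Real.pi * x / 4) ^ 2
  else ∑ k ∈ Finset.Icc 1 P.kmax,
    if 2 * (k : ℝ) / P.N < |x| ∧ |x| ≤ (2 * (k : ℝ) + 2) / P.N then
      P.chi k * Real.sin (P.N * Real.pi * x / 2) ^ 2
    else 0

/-- The intensity measure of the base stations: `λ` times Lebesgue measure on the annulus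
`rE ≤ ‖x‖ ≤ tau`. -/
noncomputable def intensity : Measure Plane :=
  ENNReal.ofReal P.lam • (volume.restrict {x : Plane | P.rE ≤ ‖x‖ ∧ ‖x‖ ≤ P.tau})

/-! #### Closed form of the mixed moments of the conditional characteristic function

Below `e = 1` and `e = -1` stand for the upper and the lower sign. -/

/-- `j q χ_k S̄ᵣ(r) / m`. -/
noncomputable def jarg (k : ℕ) (r q : ℝ) : ℂ :=
  Complex.I * ((q * P.chi k * P.Sbar r / P.m : ℝ) : ℂ)

/-- The coefficient `binom(-1/2, l) binom(m - 1, l)`. -/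
noncomputable def coef (l : ℕ) : ℝ := genBinom (-1 / 2) l * ((P.m - 1).choose l : ℝ)

/-- The `₂F₁` contribution of lobe `k`:
`₂F₁(1 - l + 2/α, 1; 1/2 - l + m + 2/α; 1/x) / (x^(1-l) (1 - x)^(m - 3/2))`, where
`x = j q χ_k S̄ᵣ(r) / m`. -/
noncomputable def gaussTerm (k l : ℕ) (r q : ℝ) : ℂ :=
  gaussF (1 - l + 2 / P.alpha) 1 (1 / 2 - l + P.m + 2 / P.alpha) (P.jarg k r q)⁻¹ /
    (P.jarg k r q ^ (1 - (l : ℤ)) * (1 - P.jarg k r q) ^ ((P.m : ℂ) - 3 / 2))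

/-- The Appell contribution of the pair of lobes `k`, `p`: with `x = j q χ_k S̄ᵣ(r) / m` and
`y = j q' χ_p S̄ᵣ(r) / m`,
`F₁(2m-1-l-l'+2/α; m-1/2, m-1/2; 2m-l-l'+2/α; 1/x, 1/y) /
  ((2 + α (2m-1-l-l')) x^(m-l-1/2) y^(m-l'-1/2))`. -/
noncomputable def appellTerm (k p l l' : ℕ) (r q q' : ℝ) : ℂ :=
  appellF (2 * P.m - 1 - l - l' + 2 / P.alpha) (P.m - 1 / 2) (P.m - 1 / 2)
      (2 * P.m - l - l' + 2 / P.alpha) (P.jarg k r q)⁻¹ (P.jarg p r q')⁻¹ /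
    (((2 + P.alpha * (2 * P.m - 1 - l - l') : ℝ) : ℂ) *
      P.jarg k r q ^ ((P.m : ℂ) - l - 1 / 2) * P.jarg p r q' ^ ((P.m : ℂ) - l' - 1 / 2))

/-- The bracket in the exponent of `γ_±(q, q')`, as a function of `r`. -/
noncomputable def bracket (e q q' r : ℝ) : ℂ :=
  let K : ℝ := 1 + P.kmax
  let u : ℝ := 6 / (P.N * Real.pi)
  ((K * (3 * K / (P.N * Real.pi) - 1) * r ^ 2 : ℝ) : ℂ) -
    ∑ k ∈ Finset.range (P.kmax + 1), ∑ l ∈ Finset.range P.m, (P.coef l : ℂ) *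
      (((e * u * (r ^ 2 + P.z ^ 2) : ℝ) : ℂ) *
          (∑ p ∈ Finset.range (P.kmax + 1), ∑ l' ∈ Finset.range P.m,
            (P.coef l' : ℂ) * P.appellTerm k p l l' r q (e * q')) +
        ((2 * (r ^ 2 + P.z ^ 2) * (1 - u * K) / (4 + P.alpha * (2 * P.m - 2 * l - 1)) : ℝ) : ℂ) *
          (P.gaussTerm k l r q + P.gaussTerm k l r (e * q')))

/-- `exp ((12 λ / N) [bracket]_{r = rE}^{r = tau})`. -/
noncomputable def gammaSigned (e q q' : ℝ) : ℂ :=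
  Complex.exp (((12 * P.lam / P.N : ℝ) : ℂ) *
    (P.bracket e q q' P.tau - P.bracket e q q' P.rE))

/-- `γ_+(q, q')`. -/
noncomputable def gammaPlus (q q' : ℝ) : ℂ := P.gammaSigned 1 q q'

/-- `γ_-(q, q')`. -/
noncomputable def gammaMinus (q q' : ℝ) : ℂ := P.gammaSigned (-1) q q'

/-- `ω(T, q, q') = ½ Re[γ_-(q, q') e^{-jT(q - q')} - γ_+(q, q') e^{-jT(q + q')}]`. -/
noncomputable def omegaKernel (T q q' : ℝ) : ℝ :=
  1 / 2 * (P.gammaMinus q q' * Complex.exp (-Complex.I * ((T * (q - q') : ℝ) : ℂ)) -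
    P.gammaPlus q q' * Complex.exp (-Complex.I * ((T * (q + q') : ℝ) : ℂ))).re

end Params

/-- The random ingredients of the network on a probability space: `n` base stations at the points
`X i`, `i < n`; the angle `xi i` between the direction of the user and the boresight of the array
of station `i` whose sector contains the user; and the channel coefficient `h i`. -/
structure Network (Ω : Type*) where
  n : Ω → ℕ
  X : ℕ → Ω → Plane
  xi : ℕ → Ω → ℝ
  h : ℕ → Ω → ℂ

/-- The stochastic model: base stations form a Poisson point process of density `lam` on the
annulus; angles are uniform on a sector; `|h i|²` is gamma distributed with shape `m` and scale
`1/m` (rate `m`); all these are independent. -/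
structure Network.IsModel {Ω : Type*} [MeasurableSpace Ω] (S : Network Ω) (P : Params)
    (μ : Measure Ω) : Prop where
  poisson : IsPoissonProcess μ P.intensity S.n S.X
  measurable_xi : ∀ i, Measurable (S.xi i)
  measurable_h : ∀ i, Measurable (S.h i)
  uniform_xi : ∀ i, HasLaw (S.xi i)
    (ProbabilityTheory.cond volume (Set.Ico (-(Real.pi / 3)) (Real.pi / 3))) μ
  gamma_h : ∀ i, HasLaw (fun ω => ‖S.h i ω‖ ^ 2) (gammaMeasure P.m P.m) μ
  indep_mark : ∀ i, IndepFun (S.xi i) (S.h i) μ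
  indep_marks : iIndepFun (fun i ω => (S.xi i ω, S.h i ω)) μ
  indep_points : IndepFun (fun ω => (S.n ω, fun i => S.X i ω))
    (fun ω => (fun i => (S.xi i ω, S.h i ω) : ℕ → ℝ × ℂ)) μ

namespace Network

variable {Ω : Type*} (S : Network Ω) (P : Params)

/-- The exposure `𝒮 = ∑_i S̄ᵣ(‖X_i‖) G(ξ_i) |h_i|²` of the passive user. -/
noncomputable def exposure (ω : Ω) : ℝ :=
  ∑ i ∈ Finset.range (S.n ω), P.Sbar ‖S.X i ω‖ * P.gain (S.xi i ω) * ‖S.h i ω‖ ^ 2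

/-- The σ-algebra generated by the point process of base stations. -/
@[reducible] noncomputable def sigmaPsi : MeasurableSpace Ω := pointSigma S.n S.X

variable [MeasurableSpace Ω] (μ : Measure Ω)

/-- `F_emf(T) = ℙ[𝒮 < T]`. -/
noncomputable def cdf (T : ℝ) : ℝ := μ.real {ω | S.exposure P ω < T}

/-- `F_emf(T | Ψ) = ℙ[𝒮 < T | Ψ]`. -/
noncomputable def condCdf (T : ℝ) : Ω → ℝ :=
  μ[Set.indicator {ω | S.exposure P ω < T} (fun _ => (1 : ℝ)) | S.sigmaPsi]

/-- The conditional characteristic function `φ_E(q | Ψ) = 𝔼[exp(j q 𝒮) | Ψ]`. -/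
noncomputable def condChar (q : ℝ) : Ω → ℂ :=
  μ[fun ω => Complex.exp (Complex.I * ((q * S.exposure P ω : ℝ) : ℂ)) | S.sigmaPsi]

/-- The second moment `𝔼[F_emf(T | Ψ)²]` of the conditional distribution function. -/
noncomputable def secondMoment (T : ℝ) : ℝ := ∫ ω, S.condCdf P μ T ω ^ 2 ∂μ

end Network

end EMFE

/-! Part (i). Given the base stations the marks are independent, so the conditional characteristic
function of the exposure is a product over the stations of one function `stationChar` of frequency
and distance (`condChar_ae_eq`). A product of two such products is again a product over the
stations, and the generating functional of the Poisson process, `integral_prod_eq`, turns its mean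
into the exponential of a radial integral of r (1 - φ(q, r) φ(±q', r)), up to the factor -2πλ. A
conjugate is the value at the opposite frequency, which treats both signs at once.

Two explicit computations remain. Averaging over fading and angle gives `stationChar` in closed
form: with gamma fading each lobe contributes an integral of (1 - x cos² θ)^(-m), evaluated in
`integral_lobe_pow` through a first order differential equation and Wallis' integrals. The radial
integral is then checked by differentiating the bracket (`hasDerivAt_bracket`). Gauss terms are
handled by the differential equation of Euler's integral; Appell terms become incomplete integrals
in the upper limit (r² + z²)^(α/2), differentiated by the fundamental theorem. The sign ± in front
of the Appell sum is the product of two branch phases (`exp_sign_add_sign`).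

Part (ii). The truncated Dirichlet integral -(1/π) ∫₀^A sin(q(𝒮 - T))/q dq is bounded uniformly in A
and tends to 1{𝒮 < T} - 1/2 wherever 𝒮 ≠ T, hence almost surely, because 𝒮 has no atom at a positive
T (`exposure_ne`). Conditional expectation is an L¹ contraction, so the mean of the product of two
such conditional expectations, with cut-offs A and B, tends to 𝔼[(F(T|Ψ) - 1/2)²] = 𝓜₂ - F + 1/4 as
A and B grow independently (`tendsto_integral_condExp_mul`). By Fubini each conditional expectation
is an integral of Im(φ_E(q|Ψ) e^{-jqT})/q, and Im a · Im b = ½ Re(a b̄ - a b) together with part (i)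
produces the kernel ω. Fubini near q = 0 is justified by |sin(qx)/q| ≤ |x| and a bound linear in the
number of stations, whose square is integrable. -/

namespace EMFE

/-! ### Powers along the line `Re = 1` -/

lemma one_sub_mem_slitPlane {w : ℂ} (hw : w.re = 0) : 1 - w ∈ Complex.slitPlane := by
  left; simp [hw]

lemma one_sub_ne_zero {w : ℂ} (hw : w.re = 0) : 1 - w ≠ 0 :=
  Complex.slitPlane_ne_zero (one_sub_mem_slitPlane hw)

lemma one_le_norm_one_sub {w : ℂ} (hw : w.re = 0) : 1 ≤ ‖1 - w‖ := by
  calc (1 : ℝ) = (1 - w).re := by simp [hw]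
    _ ≤ ‖1 - w‖ := Complex.re_le_norm _

lemma re_ofReal_mul {w : ℂ} (hw : w.re = 0) (v : ℝ) : ((v : ℂ) * w).re = 0 := by simp [hw]

lemma hasDerivAt_one_sub_cpow {w : ℂ} (hw : w.re = 0) (c : ℂ) (v : ℝ) :
    HasDerivAt (fun v : ℝ => (1 - (v : ℂ) * w) ^ c)
      (c * (1 - (v : ℂ) * w) ^ (c - 1) * (-w)) v := by
  have h : HasDerivAt (fun v : ℂ => 1 - v * w) (-w) (v : ℂ) := by
    simpa using ((hasDerivAt_id (v : ℂ)).mul_const w).const_sub 1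
  exact (h.cpow_const (one_sub_mem_slitPlane (re_ofReal_mul hw v))).comp_ofReal

lemma continuous_one_sub_cpow {w : ℂ} (hw : w.re = 0) (c : ℂ) :
    Continuous (fun v : ℝ => (1 - (v : ℂ) * w) ^ c) :=
  continuous_iff_continuousAt.2 fun v => (hasDerivAt_one_sub_cpow hw c v).continuousAt

/-- The base has modulus at least 1, so replacing c by |c| only enlarges the power; one bound serves
both signs of the exponent. -/
lemma norm_one_sub_cpow_le {w : ℂ} (hw : w.re = 0) (c : ℝ) {R : ℝ} (hR : ‖w‖ ≤ R) :
    ‖(1 - w) ^ (c : ℂ)‖ ≤ (1 + R) ^ |c| := by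
  rw [Complex.norm_cpow_real]
  have h1 := one_le_norm_one_sub hw
  calc ‖1 - w‖ ^ c ≤ ‖1 - w‖ ^ |c| := Real.rpow_le_rpow_of_exponent_le h1 (le_abs_self c)
    _ ≤ (1 + R) ^ |c| := by
        apply Real.rpow_le_rpow (norm_nonneg _) _ (abs_nonneg c)
        exact (norm_sub_le _ _).trans (by simpa using hR)

/-! ### The Euler integral `∫ (1 - t)^(b-1) (1 - t w)^(-a)` -/

lemma intervalIntegrable_one_sub_rpow {b : ℝ} (hb : 0 < b) :
    IntervalIntegrable (fun t : ℝ => (1 - t) ^ (b - 1)) volume 0 1 := by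
  have h : IntervalIntegrable (fun t : ℝ => t ^ (b - 1)) volume 1 0 :=
    intervalIntegral.intervalIntegrable_rpow' (by linarith)
  simpa using h.comp_sub_left 1

lemma intervalIntegrable_euler {b : ℝ} (hb : 0 < b) {g : ℝ → ℂ} (hg : Continuous g) :
    IntervalIntegrable (fun t : ℝ => (((1 - t) ^ (b - 1) : ℝ) : ℂ) * g t) volume 0 1 :=
  IntervalIntegrable.mul_continuousOn
    ⟨(intervalIntegrable_one_sub_rpow hb).1.ofReal, (intervalIntegrable_one_sub_rpow hb).2.ofReal⟩
    hg.continuousOn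

/-- `∫₀¹ (1 - t)^(b-1) (1 - t w)^a dt`. -/
noncomputable def eulerInt (b a : ℝ) (w : ℂ) : ℂ :=
  ∫ t in (0 : ℝ)..1, (((1 - t) ^ (b - 1) : ℝ) : ℂ) * (1 - (t : ℂ) * w) ^ (a : ℂ)

lemma continuousOn_ofReal_one_sub_rpow {b : ℝ} (hb : 0 < b) :
    ContinuousOn (fun t : ℝ => (((1 - t) ^ b : ℝ) : ℂ)) (Set.Icc 0 1) := by
  apply Continuous.continuousOn
  exact Complex.continuous_ofReal.comp
    ((continuous_const.sub continuous_id).rpow_const (fun _ => Or.inr hb.le))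

lemma hasDerivAt_ofReal_one_sub_rpow (b : ℝ) {t : ℝ} (ht : t < 1) :
    HasDerivAt (fun t : ℝ => (((1 - t) ^ b : ℝ) : ℂ))
      (-((b * (1 - t) ^ (b - 1) : ℝ) : ℂ)) t := by
  have h : HasDerivAt (fun t : ℝ => (1 - t) ^ b) (-(b * (1 - t) ^ (b - 1))) t := by
    have := ((hasDerivAt_id t).const_sub 1).rpow_const (p := b) (Or.inl (by simp; linarith))
    refine this.congr_deriv ?_
    simp
  have := h.ofReal_comp
  push_cast at this ⊢
  exact this

/-- Contiguity relation of the Euler integral. -/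
lemma eulerInt_contiguous {b : ℝ} (hb : 0 < b) (a : ℝ) {w : ℂ} (hw : w.re = 0) :
    (b - a) * eulerInt b (-a) w + a * (1 - w) * eulerInt b (-a - 1) w = 1 := by
  have hcont : ContinuousOn (fun t : ℝ => (((1 - t) ^ b : ℝ) : ℂ) *
      (1 - (t : ℂ) * w) ^ ((-a : ℝ) : ℂ)) (Set.Icc 0 1) :=
    (continuousOn_ofReal_one_sub_rpow hb).mul (continuous_one_sub_cpow hw _).continuousOn
  have hint (c : ℝ) := intervalIntegrable_euler hb (continuous_one_sub_cpow hw (c : ℂ))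
  -- The integrand is the derivative of (1 - t)^b (1 - t w)^(-a), rewritten with w (1 - t) = (1 - t
  -- w) - (1 - w). For b < 1 it is singular at t = 1, so differentiability is used on the open
  -- interval only.
  have key := intervalIntegral.integral_eq_sub_of_hasDerivAt_of_le (f' := fun t : ℝ =>
      -((b - a : ℂ) * ((((1 - t) ^ (b - 1) : ℝ) : ℂ) * (1 - (t : ℂ) * w) ^ ((-a : ℝ) : ℂ)) +
        (a * (1 - w)) * ((((1 - t) ^ (b - 1) : ℝ) : ℂ) * (1 - (t : ℂ) * w) ^ ((-a - 1 : ℝ) : ℂ))))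
      zero_le_one hcont ?_ ?_
  · rw [intervalIntegral.integral_neg, intervalIntegral.integral_add ((hint _).const_mul _)
      ((hint _).const_mul _), intervalIntegral.integral_const_mul,
      intervalIntegral.integral_const_mul] at key
    simp only [sub_self, Real.zero_rpow hb.ne', Complex.ofReal_zero, zero_mul, sub_zero,
      Real.one_rpow, Complex.ofReal_one, Complex.one_cpow, mul_one, zero_sub, neg_inj] at key
    exact key
  · intro t ht
    have h := (hasDerivAt_ofReal_one_sub_rpow b ht.2).mul
      (hasDerivAt_one_sub_cpow hw ((-a : ℝ) : ℂ) t)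
    refine h.congr_deriv ?_
    have e1 : (1 - t) ^ b = (1 - t) ^ (b - 1) * (1 - t) := by
      rw [← Real.rpow_add_one (by linarith [ht.2]), sub_add_cancel]
    have e2 : (1 - (t : ℂ) * w) ^ ((-a : ℝ) : ℂ) =
        (1 - (t : ℂ) * w) ^ ((-a - 1 : ℝ) : ℂ) * (1 - (t : ℂ) * w) := by
      have hne := one_sub_ne_zero (re_ofReal_mul hw t)
      nth_rewrite 3 [← Complex.cpow_one (1 - (t : ℂ) * w)]
      rw [← Complex.cpow_add _ _ hne]
      push_cast; ring_nf
    have e3 : ((-a : ℝ) : ℂ) - 1 = ((-a - 1 : ℝ) : ℂ) := by push_cast; ring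
    rw [e3, e1, e2]
    push_cast
    ring
  · exact (((hint _).const_mul _).add ((hint _).const_mul _)).neg

/-- Differentiation under the integral sign: since w is purely imaginary, the power of 1 - t x w
stays bounded for x in a unit neighbourhood, and the integrable weight (1 - t)^(b-1) dominates. -/
lemma hasDerivAt_eulerInt {b : ℝ} (hb : 0 < b) (a : ℝ) {w : ℂ} (hw : w.re = 0) (x : ℝ) :
    HasDerivAt (fun x : ℝ => eulerInt b (-a) (x * w))
      (∫ t in (0 : ℝ)..1, (((1 - t) ^ (b - 1) : ℝ) : ℂ) *
        (a * (t * w) * (1 - (t : ℂ) * (x * w)) ^ ((-a - 1 : ℝ) : ℂ))) x := by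
  have hx (y : ℝ) : ((y : ℂ) * w).re = 0 := re_ofReal_mul hw y
  refine (intervalIntegral.hasDerivAt_integral_of_dominated_loc_of_deriv_le
    (F := fun (x t : ℝ) => (((1 - t) ^ (b - 1) : ℝ) : ℂ) * (1 - (t : ℂ) * (x * w)) ^ ((-a : ℝ) : ℂ))
    (F' := fun (x t : ℝ) => (((1 - t) ^ (b - 1) : ℝ) : ℂ) *
        (a * (t * w) * (1 - (t : ℂ) * (x * w)) ^ ((-a - 1 : ℝ) : ℂ)))
    (s := Set.Ioo (x - 1) (x + 1))
    (bound := fun t => (1 - t) ^ (b - 1) *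
      (|a| * ‖w‖ * (1 + (|x| + 1) * ‖w‖) ^ |-a - 1|))
    (Ioo_mem_nhds (by linarith) (by linarith)) ?_ ?_ ?_ ?_ ?_ ?_).2
  · exact Eventually.of_forall fun y => (intervalIntegrable_euler hb
      (continuous_one_sub_cpow (hx y) _)).def'.aestronglyMeasurable
  · exact intervalIntegrable_euler hb (continuous_one_sub_cpow (hx x) _)
  · refine (intervalIntegrable_euler hb (g := fun t : ℝ =>
      a * (t * w) * (1 - (t : ℂ) * (x * w)) ^ ((-a - 1 : ℝ) : ℂ)) ?_).def'.aestronglyMeasurable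
    exact (by fun_prop : Continuous fun t : ℝ => (a : ℂ) * (t * w)).mul
      (continuous_one_sub_cpow (hx x) _)
  · refine Eventually.of_forall fun t ht y hy => ?_
    rw [Set.uIoc_of_le zero_le_one] at ht
    have h1 : (0 : ℝ) ≤ 1 - t := by linarith [ht.2]
    have ht0 := ht.1.le
    have ht1 := ht.2
    rw [norm_mul, norm_mul, norm_mul, norm_mul, Complex.norm_real, Complex.norm_real,
      Complex.norm_real, Real.norm_of_nonneg (Real.rpow_nonneg h1 _), Real.norm_of_nonneg ht0,
      Real.norm_eq_abs]
    have hy' : |y| ≤ |x| + 1 := by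
      have : |y - x| ≤ 1 := by rw [abs_le]; constructor <;> linarith [hy.1, hy.2]
      calc |y| = |x + (y - x)| := by ring_nf
        _ ≤ |x| + |y - x| := abs_add_le _ _
        _ ≤ _ := by linarith
    have hn : ‖(t : ℂ) * (y * w)‖ ≤ (|x| + 1) * ‖w‖ := by
      rw [norm_mul, norm_mul, Complex.norm_real, Complex.norm_real, Real.norm_of_nonneg ht0,
        Real.norm_eq_abs]
      have : |y| * ‖w‖ ≤ (|x| + 1) * ‖w‖ := by gcongr
      calc t * (|y| * ‖w‖) ≤ 1 * (|y| * ‖w‖) := by gcongr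
        _ ≤ _ := by simpa using this
    have := norm_one_sub_cpow_le (re_ofReal_mul (hx y) t) (-a - 1) hn
    gcongr
    calc t * ‖w‖ ≤ 1 * ‖w‖ := by gcongr
      _ = ‖w‖ := one_mul _
  · exact (intervalIntegrable_one_sub_rpow hb).mul_const _
  · refine Eventually.of_forall fun t _ y _ => ?_
    have hd := hasDerivAt_one_sub_cpow (re_ofReal_mul hw t) ((-a : ℝ) : ℂ) y
    have hd' := hd.const_mul (((1 - t) ^ (b - 1) : ℝ) : ℂ)
    have e (y : ℝ) : (t : ℂ) * ((y : ℂ) * w) = y * (t * w) := by ring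
    simp only [e]
    refine hd'.congr_deriv ?_
    push_cast
    ring

/-- The Euler integral along a ray solves a first order differential equation. -/
lemma exists_hasDerivAt_eulerInt {b : ℝ} (hb : 0 < b) (a : ℝ) {w : ℂ} (hw : w.re = 0) (x : ℝ) :
    ∃ D : ℂ, HasDerivAt (fun x : ℝ => eulerInt b (-a) (x * w)) D x ∧
      x * (1 - x * w) * D = 1 + (a * (x * w) - b) * eulerInt b (-a) (x * w) := by
  refine ⟨_, hasDerivAt_eulerInt hb a hw x, ?_⟩
  have hx : ((x : ℂ) * w).re = 0 := re_ofReal_mul hw x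
  have hint (c : ℝ) := intervalIntegrable_euler hb (continuous_one_sub_cpow hx (c : ℂ))
  -- Writing t x w = 1 - (1 - t x w) makes x times the derivative a difference of two Euler
  -- integrals; the contiguity relation then eliminates the one with exponent -a - 1.
  have h : (x : ℂ) * (∫ t in (0 : ℝ)..1, (((1 - t) ^ (b - 1) : ℝ) : ℂ) *
        (a * (t * w) * (1 - (t : ℂ) * (x * w)) ^ ((-a - 1 : ℝ) : ℂ))) =
      a * (eulerInt b (-a - 1) (x * w) - eulerInt b (-a) (x * w)) := by
    rw [eulerInt, eulerInt, ← intervalIntegral.integral_sub (hint _) (hint _),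
      ← intervalIntegral.integral_const_mul, ← intervalIntegral.integral_const_mul]
    refine intervalIntegral.integral_congr fun t _ => ?_
    have e2 : (1 - (t : ℂ) * (x * w)) ^ ((-a : ℝ) : ℂ) =
        (1 - (t : ℂ) * (x * w)) ^ ((-a - 1 : ℝ) : ℂ) * (1 - (t : ℂ) * (x * w)) := by
      have hne := one_sub_ne_zero (re_ofReal_mul hx t)
      nth_rewrite 3 [← Complex.cpow_one (1 - (t : ℂ) * (x * w))]
      rw [← Complex.cpow_add _ _ hne]
      push_cast; ring_nf
    simp only [e2]
    ring
  have h2 := eulerInt_contiguous hb a hx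
  linear_combination (1 - (x : ℂ) * w) * h + h2

end EMFE


namespace EMFE

/-! ### Principal powers on the imaginary axis -/

lemma ofReal_mul_cpow {c : ℝ} (hc : 0 < c) {x : ℂ} (hx : x ≠ 0) (p : ℂ) :
    ((c : ℂ) * x) ^ p = (c : ℂ) ^ p * x ^ p := by
  have hc' : (c : ℂ) ≠ 0 := by exact_mod_cast hc.ne'
  rw [Complex.cpow_def_of_ne_zero (mul_ne_zero hc' hx), Complex.cpow_def_of_ne_zero hc',
    Complex.cpow_def_of_ne_zero hx, Complex.log_ofReal_mul hc hx, ← Complex.exp_add,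
    Complex.ofReal_log hc.le, add_mul]

lemma log_I_mul_of_pos {a : ℝ} (ha : 0 < a) :
    Complex.log (Complex.I * a) = Real.log a + Real.pi / 2 * Complex.I := by
  rw [mul_comm, Complex.log_ofReal_mul ha Complex.I_ne_zero, Complex.log_I]

lemma log_neg_I_mul_of_pos {a : ℝ} (ha : 0 < a) :
    Complex.log (-(Complex.I * a)) = Real.log a - Real.pi / 2 * Complex.I := by
  rw [mul_comm, ← mul_neg, Complex.log_ofReal_mul ha (neg_ne_zero.2 Complex.I_ne_zero),
    Complex.log_neg_I]
  ring

/-- Phase factor relating `(1 - x)^p` and `x^p (1 - 1/x)^p` on the imaginary axis. -/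
lemma one_sub_cpow_of_imag {a : ℝ} (ha : a ≠ 0) (p : ℂ) :
    (1 - Complex.I * a) ^ p = Complex.exp (-(SignType.sign a : ℝ) * Real.pi * Complex.I * p) *
      ((Complex.I * a) ^ p * (1 - (Complex.I * a)⁻¹) ^ p) := by
  have ha' : (a : ℂ) ≠ 0 := by exact_mod_cast ha
  have hx : Complex.I * a ≠ 0 := mul_ne_zero Complex.I_ne_zero ha'
  have hre : ((Complex.I * a)⁻¹).re = 0 := by simp
  have hne := one_sub_ne_zero hre
  have hne' : 1 - Complex.I * a ≠ 0 := one_sub_ne_zero (by simp)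
  -- The factor 1 - 1/x lies in the open right half-plane and -x on the imaginary axis, so their
  -- arguments sum to something in (-π, π) and the principal logarithm is additive on this product.
  -- Passing from log(-x) to log x costs the phase.
  have hfac : 1 - Complex.I * a = -(Complex.I * a) * (1 - (Complex.I * a)⁻¹) := by
    field_simp; ring
  have harg : |(1 - (Complex.I * a)⁻¹).arg| < Real.pi / 2 := by
    rw [Complex.abs_arg_lt_pi_div_two_iff]
    left
    rw [Complex.sub_re, hre]
    simp
  rw [abs_lt] at harg
  have hpi := Real.pi_pos
  have key : Complex.log (1 - Complex.I * a) = Complex.log (Complex.I * a) +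
      Complex.log (1 - (Complex.I * a)⁻¹) - (SignType.sign a : ℝ) * Real.pi * Complex.I := by
    rcases lt_or_gt_of_ne ha with h | h
    · have hb : 0 < -a := by linarith
      have e1 := log_I_mul_of_pos hb
      have e2 := log_neg_I_mul_of_pos hb
      have e3 : -(Complex.I * ((-a : ℝ) : ℂ)) = Complex.I * a := by push_cast; ring
      have e4 : Complex.I * ((-a : ℝ) : ℂ) = -(Complex.I * a) := by push_cast; ring
      rw [e3] at e2
      rw [e4] at e1
      have harg1 : (-(Complex.I * (a : ℂ))).arg = Real.pi / 2 := by
        rw [← Complex.log_im, e1]; simp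
      have hl := Complex.log_mul (neg_ne_zero.2 hx) hne
        (by rw [harg1]; constructor <;> linarith)
      rw [← hfac] at hl
      rw [hl, e1, e2, sign_neg h]
      simp only [SignType.coe_neg_one]
      push_cast; ring
    · have e1 := log_I_mul_of_pos h
      have e2 := log_neg_I_mul_of_pos h
      have harg1 : (-(Complex.I * (a : ℂ))).arg = -(Real.pi / 2) := by
        rw [← Complex.log_im, e2]; simp
      have hl := Complex.log_mul (neg_ne_zero.2 hx) hne
        (by rw [harg1]; constructor <;> linarith)
      rw [← hfac] at hl
      rw [hl, e1, e2, sign_pos h]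
      simp only [SignType.coe_one]
      push_cast; ring
  rw [Complex.cpow_def_of_ne_zero hne', Complex.cpow_def_of_ne_zero hx,
    Complex.cpow_def_of_ne_zero hne, key, ← Complex.exp_add, ← Complex.exp_add]
  congr 1
  ring

/-- For equal signs the two phases add up to ±(2πm - π), whose exponential is -1; for opposite signs
they cancel. This is the origin of the sign ± of the Appell sum in γ_±. -/
lemma exp_sign_add_sign {a b e : ℝ} (m : ℕ) (hab : (0 < e ∧ e = 1 ∧ 0 < a * b) ∨ (e = -1 ∧ a * b < 0)) :
    Complex.exp (-(SignType.sign a : ℝ) * Real.pi * Complex.I * (-((m : ℂ) - 1 / 2))) *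
      Complex.exp (-(SignType.sign b : ℝ) * Real.pi * Complex.I * (-((m : ℂ) - 1 / 2))) = -e := by
  rw [← Complex.exp_add]
  have h1 : Complex.exp (2 * Real.pi * Complex.I * m - Real.pi * Complex.I) = -1 := by
    rw [Complex.exp_sub, Complex.exp_pi_mul_I, mul_comm, Complex.exp_nat_mul_two_pi_mul_I]
    norm_num
  rcases hab with ⟨-, rfl, h⟩ | ⟨rfl, h⟩
  · rcases pos_and_pos_or_neg_and_neg_of_mul_pos h with ⟨ha, hb⟩ | ⟨ha, hb⟩
    · rw [sign_pos ha, sign_pos hb]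
      simp only [SignType.coe_one, Complex.ofReal_one]
      refine (congrArg Complex.exp ?_).trans h1
      ring
    · rw [sign_neg ha, sign_neg hb]
      have h2 : Complex.exp (-(2 * Real.pi * Complex.I * m - Real.pi * Complex.I)) = -1 := by
        rw [Complex.exp_neg, h1]; norm_num
      simp only [SignType.coe_neg_one, Complex.ofReal_neg, Complex.ofReal_one]
      refine (congrArg Complex.exp ?_).trans h2
      ring
  · have : SignType.sign a + SignType.sign b = (0 : ℝ) := by
      rcases mul_neg_iff.1 h with ⟨ha, hb⟩ | ⟨ha, hb⟩
      · rw [sign_pos ha, sign_neg hb]; simp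
      · rw [sign_neg ha, sign_pos hb]; simp
    have h3 : ((SignType.sign a : ℝ) : ℂ) + ((SignType.sign b : ℝ) : ℂ) = 0 := by
      exact_mod_cast this
    rw [show (-((SignType.sign a : ℝ) : ℂ) * Real.pi * Complex.I * (-((m : ℂ) - 1 / 2)) +
      -((SignType.sign b : ℝ) : ℂ) * Real.pi * Complex.I * (-((m : ℂ) - 1 / 2))) =
      (((SignType.sign a : ℝ) : ℂ) + ((SignType.sign b : ℝ) : ℂ)) *
        (Real.pi * Complex.I * (((m : ℂ) - 1 / 2))) by ring, h3]
    simp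

/-! ### Antiderivatives in the radial variable -/

section Radial

variable {α z r : ℝ}

lemma hasDerivAt_sq_add (z r : ℝ) : HasDerivAt (fun r : ℝ => r ^ 2 + z ^ 2) (2 * r) r := by
  simpa using (hasDerivAt_pow 2 r).add_const (z ^ 2)

lemma hasDerivAt_radial (p : ℝ) (hs : 0 < r ^ 2 + z ^ 2) :
    HasDerivAt (fun r : ℝ => (r ^ 2 + z ^ 2) ^ p)
      (2 * p * r / (r ^ 2 + z ^ 2) * (r ^ 2 + z ^ 2) ^ p) r := by
  refine ((hasDerivAt_sq_add z r).rpow_const (p := p) (Or.inl hs.ne')).congr_deriv ?_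
  rw [Real.rpow_sub_one hs.ne']
  ring

lemma HasDerivAt.pow_of_log {f : ℝ → ℂ} {k : ℂ} (h : HasDerivAt f (k * f r) r) (n : ℕ) :
    HasDerivAt (fun x => f x ^ n) (n * k * f r ^ n) r := by
  refine (h.fun_pow n).congr_deriv ?_
  rcases n with _ | n
  · simp
  · rw [Nat.add_sub_cancel, pow_succ]; ring

lemma HasDerivAt.one_sub_cpow {f : ℝ → ℂ} {f' : ℂ} (h : HasDerivAt f f' r) (hf : (f r).re = 0)
    (p : ℂ) : HasDerivAt (fun x => (1 - f x) ^ p) (p * (1 - f r) ^ (p - 1) * (-f')) r :=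
  HasDerivAt.comp (h₂ := fun z : ℂ => z ^ p) r
    (Complex.hasStrictDerivAt_cpow_const (one_sub_mem_slitPlane hf)).hasDerivAt (h.const_sub 1)

/-- Put s = r² + z², ρ = s^(α/2) and X = jA s^(-α/2), so that 1/X = ρ/(jA). The factor s X^(l-1) (1
- X)^(1-d) is, up to a constant, an integrating factor of the differential equation in ρ of the
Euler integral, because its two parameters differ by d - 1. All terms containing the Euler integral
therefore cancel and only the inhomogeneous term 1 survives. -/
lemma hasDerivAt_gauss_radial (hα : 0 < α) (hs : 0 < r ^ 2 + z ^ 2) {A : ℝ} (hA : A ≠ 0)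
    (d : ℝ) (l : ℕ) (hb : 0 < d - l + 2 / α) :
    HasDerivAt (fun r : ℝ => ((r ^ 2 + z ^ 2 : ℝ) : ℂ) / α *
      ((Complex.I * ((A * (r ^ 2 + z ^ 2) ^ (-α / 2) : ℝ) : ℂ)) ^ l *
        (1 - Complex.I * ((A * (r ^ 2 + z ^ 2) ^ (-α / 2) : ℝ) : ℂ)) ^ (1 - d : ℂ) *
        ((((r ^ 2 + z ^ 2) ^ (α / 2) : ℝ) : ℂ) * (Complex.I * A)⁻¹ *
        eulerInt (d - l + 2 / α) (-(1 - l + 2 / α))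
          ((((r ^ 2 + z ^ 2) ^ (α / 2) : ℝ) : ℂ) * (Complex.I * A)⁻¹))))
      (-(r * ((Complex.I * ((A * (r ^ 2 + z ^ 2) ^ (-α / 2) : ℝ) : ℂ)) ^ l *
        (1 - Complex.I * ((A * (r ^ 2 + z ^ 2) ^ (-α / 2) : ℝ) : ℂ)) ^ (-d : ℂ)))) r := by
  have hA' : (A : ℂ) ≠ 0 := by exact_mod_cast hA
  set w : ℂ := (Complex.I * A)⁻¹ with hwdef
  have hw : w.re = 0 := by simp [hwdef]
  set b := d - l + 2 / α with hbdef
  set a : ℝ := 1 - l + 2 / α with hadef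
  have hS := (hasDerivAt_sq_add z r).ofReal_comp
  have hR := (hasDerivAt_radial (α / 2) hs)
  have hX' : HasDerivAt (fun r : ℝ => Complex.I * ((A * (r ^ 2 + z ^ 2) ^ (-α / 2) : ℝ) : ℂ))
      (((-(α * r / (r ^ 2 + z ^ 2)) : ℝ) : ℂ) *
        (Complex.I * ((A * (r ^ 2 + z ^ 2) ^ (-α / 2) : ℝ) : ℂ))) r := by
    refine (((hasDerivAt_radial (-α / 2) hs).const_mul A).ofReal_comp.const_mul
      Complex.I).congr_deriv ?_
    push_cast
    ring
  obtain ⟨D, hD, hode⟩ := exists_hasDerivAt_eulerInt hb a hw ((r ^ 2 + z ^ 2) ^ (α / 2))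
  have hE := hD.scomp r hR
  have hX1 := HasDerivAt.pow_of_log hX' l
  have hX2 := HasDerivAt.one_sub_cpow hX' (by simp) (1 - d : ℂ)
  have hRw := hR.ofReal_comp.mul_const w
  have hall := (hS.div_const (α : ℂ)).mul ((hX1.mul hX2).mul (hRw.mul hE))
  refine hall.congr_deriv ?_
  -- The argument of the Euler integral is the reciprocal of X; with the differential equation
  -- `hode` this is all that the final cancellation uses.
  have hX0 : (Complex.I * ((A * (r ^ 2 + z ^ 2) ^ (-α / 2) : ℝ) : ℂ)) *
      ((((r ^ 2 + z ^ 2) ^ (α / 2) : ℝ) : ℂ) * w) = 1 := by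
    have : (r ^ 2 + z ^ 2) ^ (-α / 2) * (r ^ 2 + z ^ 2) ^ (α / 2) = 1 := by
      rw [← Real.rpow_add hs]; simp [neg_div]
    rw [neg_div] at this ⊢
    have h2 : (((r ^ 2 + z ^ 2) ^ (-(α / 2)) : ℝ) : ℂ) * (((r ^ 2 + z ^ 2) ^ (α / 2) : ℝ) : ℂ) = 1 := by
      exact_mod_cast this
    rw [hwdef, Complex.ofReal_mul]
    field_simp
    exact h2
  have hpow : (1 - Complex.I * ((A * (r ^ 2 + z ^ 2) ^ (-α / 2) : ℝ) : ℂ)) ^ (1 - d : ℂ) =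
      (1 - Complex.I * ((A * (r ^ 2 + z ^ 2) ^ (-α / 2) : ℝ) : ℂ)) ^ (-d : ℂ) *
      (1 - Complex.I * ((A * (r ^ 2 + z ^ 2) ^ (-α / 2) : ℝ) : ℂ)) := by
    have hne : 1 - Complex.I * ((A * (r ^ 2 + z ^ 2) ^ (-α / 2) : ℝ) : ℂ) ≠ 0 :=
      one_sub_ne_zero (by simp)
    rw [show (1 : ℂ) - d = -d + 1 by ring, Complex.cpow_add _ _ hne, Complex.cpow_one]
  have e1 : (1 : ℂ) - d - 1 = -d := by ring
  simp only [Pi.mul_apply, Function.comp_apply]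
  rw [e1, hpow]
  have hsC : ((r ^ 2 + z ^ 2 : ℝ) : ℂ) ≠ 0 := by exact_mod_cast hs.ne'
  have hαC : (α : ℂ) ≠ 0 := by exact_mod_cast hα.ne'
  have haC : (a : ℂ) = 1 - l + 2 / α := by rw [hadef]; push_cast; ring
  have hbC : (b : ℂ) = d - l + 2 / α := by rw [hbdef]; push_cast; ring
  rw [haC, hbC] at hode
  generalize eulerInt b (-a) ((((r ^ 2 + z ^ 2) ^ (α / 2) : ℝ) : ℂ) * w) = E at *
  generalize (1 - Complex.I * ((A * (r ^ 2 + z ^ 2) ^ (-α / 2) : ℝ) : ℂ)) ^ (-d : ℂ) = Y at *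
  generalize Complex.I * ((A * (r ^ 2 + z ^ 2) ^ (-α / 2) : ℝ) : ℂ) = X at *
  rw [Complex.real_smul]
  push_cast at *
  generalize (((r ^ 2 + z ^ 2) ^ (α / 2) : ℝ) : ℂ) = ρ at *
  generalize (r : ℂ) ^ 2 + (z : ℂ) ^ 2 = s at *
  generalize X ^ l = Z at *
  linear_combination (norm := (field_simp; ring)) Z * Y * r *
    ((-(E * (2 / α - l + 1)) + (1 - d) * E - ρ * D) * hX0 - hode)

end Radial

end EMFE


/-! ### Appell's integral as an incomplete integral in the radial variable. -/

namespace EMFE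

/-- Substituting v = tρ absorbs ρ^a and leaves ρ only as the upper limit, ready for the fundamental
theorem of calculus. -/
lemma rpow_mul_integral_comp_mul {a : ℝ} {ρ : ℝ} (hρ : 0 < ρ) (H : ℝ → ℂ) :
    ((ρ ^ a : ℝ) : ℂ) * ∫ t in (0 : ℝ)..1, ((t ^ (a - 1) : ℝ) : ℂ) * H (t * ρ) =
      ∫ v in (0 : ℝ)..ρ, ((v ^ (a - 1) : ℝ) : ℂ) * H v := by
  have h := intervalIntegral.smul_integral_comp_mul_right (a := 0) (b := 1)
    (fun v : ℝ => ((v ^ (a - 1) : ℝ) : ℂ) * H v) ρ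
  rw [zero_mul, one_mul] at h
  rw [← h, Complex.real_smul, ← intervalIntegral.integral_const_mul,
    ← intervalIntegral.integral_const_mul]
  refine intervalIntegral.integral_congr fun t ht => ?_
  rw [Set.uIcc_of_le zero_le_one] at ht
  have e : ρ ^ a = ρ * ρ ^ (a - 1) := by
    rw [mul_comm, ← Real.rpow_add_one hρ.ne', sub_add_cancel]
  simp only [Real.mul_rpow ht.1 hρ.le, e]
  push_cast
  ring

lemma hasDerivAt_integral_rpow_mul {a : ℝ} (ha : 0 < a) {H : ℝ → ℂ} (hH : Continuous H)
    {ρ : ℝ} (hρ : 0 < ρ) :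
    HasDerivAt (fun ρ => ∫ v in (0 : ℝ)..ρ, ((v ^ (a - 1) : ℝ) : ℂ) * H v)
      (((ρ ^ (a - 1) : ℝ) : ℂ) * H ρ) ρ := by
  have hm : Measurable (fun v : ℝ => ((v ^ (a - 1) : ℝ) : ℂ) * H v) :=
    (Complex.measurable_ofReal.comp (measurable_id.pow_const _)).mul hH.measurable
  refine intervalIntegral.integral_hasDerivAt_right ?_
    (hm.stronglyMeasurable.stronglyMeasurableAtFilter) ?_
  · have h : IntervalIntegrable (fun v : ℝ => v ^ (a - 1)) volume 0 ρ :=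
      intervalIntegral.intervalIntegrable_rpow' (by linarith)
    exact IntervalIntegrable.mul_continuousOn ⟨h.1.ofReal, h.2.ofReal⟩ hH.continuousOn
  · exact (Complex.continuous_ofReal.continuousAt.comp
      (Real.continuousAt_rpow_const _ _ (Or.inl hρ.ne'))).mul hH.continuousAt

section Radial

variable {α z r : ℝ}

lemma imag_scaled_cpow {s A : ℝ} (hs : 0 < s) (hA : A ≠ 0) (d : ℝ) :
    (Complex.I * ((A * s ^ (-α / 2) : ℝ) : ℂ)) ^ (-d : ℂ) =
      ((s ^ (α / 2 * d) : ℝ) : ℂ) * (Complex.I * A) ^ (-d : ℂ) := by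
  have hA' : (A : ℂ) ≠ 0 := by exact_mod_cast hA
  have hpos := Real.rpow_pos_of_pos hs (-α / 2)
  have e : Complex.I * ((A * s ^ (-α / 2) : ℝ) : ℂ) =
      ((s ^ (-α / 2) : ℝ) : ℂ) * (Complex.I * A) := by push_cast; ring
  rw [e, ofReal_mul_cpow hpos (mul_ne_zero Complex.I_ne_zero hA')]
  congr 1
  rw [← Complex.ofReal_neg, ← Complex.ofReal_cpow hpos.le, ← Real.rpow_mul hs.le]
  congr 2
  ring

/-- The dependence of the prefactor on s is a single power, since 1 + αd - (α/2)(l + l') = (α/2) a.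
Principal powers split here because s^(-α/2) is a positive real factor. -/
lemma appell_radial_eq (hα : 0 < α) {s : ℝ} (hs : 0 < s) {A B : ℝ} (hA : A ≠ 0) (hB : B ≠ 0)
    (d : ℝ) (l l' : ℕ) {a : ℝ} (ha : a = 2 * d - l - l' + 2 / α) :
    (s : ℂ) * ((Complex.I * ((A * s ^ (-α / 2) : ℝ) : ℂ)) ^ l *
        (Complex.I * ((B * s ^ (-α / 2) : ℝ) : ℂ)) ^ l' *
        ((Complex.I * ((A * s ^ (-α / 2) : ℝ) : ℂ)) ^ (-d : ℂ) *
          (Complex.I * ((B * s ^ (-α / 2) : ℝ) : ℂ)) ^ (-d : ℂ))) =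
      (((s ^ (α / 2)) ^ a : ℝ) : ℂ) * ((Complex.I * A) ^ l * (Complex.I * B) ^ l' *
        ((Complex.I * A) ^ (-d : ℂ) * (Complex.I * B) ^ (-d : ℂ))) := by
  rw [imag_scaled_cpow hs hA, imag_scaled_cpow hs hB]
  have e : (s ^ (α / 2)) ^ a = s * (s ^ (-α / 2)) ^ l * (s ^ (-α / 2)) ^ l' *
      s ^ (α / 2 * d) * s ^ (α / 2 * d) := by
    rw [← Real.rpow_mul hs.le, ← Real.rpow_natCast, ← Real.rpow_natCast, ← Real.rpow_mul hs.le,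
      ← Real.rpow_mul hs.le]
    nth_rewrite 2 [← Real.rpow_one s]
    rw [← Real.rpow_add hs, ← Real.rpow_add hs, ← Real.rpow_add hs, ← Real.rpow_add hs]
    congr 1
    rw [ha]
    field_simp
    ring
  rw [e]
  push_cast
  ring

/-- By `appell_radial_eq` and rescaling, the function is a constant multiple of ∫₀^ρ v^(a-1) H(v) dv
with ρ = (r² + z²)^(α/2). Its derivative follows from the fundamental theorem and is then rewritten
through 1/X = ρ/(jA). -/
lemma hasDerivAt_appell_radial (hα : 0 < α) (hs : 0 < r ^ 2 + z ^ 2) {A B : ℝ} (hA : A ≠ 0)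
    (hB : B ≠ 0) (d : ℝ) (l l' : ℕ) {a : ℝ} (ha : a = 2 * d - l - l' + 2 / α) (ha0 : 0 < a) :
    HasDerivAt (fun r : ℝ => ((r ^ 2 + z ^ 2 : ℝ) : ℂ) / α *
      ((Complex.I * ((A * (r ^ 2 + z ^ 2) ^ (-α / 2) : ℝ) : ℂ)) ^ l *
        (Complex.I * ((B * (r ^ 2 + z ^ 2) ^ (-α / 2) : ℝ) : ℂ)) ^ l' *
        ((Complex.I * ((A * (r ^ 2 + z ^ 2) ^ (-α / 2) : ℝ) : ℂ)) ^ (-d : ℂ) *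
          (Complex.I * ((B * (r ^ 2 + z ^ 2) ^ (-α / 2) : ℝ) : ℂ)) ^ (-d : ℂ)) *
        ∫ t in (0 : ℝ)..1, ((t ^ (a - 1) : ℝ) : ℂ) *
          ((1 - (t : ℂ) * ((((r ^ 2 + z ^ 2) ^ (α / 2) : ℝ) : ℂ) * (Complex.I * A)⁻¹)) ^ (-d : ℂ) *
            (1 - (t : ℂ) * ((((r ^ 2 + z ^ 2) ^ (α / 2) : ℝ) : ℂ) * (Complex.I * B)⁻¹)) ^ (-d : ℂ))))
      (r * ((Complex.I * ((A * (r ^ 2 + z ^ 2) ^ (-α / 2) : ℝ) : ℂ)) ^ l *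
        (Complex.I * ((B * (r ^ 2 + z ^ 2) ^ (-α / 2) : ℝ) : ℂ)) ^ l' *
        (((Complex.I * ((A * (r ^ 2 + z ^ 2) ^ (-α / 2) : ℝ) : ℂ)) ^ (-d : ℂ) *
          (1 - (Complex.I * ((A * (r ^ 2 + z ^ 2) ^ (-α / 2) : ℝ) : ℂ))⁻¹) ^ (-d : ℂ)) *
          ((Complex.I * ((B * (r ^ 2 + z ^ 2) ^ (-α / 2) : ℝ) : ℂ)) ^ (-d : ℂ) *
          (1 - (Complex.I * ((B * (r ^ 2 + z ^ 2) ^ (-α / 2) : ℝ) : ℂ))⁻¹) ^ (-d : ℂ))))) r := by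
  set C : ℂ := (Complex.I * A) ^ l * (Complex.I * B) ^ l' *
        ((Complex.I * A) ^ (-d : ℂ) * (Complex.I * B) ^ (-d : ℂ)) with hC
  have hw (D : ℝ) : ((Complex.I * (D : ℂ))⁻¹).re = 0 := by simp
  set H : ℝ → ℂ := fun v => (1 - (v : ℂ) * (Complex.I * A)⁻¹) ^ (-d : ℂ) *
    (1 - (v : ℂ) * (Complex.I * B)⁻¹) ^ (-d : ℂ) with hH
  have hHc : Continuous H := (continuous_one_sub_cpow (hw A) _).mul (continuous_one_sub_cpow (hw B) _)
  have hρ : 0 < (r ^ 2 + z ^ 2) ^ (α / 2) := Real.rpow_pos_of_pos hs _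
  have hV := (hasDerivAt_integral_rpow_mul ha0 hHc hρ).scomp r (hasDerivAt_radial (α / 2) hs)
  have hV' := hV.const_mul (C / α)
  have hev : ∀ᶠ y in 𝓝 r, 0 < y ^ 2 + z ^ 2 :=
    (hasDerivAt_sq_add z r).continuousAt.eventually (lt_mem_nhds hs)
  refine (hV'.congr_of_eventuallyEq ?_).congr_deriv ?_
  · filter_upwards [hev] with y hy
    have hρy : 0 < (y ^ 2 + z ^ 2) ^ (α / 2) := Real.rpow_pos_of_pos hy _
    have e1 := appell_radial_eq hα hy hA hB d l l' ha
    have e2 := rpow_mul_integral_comp_mul (a := a) hρy H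
    simp only [Function.comp_apply]
    rw [← e2]
    have e3 : (fun t : ℝ => ((t ^ (a - 1) : ℝ) : ℂ) * H (t * (y ^ 2 + z ^ 2) ^ (α / 2))) =
        fun t : ℝ => ((t ^ (a - 1) : ℝ) : ℂ) *
          ((1 - (t : ℂ) * ((((y ^ 2 + z ^ 2) ^ (α / 2) : ℝ) : ℂ) * (Complex.I * A)⁻¹)) ^ (-d : ℂ) *
          (1 - (t : ℂ) * ((((y ^ 2 + z ^ 2) ^ (α / 2) : ℝ) : ℂ) * (Complex.I * B)⁻¹)) ^ (-d : ℂ)) := by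
      funext t
      simp only [hH, Complex.ofReal_mul, mul_assoc]
    rw [e3]
    generalize (∫ t in (0 : ℝ)..1, ((t ^ (a - 1) : ℝ) : ℂ) *
          ((1 - (t : ℂ) * ((((y ^ 2 + z ^ 2) ^ (α / 2) : ℝ) : ℂ) * (Complex.I * A)⁻¹)) ^ (-d : ℂ) *
          (1 - (t : ℂ) * ((((y ^ 2 + z ^ 2) ^ (α / 2) : ℝ) : ℂ) * (Complex.I * B)⁻¹)) ^ (-d : ℂ))) = J
    linear_combination (J / α) * e1
  · have e1 := appell_radial_eq hα hs hA hB d l l' ha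
    have e4 (D : ℝ) : (Complex.I * ((D * (r ^ 2 + z ^ 2) ^ (-α / 2) : ℝ) : ℂ))⁻¹ =
        (((r ^ 2 + z ^ 2) ^ (α / 2) : ℝ) : ℂ) * (Complex.I * D)⁻¹ := by
      rw [neg_div, Real.rpow_neg hs.le]
      push_cast
      rw [mul_inv, mul_inv, mul_inv, inv_inv]
      ring
    rw [e4, e4]
    have e5 : ((r ^ 2 + z ^ 2) ^ (α / 2)) ^ a =
        ((r ^ 2 + z ^ 2) ^ (α / 2)) ^ (a - 1) * (r ^ 2 + z ^ 2) ^ (α / 2) := by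
      rw [← Real.rpow_add_one hρ.ne', sub_add_cancel]
    rw [e5] at e1
    have hsC : ((r ^ 2 + z ^ 2 : ℝ) : ℂ) ≠ 0 := by exact_mod_cast hs.ne'
    have hαC : (α : ℂ) ≠ 0 := by exact_mod_cast hα.ne'
    rw [Complex.real_smul]
    simp only [hH]
    generalize (1 - (((r ^ 2 + z ^ 2) ^ (α / 2) : ℝ) : ℂ) * (Complex.I * A)⁻¹) ^ (-d : ℂ) = h1
    generalize (1 - (((r ^ 2 + z ^ 2) ^ (α / 2) : ℝ) : ℂ) * (Complex.I * B)⁻¹) ^ (-d : ℂ) = h2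
    generalize (Complex.I * ((A * (r ^ 2 + z ^ 2) ^ (-α / 2) : ℝ) : ℂ)) ^ (-d : ℂ) = x1 at *
    generalize (Complex.I * ((B * (r ^ 2 + z ^ 2) ^ (-α / 2) : ℝ) : ℂ)) ^ (-d : ℂ) = x2 at *
    generalize (Complex.I * ((A * (r ^ 2 + z ^ 2) ^ (-α / 2) : ℝ) : ℂ)) ^ l = x3 at *
    generalize (Complex.I * ((B * (r ^ 2 + z ^ 2) ^ (-α / 2) : ℝ) : ℂ)) ^ l' = x4 at *
    rw [← hC] at e1
    clear_value C
    generalize hR : (r ^ 2 + z ^ 2) ^ (α / 2) = R at *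
    rw [Complex.ofReal_mul] at e1
    generalize ((R ^ (a - 1) : ℝ) : ℂ) = Q at *
    push_cast at *
    linear_combination (norm := (field_simp; ring)) (-(r * h1 * h2) / ((r : ℂ) ^ 2 + (z : ℂ) ^ 2)) * e1

end Radial

end EMFE


/-! ### The terms of the closed form and their radial derivatives. -/

namespace EMFE

/-- With second parameter 1 the power of t in Euler's integral disappears, and the Gamma quotient
collapses to b. -/
lemma gaussF_one_right {a b : ℝ} (hb : 0 < b) (w : ℂ) :
    gaussF a 1 (b + 1) w = b * eulerInt b (-a) w := by
  have hG : Real.Gamma (b + 1) / (Real.Gamma 1 * Real.Gamma (b + 1 - 1)) = b := by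
    rw [add_sub_cancel_right, Real.Gamma_one, one_mul, Real.Gamma_add_one hb.ne',
      mul_div_cancel_right₀ _ (Real.Gamma_pos_of_pos hb).ne']
  rw [gaussF, hG, eulerInt]
  congr 1
  refine intervalIntegral.integral_congr fun t _ => ?_
  simp only [sub_self, Real.rpow_zero, one_mul, add_sub_cancel_right, Complex.ofReal_neg,
    Complex.cpow_neg]
  rw [div_eq_mul_inv]

/-- Since c - a = 1, the power of 1 - t disappears and the Gamma quotient collapses to a. -/
lemma appellF_succ {a d : ℝ} (ha : 0 < a) (w₁ w₂ : ℂ) :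
    appellF a d d (a + 1) w₁ w₂ = a * ∫ t in (0 : ℝ)..1, ((t ^ (a - 1) : ℝ) : ℂ) *
      ((1 - (t : ℂ) * w₁) ^ (-d : ℂ) * (1 - (t : ℂ) * w₂) ^ (-d : ℂ)) := by
  have hG : Real.Gamma (a + 1) / (Real.Gamma a * Real.Gamma (a + 1 - a)) = a := by
    rw [add_sub_cancel_left, Real.Gamma_one, mul_one, Real.Gamma_add_one ha.ne',
      mul_div_cancel_right₀ _ (Real.Gamma_pos_of_pos ha).ne']
  rw [appellF, hG]
  congr 1
  refine intervalIntegral.integral_congr fun t _ => ?_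
  simp only [add_sub_cancel_left, sub_self, Real.rpow_zero, mul_one, Complex.cpow_neg]
  rw [div_eq_mul_inv, mul_inv]

namespace Params

variable (P : Params)

/-- Coefficient of `(r² + z²)^(-α/2)` in the argument `q χ_k S̄ᵣ(r) / m`. -/
noncomputable def amp (k : ℕ) (q : ℝ) : ℝ := q * P.chi k * P.Pt / (4 * Real.pi * P.m)

/-- `m - 1/2`. -/
noncomputable def halfShape : ℝ := P.m - 1 / 2

/-- `6 / (N π)`, the probability of one lobe. -/
noncomputable def lobeProb : ℝ := 6 / (P.N * Real.pi)

/-- The characteristic function of `G |h|²` restricted to lobe `k`, at `q S̄ᵣ(r)`. -/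
noncomputable def lobeChar (k : ℕ) (q r : ℝ) : ℂ :=
  ∑ l ∈ Finset.range P.m, (P.coef l : ℂ) *
    (P.jarg k r q ^ l * (1 - P.jarg k r q) ^ (-(P.halfShape : ℂ)))

/-- The characteristic function of the contribution of a station at distance `r`. -/
noncomputable def stationChar (q r : ℝ) : ℂ :=
  ((1 - P.lobeProb * (1 + P.kmax) : ℝ) : ℂ) +
    P.lobeProb * ∑ k ∈ Finset.range (P.kmax + 1), P.lobeChar k q r

lemma alpha_pos : 0 < P.alpha := by linarith [P.two_lt_alpha]

lemma m_pos : (0 : ℝ) < P.m := by exact_mod_cast P.one_le_m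

lemma kappa_pos : 0 < P.kappa := by
  have := P.freq_pos
  have := P.c0_pos
  have := Real.pi_pos
  unfold kappa; positivity

lemma Sbar_eq (r : ℝ) : P.Sbar r = P.Pt / (4 * Real.pi) * (r ^ 2 + P.z ^ 2) ^ (-P.alpha / 2) := by
  have := P.kappa_pos.ne'
  rw [Sbar, pathLoss]
  field_simp

lemma jarg_eq (k : ℕ) (r q : ℝ) :
    P.jarg k r q = Complex.I * ((P.amp k q * (r ^ 2 + P.z ^ 2) ^ (-P.alpha / 2) : ℝ) : ℂ) := by
  rw [jarg, Sbar_eq, amp]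
  congr 2
  have := P.m_pos.ne'
  field_simp

lemma jarg_inv (k : ℕ) {r : ℝ} (hs : 0 < r ^ 2 + P.z ^ 2) (q : ℝ) :
    (P.jarg k r q)⁻¹ =
      (((r ^ 2 + P.z ^ 2) ^ (P.alpha / 2) : ℝ) : ℂ) * (Complex.I * P.amp k q)⁻¹ := by
  rw [jarg_eq, neg_div, Real.rpow_neg hs.le]
  push_cast
  rw [mul_inv, mul_inv, mul_inv, inv_inv]
  ring

lemma jarg_ne_zero {k : ℕ} {r q : ℝ} (hs : 0 < r ^ 2 + P.z ^ 2) (hA : P.amp k q ≠ 0) :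
    P.jarg k r q ≠ 0 := by
  rw [jarg_eq]
  refine mul_ne_zero Complex.I_ne_zero ?_
  exact_mod_cast mul_ne_zero hA (Real.rpow_pos_of_pos hs _).ne'

lemma gauss_exponent_pos {l : ℕ} (hl : l < P.m) : 0 < P.halfShape - l + 2 / P.alpha := by
  have h1 : (l : ℝ) + 1 ≤ P.m := by exact_mod_cast hl
  have h2 : 0 < 2 / P.alpha := div_pos two_pos P.alpha_pos
  rw [halfShape]; linarith

lemma gaussTerm_eq {k l : ℕ} (hl : l < P.m) {r q : ℝ} (hs : 0 < r ^ 2 + P.z ^ 2)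
    (hA : P.amp k q ≠ 0) :
    ((2 * (r ^ 2 + P.z ^ 2) / (4 + P.alpha * (2 * P.m - 2 * l - 1)) : ℝ) : ℂ) *
      P.gaussTerm k l r q =
    ((r ^ 2 + P.z ^ 2 : ℝ) : ℂ) / P.alpha *
      ((Complex.I * ((P.amp k q * (r ^ 2 + P.z ^ 2) ^ (-P.alpha / 2) : ℝ) : ℂ)) ^ l *
        (1 - Complex.I * ((P.amp k q * (r ^ 2 + P.z ^ 2) ^ (-P.alpha / 2) : ℝ) : ℂ)) ^
          (1 - P.halfShape : ℂ) *
        ((((r ^ 2 + P.z ^ 2) ^ (P.alpha / 2) : ℝ) : ℂ) * (Complex.I * P.amp k q)⁻¹ *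
        eulerInt (P.halfShape - l + 2 / P.alpha) (-(1 - l + 2 / P.alpha))
          ((((r ^ 2 + P.z ^ 2) ^ (P.alpha / 2) : ℝ) : ℂ) * (Complex.I * P.amp k q)⁻¹))) := by
  have hb := P.gauss_exponent_pos hl
  have hα := P.alpha_pos
  have hx := P.jarg_ne_zero hs hA
  have hc : (1 / 2 - l + P.m + 2 / P.alpha : ℝ) = (P.halfShape - l + 2 / P.alpha) + 1 := by
    rw [halfShape]; ring
  -- The denominator of the closed form is 2α times the parameter b of the Euler integral, so it
  -- cancels the factor b coming from the Gamma quotient.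
  have hden : 4 + P.alpha * (2 * P.m - 2 * l - 1) =
      2 * P.alpha * (P.halfShape - l + 2 / P.alpha) := by
    rw [halfShape]; field_simp; ring
  rw [gaussTerm, hc, gaussF_one_right hb, hden, ← P.jarg_inv k hs, ← P.jarg_eq]
  have hz : P.jarg k r q ^ (1 - (l : ℤ)) = P.jarg k r q / P.jarg k r q ^ l := by
    rw [zpow_sub₀ hx, zpow_one, zpow_natCast]
  have hp : (1 - P.halfShape : ℂ) = -((P.m : ℂ) - 3 / 2) := by
    rw [halfShape]; push_cast; ring
  rw [hz, hp, Complex.cpow_neg]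
  have hne : (1 - P.jarg k r q) ^ ((P.m : ℂ) - 3 / 2) ≠ 0 := by
    rw [Complex.cpow_ne_zero_iff]
    left
    rw [jarg_eq]
    exact one_sub_ne_zero (by simp)
  generalize eulerInt (P.halfShape - l + 2 / P.alpha) (-(1 - l + 2 / P.alpha))
    (P.jarg k r q)⁻¹ = E
  generalize P.halfShape - l + 2 / P.alpha = b at *
  have hbC : (b : ℂ) ≠ 0 := by exact_mod_cast hb.ne'
  have hαC : (P.alpha : ℂ) ≠ 0 := by exact_mod_cast hα.ne'
  push_cast
  field_simp

lemma appellTerm_eq {k p l l' : ℕ} (hl : l < P.m) (hl' : l' < P.m) {r q q' : ℝ}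
    (hs : 0 < r ^ 2 + P.z ^ 2) (hA : P.amp k q ≠ 0) (hB : P.amp p q' ≠ 0) :
    ((r ^ 2 + P.z ^ 2 : ℝ) : ℂ) * P.appellTerm k p l l' r q q' =
      ((r ^ 2 + P.z ^ 2 : ℝ) : ℂ) / P.alpha *
      ((Complex.I * ((P.amp k q * (r ^ 2 + P.z ^ 2) ^ (-P.alpha / 2) : ℝ) : ℂ)) ^ l *
        (Complex.I * ((P.amp p q' * (r ^ 2 + P.z ^ 2) ^ (-P.alpha / 2) : ℝ) : ℂ)) ^ l' *
        ((Complex.I * ((P.amp k q * (r ^ 2 + P.z ^ 2) ^ (-P.alpha / 2) : ℝ) : ℂ)) ^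
            (-P.halfShape : ℂ) *
          (Complex.I * ((P.amp p q' * (r ^ 2 + P.z ^ 2) ^ (-P.alpha / 2) : ℝ) : ℂ)) ^
            (-P.halfShape : ℂ)) *
        ∫ t in (0 : ℝ)..1, ((t ^ (2 * P.halfShape - l - l' + 2 / P.alpha - 1) : ℝ) : ℂ) *
          ((1 - (t : ℂ) * ((((r ^ 2 + P.z ^ 2) ^ (P.alpha / 2) : ℝ) : ℂ) *
              (Complex.I * P.amp k q)⁻¹)) ^ (-P.halfShape : ℂ) *
            (1 - (t : ℂ) * ((((r ^ 2 + P.z ^ 2) ^ (P.alpha / 2) : ℝ) : ℂ) *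
              (Complex.I * P.amp p q')⁻¹)) ^ (-P.halfShape : ℂ))) := by
  have hb := P.gauss_exponent_pos hl
  have hb' := P.gauss_exponent_pos hl'
  have hα := P.alpha_pos
  have hx := P.jarg_ne_zero hs hA
  have hy := P.jarg_ne_zero hs hB
  have h1' : (l' : ℝ) + 1 ≤ P.m := by exact_mod_cast hl'
  have hd : (P.m : ℝ) - 1 / 2 = P.halfShape := rfl
  have ha0 : 0 < 2 * P.halfShape - l - l' + 2 / P.alpha := by
    linarith
  have h1 : (2 * P.m - 1 - l - l' + 2 / P.alpha : ℝ) = 2 * P.halfShape - l - l' + 2 / P.alpha := by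
    rw [← hd]; ring
  have h2 : (2 * P.m - l - l' + 2 / P.alpha : ℝ) =
      (2 * P.halfShape - l - l' + 2 / P.alpha) + 1 := by
    rw [← hd]; ring
  -- Likewise this denominator is α times the first Appell parameter, which is the value of the
  -- Gamma quotient.
  have hden : 2 + P.alpha * (2 * P.m - 1 - l - l') =
      P.alpha * (2 * P.halfShape - l - l' + 2 / P.alpha) := by
    rw [← hd]; field_simp; ring
  rw [appellTerm, h1, h2, hd, appellF_succ ha0, hden, ← P.jarg_inv k hs, ← P.jarg_inv p hs,
    ← P.jarg_eq, ← P.jarg_eq]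
  have hp (l : ℕ) : (P.m : ℂ) - l - 1 / 2 = P.halfShape - l := by
    rw [halfShape]; push_cast; ring
  have hz : P.jarg k r q ^ ((P.m : ℂ) - l - 1 / 2) =
      P.jarg k r q ^ (P.halfShape : ℂ) / P.jarg k r q ^ l := by
    rw [hp, Complex.cpow_sub _ _ hx, Complex.cpow_natCast]
  have hz' : P.jarg p r q' ^ ((P.m : ℂ) - l' - 1 / 2) =
      P.jarg p r q' ^ (P.halfShape : ℂ) / P.jarg p r q' ^ l' := by
    rw [hp, Complex.cpow_sub _ _ hy, Complex.cpow_natCast]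
  rw [hz, hz', Complex.cpow_neg, Complex.cpow_neg]
  have hne : P.jarg k r q ^ (P.halfShape : ℂ) ≠ 0 := by
    rw [Complex.cpow_ne_zero_iff]; exact Or.inl hx
  have hne' : P.jarg p r q' ^ (P.halfShape : ℂ) ≠ 0 := by
    rw [Complex.cpow_ne_zero_iff]; exact Or.inl hy
  generalize (∫ t in (0 : ℝ)..1, ((t ^ (2 * P.halfShape - l - l' + 2 / P.alpha - 1) : ℝ) : ℂ) *
          ((1 - (t : ℂ) * (P.jarg k r q)⁻¹) ^ (-P.halfShape : ℂ) *
            (1 - (t : ℂ) * (P.jarg p r q')⁻¹) ^ (-P.halfShape : ℂ))) = J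
  generalize 2 * P.halfShape - l - l' + 2 / P.alpha = a at *
  have haC : (a : ℂ) ≠ 0 := by exact_mod_cast ha0.ne'
  have hαC : (P.alpha : ℂ) ≠ 0 := by exact_mod_cast hα.ne'
  push_cast
  field_simp

lemma eventually_sq_add_pos {z r : ℝ} (hs : 0 < r ^ 2 + z ^ 2) :
    ∀ᶠ y in 𝓝 r, 0 < y ^ 2 + z ^ 2 :=
  (hasDerivAt_sq_add z r).continuousAt.eventually (lt_mem_nhds hs)

lemma hasDerivAt_gaussTerm {k l : ℕ} (hl : l < P.m) {r q : ℝ} (hs : 0 < r ^ 2 + P.z ^ 2)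
    (hA : P.amp k q ≠ 0) :
    HasDerivAt (fun r => ((2 * (r ^ 2 + P.z ^ 2) / (4 + P.alpha * (2 * P.m - 2 * l - 1)) : ℝ) : ℂ) *
      P.gaussTerm k l r q)
      (-(r * (P.jarg k r q ^ l * (1 - P.jarg k r q) ^ (-(P.halfShape : ℂ))))) r := by
  have h := hasDerivAt_gauss_radial P.alpha_pos hs hA P.halfShape l (P.gauss_exponent_pos hl)
  rw [← P.jarg_eq] at h
  refine h.congr_of_eventuallyEq ?_
  filter_upwards [eventually_sq_add_pos hs] with y hy
  exact P.gaussTerm_eq hl hy hA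

/-- The incomplete integral differentiates to powers x^(-d) (1 - 1/x)^(-d) with d = m - 1/2.
Replacing both by (1 - x)^(-d) costs one phase each, and the product of the phases is -e. -/
lemma hasDerivAt_appellTerm {k p l l' : ℕ} (hl : l < P.m) (hl' : l' < P.m) {r q q' e : ℝ}
    (hs : 0 < r ^ 2 + P.z ^ 2) (hA : P.amp k q ≠ 0) (hB : P.amp p q' ≠ 0)
    (he : (0 < e ∧ e = 1 ∧ 0 < P.amp k q * P.amp p q') ∨ (e = -1 ∧ P.amp k q * P.amp p q' < 0)) :
    HasDerivAt (fun r => ((r ^ 2 + P.z ^ 2 : ℝ) : ℂ) * P.appellTerm k p l l' r q q')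
      (-e * r * ((P.jarg k r q ^ l * (1 - P.jarg k r q) ^ (-(P.halfShape : ℂ))) *
        (P.jarg p r q' ^ l' * (1 - P.jarg p r q') ^ (-(P.halfShape : ℂ))))) r := by
  have hb := P.gauss_exponent_pos hl
  have h1' : (l' : ℝ) + 1 ≤ P.m := by exact_mod_cast hl'
  have ha0 : 0 < 2 * P.halfShape - l - l' + 2 / P.alpha := by
    rw [halfShape] at *; linarith
  have h := hasDerivAt_appell_radial P.alpha_pos hs hA hB P.halfShape l l' rfl ha0
  have h' := h.congr_of_eventuallyEq (f₁ :=
    fun r => ((r ^ 2 + P.z ^ 2 : ℝ) : ℂ) * P.appellTerm k p l l' r q q') (by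
      filter_upwards [eventually_sq_add_pos hs] with y hy
      exact P.appellTerm_eq hl hl' hy hA hB)
  refine h'.congr_deriv ?_
  have hρ := Real.rpow_pos_of_pos hs (-P.alpha / 2)
  have hsA := one_sub_cpow_of_imag (mul_ne_zero hA hρ.ne') (-(P.halfShape : ℂ))
  have hsB := one_sub_cpow_of_imag (mul_ne_zero hB hρ.ne') (-(P.halfShape : ℂ))
  have he' : (0 < e ∧ e = 1 ∧ 0 < (P.amp k q * (r ^ 2 + P.z ^ 2) ^ (-P.alpha / 2)) *
      (P.amp p q' * (r ^ 2 + P.z ^ 2) ^ (-P.alpha / 2))) ∨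
      (e = -1 ∧ (P.amp k q * (r ^ 2 + P.z ^ 2) ^ (-P.alpha / 2)) *
      (P.amp p q' * (r ^ 2 + P.z ^ 2) ^ (-P.alpha / 2)) < 0) := by
    have hρ2 := mul_pos hρ hρ
    rw [mul_mul_mul_comm]
    rcases he with ⟨h0, h1, h2⟩ | ⟨h1, h2⟩
    · exact Or.inl ⟨h0, h1, mul_pos h2 hρ2⟩
    · exact Or.inr ⟨h1, mul_neg_of_neg_of_pos h2 hρ2⟩
  have hph := exp_sign_add_sign P.m he'
  have hd : (P.m : ℂ) - 1 / 2 = P.halfShape := by rw [halfShape]; push_cast; ring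
  have he2 : (e : ℂ) * e = 1 := by
    rcases he with ⟨-, rfl, -⟩ | ⟨rfl, -⟩ <;> norm_num
  rw [hd] at hph
  rw [← P.jarg_eq] at hsA hsB
  simp only [← P.jarg_eq]
  rw [hsA, hsB]
  generalize P.jarg k r q ^ (-(P.halfShape : ℂ)) = x1
  generalize (1 - (P.jarg k r q)⁻¹) ^ (-(P.halfShape : ℂ)) = x2
  generalize P.jarg p r q' ^ (-(P.halfShape : ℂ)) = x3
  generalize (1 - (P.jarg p r q')⁻¹) ^ (-(P.halfShape : ℂ)) = x4
  linear_combination (e * r * (P.jarg k r q ^ l * x1 * x2 * (P.jarg p r q' ^ l' * x3 * x4))) * hph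
    - (r * (P.jarg k r q ^ l * x1 * x2 * (P.jarg p r q' ^ l' * x3 * x4))) * he2

end Params

end EMFE


/-! ### The bracket as an antiderivative of the radial integrand. -/

namespace EMFE

namespace Params

variable (P : Params)

lemma N_pos : (0 : ℝ) < P.N := by
  have h := P.kmax_le
  have h0 : (0 : ℝ) ≤ P.kmax := Nat.cast_nonneg _
  by_contra hn
  have h1 : (P.N : ℝ) = 0 := le_antisymm (not_lt.1 hn) (Nat.cast_nonneg _)
  rw [h1] at h
  linarith

lemma lobeProb_pos : 0 < P.lobeProb := div_pos (by norm_num) (mul_pos P.N_pos Real.pi_pos)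

/-- Regrouped so that each special function stands next to its factor r² + z², the combination whose
derivative is known. -/
lemma bracket_eq (e q q' r : ℝ) : P.bracket e q q' r =
    (((1 + P.kmax) * (P.lobeProb * (1 + P.kmax) / 2 - 1) : ℝ) : ℂ) * ((r ^ 2 : ℝ) : ℂ) -
    ∑ k ∈ Finset.range (P.kmax + 1), ∑ l ∈ Finset.range P.m, (P.coef l : ℂ) *
      ((e * P.lobeProb) * (∑ p ∈ Finset.range (P.kmax + 1), ∑ l' ∈ Finset.range P.m,
            (P.coef l' : ℂ) * (((r ^ 2 + P.z ^ 2 : ℝ) : ℂ) * P.appellTerm k p l l' r q (e * q'))) +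
        ((1 - P.lobeProb * (1 + P.kmax) : ℝ) : ℂ) *
          (((2 * (r ^ 2 + P.z ^ 2) / (4 + P.alpha * (2 * P.m - 2 * l - 1)) : ℝ) : ℂ) *
              P.gaussTerm k l r q +
            ((2 * (r ^ 2 + P.z ^ 2) / (4 + P.alpha * (2 * P.m - 2 * l - 1)) : ℝ) : ℂ) *
              P.gaussTerm k l r (e * q'))) := by
  simp only [bracket]
  congr 1
  · rw [← Complex.ofReal_mul]
    congr 1
    rw [lobeProb]
    ring
  · refine Finset.sum_congr rfl fun k _ => Finset.sum_congr rfl fun l _ => ?_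
    congr 1
    congr 1
    · simp only [Finset.mul_sum]
      refine Finset.sum_congr rfl fun p _ => Finset.sum_congr rfl fun l' _ => ?_
      rw [lobeProb]
      push_cast
      ring
    · rw [lobeProb]
      push_cast
      ring

/-- Write φ = (1 - pK) + pΣ for `stationChar`, with p the probability of one lobe, K = 1 + kmax and
Σ the sum of the lobe terms. In 1 - φφ' the constant part matches the r² term of the bracket, the
two linear parts match the Gauss terms, and the product ΣΣ' matches the Appell terms. -/
lemma hasDerivAt_bracket {e q q' r : ℝ} (he : e = 1 ∨ e = -1) (hq : 0 < q) (hq' : 0 < q')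
    (hchi : ∀ k ≤ P.kmax, 0 < P.chi k) (hs : 0 < r ^ 2 + P.z ^ 2) :
    HasDerivAt (P.bracket e q q')
      (-(r / P.lobeProb) * (1 - P.stationChar q r * P.stationChar (e * q') r)) r := by
  have hpos : 0 < P.Pt / (4 * Real.pi * P.m) := by
    have := P.Pt_pos
    have := P.m_pos
    have := Real.pi_pos
    positivity
  -- Positivity of χ_k makes every argument nonzero, with the sign of its frequency; this decides
  -- between the two phase cases for the Appell terms.
  have hamp (k : ℕ) (hk : k ≤ P.kmax) : 0 < P.amp k q ∧ 0 < e * P.amp k (e * q') := by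
    have h1 := hchi k hk
    refine ⟨?_, ?_⟩
    · rw [amp, mul_div_assoc]
      positivity
    · rw [amp, mul_div_assoc, show e * (e * q' * P.chi k * (P.Pt / (4 * Real.pi * P.m))) =
        e * e * (q' * P.chi k * (P.Pt / (4 * Real.pi * P.m))) by ring]
      have : e * e = 1 := by rcases he with rfl | rfl <;> norm_num
      rw [this]
      positivity
  have he0 : e ≠ 0 := by rcases he with rfl | rfl <;> norm_num
  have hne' (k : ℕ) (hk : k ≤ P.kmax) : P.amp k (e * q') ≠ 0 := by
    intro h0
    have := (hamp k hk).2
    rw [h0, mul_zero] at this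
    exact lt_irrefl _ this
  have hsign (k p : ℕ) (hk : k ≤ P.kmax) (hp : p ≤ P.kmax) :
      (0 < e ∧ e = 1 ∧ 0 < P.amp k q * P.amp p (e * q')) ∨
        (e = -1 ∧ P.amp k q * P.amp p (e * q') < 0) := by
    have h1 := (hamp k hk).1
    have h2 := (hamp p hp).2
    rcases he with rfl | rfl
    · left
      refine ⟨one_pos, rfl, mul_pos h1 (by simpa using h2)⟩
    · right
      refine ⟨rfl, mul_neg_of_pos_of_neg h1 (by linarith)⟩
  have hsum : HasDerivAt (fun r : ℝ =>
      (((1 + P.kmax) * (P.lobeProb * (1 + P.kmax) / 2 - 1) : ℝ) : ℂ) * ((r ^ 2 : ℝ) : ℂ) -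
    ∑ k ∈ Finset.range (P.kmax + 1), ∑ l ∈ Finset.range P.m, (P.coef l : ℂ) *
      ((e * P.lobeProb) * (∑ p ∈ Finset.range (P.kmax + 1), ∑ l' ∈ Finset.range P.m,
            (P.coef l' : ℂ) * (((r ^ 2 + P.z ^ 2 : ℝ) : ℂ) * P.appellTerm k p l l' r q (e * q'))) +
        ((1 - P.lobeProb * (1 + P.kmax) : ℝ) : ℂ) *
          (((2 * (r ^ 2 + P.z ^ 2) / (4 + P.alpha * (2 * P.m - 2 * l - 1)) : ℝ) : ℂ) *
              P.gaussTerm k l r q +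
            ((2 * (r ^ 2 + P.z ^ 2) / (4 + P.alpha * (2 * P.m - 2 * l - 1)) : ℝ) : ℂ) *
              P.gaussTerm k l r (e * q'))))
      ((((1 + P.kmax) * (P.lobeProb * (1 + P.kmax) / 2 - 1) : ℝ) : ℂ) * ((2 * r : ℝ) : ℂ) -
    ∑ k ∈ Finset.range (P.kmax + 1), ∑ l ∈ Finset.range P.m, (P.coef l : ℂ) *
      ((e * P.lobeProb) * (∑ p ∈ Finset.range (P.kmax + 1), ∑ l' ∈ Finset.range P.m,
            (P.coef l' : ℂ) * (-e * r *
              ((P.jarg k r q ^ l * (1 - P.jarg k r q) ^ (-(P.halfShape : ℂ))) *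
              (P.jarg p r (e * q') ^ l' * (1 - P.jarg p r (e * q')) ^ (-(P.halfShape : ℂ)))))) +
        ((1 - P.lobeProb * (1 + P.kmax) : ℝ) : ℂ) *
          (-(r * (P.jarg k r q ^ l * (1 - P.jarg k r q) ^ (-(P.halfShape : ℂ)))) +
            -(r * (P.jarg k r (e * q') ^ l *
              (1 - P.jarg k r (e * q')) ^ (-(P.halfShape : ℂ))))))) r := by
    refine HasDerivAt.fun_sub ?_ (HasDerivAt.fun_sum fun k hk => HasDerivAt.fun_sum fun l hl =>
      HasDerivAt.const_mul _ (HasDerivAt.fun_add (HasDerivAt.const_mul _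
        (HasDerivAt.fun_sum fun p hp => HasDerivAt.fun_sum fun l' hl' =>
          HasDerivAt.const_mul _ ?_)) (HasDerivAt.const_mul _ (HasDerivAt.fun_add ?_ ?_))))
    · refine HasDerivAt.const_mul _ ?_
      have := (hasDerivAt_pow 2 r).ofReal_comp
      simpa using this
    · rw [Finset.mem_range] at hl hl' hk hp
      have hk' : k ≤ P.kmax := by omega
      have hp' : p ≤ P.kmax := by omega
      exact P.hasDerivAt_appellTerm hl hl' hs (hamp k hk').1.ne' (hne' p hp') (hsign k p hk' hp')
    · rw [Finset.mem_range] at hl hk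
      exact P.hasDerivAt_gaussTerm hl hs (hamp k (by omega)).1.ne'
    · rw [Finset.mem_range] at hl hk
      exact P.hasDerivAt_gaussTerm hl hs (hne' k (by omega))
  rw [funext (P.bracket_eq e q q')]
  refine hsum.congr_deriv ?_
  -- The sign e in front of the Appell sum meets the sign -e of the Appell derivative, so the
  -- product of lobe terms enters with the same sign in both cases.
  have hee : (e : ℂ) * e = 1 := by rcases he with rfl | rfl <;> norm_num
  have hkey : (∑ k ∈ Finset.range (P.kmax + 1), ∑ l ∈ Finset.range P.m, (P.coef l : ℂ) *
      ((e * P.lobeProb) * (∑ p ∈ Finset.range (P.kmax + 1), ∑ l' ∈ Finset.range P.m,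
            (P.coef l' : ℂ) * (-e * r *
              ((P.jarg k r q ^ l * (1 - P.jarg k r q) ^ (-(P.halfShape : ℂ))) *
              (P.jarg p r (e * q') ^ l' * (1 - P.jarg p r (e * q')) ^ (-(P.halfShape : ℂ)))))) +
        ((1 - P.lobeProb * (1 + P.kmax) : ℝ) : ℂ) *
          (-(r * (P.jarg k r q ^ l * (1 - P.jarg k r q) ^ (-(P.halfShape : ℂ)))) +
            -(r * (P.jarg k r (e * q') ^ l *
              (1 - P.jarg k r (e * q')) ^ (-(P.halfShape : ℂ))))))) =
      -(P.lobeProb * r * ((∑ k ∈ Finset.range (P.kmax + 1), P.lobeChar k q r) *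
        ∑ k ∈ Finset.range (P.kmax + 1), P.lobeChar k (e * q') r)) -
      ((1 - P.lobeProb * (1 + P.kmax) : ℝ) : ℂ) * r *
        ((∑ k ∈ Finset.range (P.kmax + 1), P.lobeChar k q r) +
          ∑ k ∈ Finset.range (P.kmax + 1), P.lobeChar k (e * q') r) := by
    have h1 : (∑ p ∈ Finset.range (P.kmax + 1), P.lobeChar p (e * q') r) =
      ∑ p ∈ Finset.range (P.kmax + 1), ∑ l' ∈ Finset.range P.m, (P.coef l' : ℂ) *
        (P.jarg p r (e * q') ^ l' * (1 - P.jarg p r (e * q')) ^ (-(P.halfShape : ℂ))) := rfl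
    have h2 (k l : ℕ) : (∑ p ∈ Finset.range (P.kmax + 1), ∑ l' ∈ Finset.range P.m,
            (P.coef l' : ℂ) * (-e * r *
              ((P.jarg k r q ^ l * (1 - P.jarg k r q) ^ (-(P.halfShape : ℂ))) *
              (P.jarg p r (e * q') ^ l' * (1 - P.jarg p r (e * q')) ^ (-(P.halfShape : ℂ)))))) =
        -e * r * (P.jarg k r q ^ l * (1 - P.jarg k r q) ^ (-(P.halfShape : ℂ))) *
          ∑ p ∈ Finset.range (P.kmax + 1), P.lobeChar p (e * q') r := by
      rw [h1]
      simp only [Finset.mul_sum]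
      exact Finset.sum_congr rfl fun p _ => Finset.sum_congr rfl fun l' _ => by ring
    simp only [h2]
    set T := ∑ p ∈ Finset.range (P.kmax + 1), P.lobeChar p (e * q') r with hT
    have h3 : T = ∑ k ∈ Finset.range (P.kmax + 1), ∑ l ∈ Finset.range P.m, (P.coef l : ℂ) *
        (P.jarg k r (e * q') ^ l * (1 - P.jarg k r (e * q')) ^ (-(P.halfShape : ℂ))) := rfl
    have h4 : (∑ k ∈ Finset.range (P.kmax + 1), P.lobeChar k q r) =
      ∑ k ∈ Finset.range (P.kmax + 1), ∑ l ∈ Finset.range P.m, (P.coef l : ℂ) *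
        (P.jarg k r q ^ l * (1 - P.jarg k r q) ^ (-(P.halfShape : ℂ))) := rfl
    have h5 : -(P.lobeProb * r * ((∑ k ∈ Finset.range (P.kmax + 1), P.lobeChar k q r) * T)) -
      ((1 - P.lobeProb * (1 + P.kmax) : ℝ) : ℂ) * r *
        ((∑ k ∈ Finset.range (P.kmax + 1), P.lobeChar k q r) + T) =
      (-(P.lobeProb * r * T) - ((1 - P.lobeProb * (1 + P.kmax) : ℝ) : ℂ) * r) *
        (∑ k ∈ Finset.range (P.kmax + 1), P.lobeChar k q r) +
      (-((1 - P.lobeProb * (1 + P.kmax) : ℝ) : ℂ) * r) * T := by ring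
    rw [h5]
    conv_rhs => rw [h4]; arg 2; rw [h3]
    simp only [Finset.mul_sum, ← Finset.sum_add_distrib]
    refine Finset.sum_congr rfl fun k _ => Finset.sum_congr rfl fun l _ => ?_
    linear_combination (-(P.coef l : ℂ) * P.lobeProb * r * T *
      (P.jarg k r q ^ l * (1 - P.jarg k r q) ^ (-(P.halfShape : ℂ)))) * hee
  rw [hkey, stationChar, stationChar]
  have hu : (P.lobeProb : ℂ) ≠ 0 := by exact_mod_cast P.lobeProb_pos.ne'
  push_cast
  field_simp
  ring

lemma continuous_stationChar_right (q : ℝ) {a b : ℝ} (hs : ∀ r ∈ Set.Icc a b, 0 < r ^ 2 + P.z ^ 2) :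
    ContinuousOn (P.stationChar q) (Set.Icc a b) := by
  have hj (k : ℕ) : ContinuousOn (fun r => P.jarg k r q) (Set.Icc a b) := by
    simp only [jarg_eq]
    refine continuousOn_const.mul (Complex.continuous_ofReal.comp_continuousOn
      (continuousOn_const.mul ?_))
    exact ContinuousOn.rpow_const (by fun_prop) (fun r hr => Or.inl (hs r hr).ne')
  have hl (k : ℕ) : ContinuousOn (fun r => P.lobeChar k q r) (Set.Icc a b) := by
    refine continuousOn_finsetSum _ fun l _ => continuousOn_const.mul (((hj k).pow l).mul ?_)
    refine (continuousOn_const.sub (hj k)).cpow continuousOn_const fun r hr => ?_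
    simp only [jarg_eq]
    exact one_sub_mem_slitPlane (by simp)
  exact continuousOn_const.add (continuousOn_const.mul (continuousOn_finsetSum _ fun k _ => hl k))

lemma sq_add_pos_of_mem {r : ℝ} (hr : r ∈ Set.Icc P.rE P.tau) : 0 < r ^ 2 + P.z ^ 2 := by
  rcases P.z_or_rE_pos with h | h
  · positivity
  · have : 0 < r := h.trans_le hr.1
    positivity

/-- The closed form of the mixed moments is an exponential of a radial integral. -/
lemma gammaSigned_eq {e q q' : ℝ} (he : e = 1 ∨ e = -1) (hq : 0 < q) (hq' : 0 < q')
    (hchi : ∀ k ≤ P.kmax, 0 < P.chi k) :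
    P.gammaSigned e q q' = Complex.exp (-(2 * Real.pi * P.lam * ∫ r in P.rE..P.tau,
      (r : ℂ) * (1 - P.stationChar q r * P.stationChar (e * q') r))) := by
  have hle := P.rE_lt_tau.le
  have hcont : ContinuousOn (fun r : ℝ => (-(r / P.lobeProb) *
      (1 - P.stationChar q r * P.stationChar (e * q') r) : ℂ)) (Set.Icc P.rE P.tau) := by
    have h1 := P.continuous_stationChar_right q (fun r hr => P.sq_add_pos_of_mem hr)
    have h2 := P.continuous_stationChar_right (e * q') (fun r hr => P.sq_add_pos_of_mem hr)
    refine ContinuousOn.mul ?_ (continuousOn_const.sub (h1.mul h2))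
    fun_prop
  have hint := intervalIntegral.integral_eq_sub_of_hasDerivAt (a := P.rE) (b := P.tau)
    (f := P.bracket e q q') (f' := fun r : ℝ => (-(r / P.lobeProb) *
      (1 - P.stationChar q r * P.stationChar (e * q') r) : ℂ)) (fun r hr => by
      rw [Set.uIcc_of_le hle] at hr
      exact P.hasDerivAt_bracket he hq hq' hchi (P.sq_add_pos_of_mem hr))
    (by
      apply ContinuousOn.intervalIntegrable
      rwa [Set.uIcc_of_le hle])
  rw [gammaSigned, ← hint]
  congr 1
  rw [← intervalIntegral.integral_const_mul, ← intervalIntegral.integral_const_mul,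
    ← intervalIntegral.integral_neg]
  refine intervalIntegral.integral_congr fun r _ => ?_
  -- The constants agree because 12λ/N divided by the lobe probability 6/(Nπ) equals 2πλ.
  have hN : (P.N : ℂ) ≠ 0 := by exact_mod_cast P.N_pos.ne'
  have hpi : (Real.pi : ℂ) ≠ 0 := by exact_mod_cast Real.pi_ne_zero
  simp only [lobeProb]
  push_cast
  field_simp
  ring

end Params
end EMFE


namespace EMFE

/-! ### Averages over one lobe -/

lemma re_imag_mul (y s : ℝ) : (Complex.I * y * (s : ℂ)).re = 0 := by simp

lemma lobe_denom_ne_zero (y s : ℝ) : 1 - Complex.I * y * (s : ℂ) ≠ 0 :=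
  one_sub_ne_zero (re_imag_mul y s)

lemma norm_lobe_pow_inv_le (y s : ℝ) (n : ℕ) : ‖((1 - Complex.I * y * (s : ℂ)) ^ n)⁻¹‖ ≤ 1 := by
  rw [norm_inv, norm_pow]
  exact inv_le_one_of_one_le₀ (one_le_pow₀ (one_le_norm_one_sub (re_imag_mul y s)))

/-- `∫₀^π sin^(2l) θ / (1 - j y cos² θ)^(l+1) dθ`. -/
noncomputable def lobeInt (l : ℕ) (y : ℝ) : ℂ :=
  ∫ θ in (0 : ℝ)..Real.pi, ((Real.sin θ ^ (2 * l) : ℝ) : ℂ) *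
    ((1 - Complex.I * y * ((Real.cos θ ^ 2 : ℝ) : ℂ)) ^ (l + 1))⁻¹

lemma continuous_lobe_pow_inv (y : ℝ) (n : ℕ) :
    Continuous fun θ : ℝ => ((1 - Complex.I * y * ((Real.cos θ ^ 2 : ℝ) : ℂ)) ^ n)⁻¹ := by
  refine Continuous.inv₀ (by fun_prop) fun θ => pow_ne_zero _ (lobe_denom_ne_zero _ _)

lemma hasDerivAt_lobeInt (l : ℕ) (y : ℝ) :
    HasDerivAt (lobeInt l) (∫ θ in (0 : ℝ)..Real.pi, ((Real.sin θ ^ (2 * l) : ℝ) : ℂ) *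
      ((l + 1) * Complex.I * ((Real.cos θ ^ 2 : ℝ) : ℂ) *
        ((1 - Complex.I * y * ((Real.cos θ ^ 2 : ℝ) : ℂ)) ^ (l + 2))⁻¹)) y := by
  refine (intervalIntegral.hasDerivAt_integral_of_dominated_loc_of_deriv_le
    (F := fun (y θ : ℝ) => ((Real.sin θ ^ (2 * l) : ℝ) : ℂ) *
      ((1 - Complex.I * y * ((Real.cos θ ^ 2 : ℝ) : ℂ)) ^ (l + 1))⁻¹)
    (F' := fun (y θ : ℝ) => ((Real.sin θ ^ (2 * l) : ℝ) : ℂ) *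
      ((l + 1) * Complex.I * ((Real.cos θ ^ 2 : ℝ) : ℂ) *
        ((1 - Complex.I * y * ((Real.cos θ ^ 2 : ℝ) : ℂ)) ^ (l + 2))⁻¹))
    (s := Set.univ) (bound := fun _ => (l : ℝ) + 1) univ_mem ?_ ?_ ?_ ?_ ?_ ?_).2
  · refine Eventually.of_forall fun y => Continuous.aestronglyMeasurable ?_
    exact (by fun_prop : Continuous fun θ : ℝ => ((Real.sin θ ^ (2 * l) : ℝ) : ℂ)).mul
      (continuous_lobe_pow_inv y _)
  · refine Continuous.intervalIntegrable ?_ _ _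
    exact (by fun_prop : Continuous fun θ : ℝ => ((Real.sin θ ^ (2 * l) : ℝ) : ℂ)).mul
      (continuous_lobe_pow_inv y _)
  · refine Continuous.aestronglyMeasurable ?_
    exact (by fun_prop : Continuous fun θ : ℝ => ((Real.sin θ ^ (2 * l) : ℝ) : ℂ)).mul
      ((by fun_prop : Continuous fun θ : ℝ =>
        ((l + 1 : ℂ) * Complex.I * ((Real.cos θ ^ 2 : ℝ) : ℂ))).mul (continuous_lobe_pow_inv y _))
  · refine Eventually.of_forall fun θ _ y _ => ?_
    have h1 : |Real.sin θ| ^ (2 * l) ≤ 1 := pow_le_one₀ (abs_nonneg _) (Real.abs_sin_le_one θ)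
    have h2 : |Real.cos θ| ^ 2 ≤ 1 := pow_le_one₀ (abs_nonneg _) (Real.abs_cos_le_one θ)
    have h3 := norm_lobe_pow_inv_le y (Real.cos θ ^ 2) (l + 2)
    have h4 : ‖(l + 1 : ℂ)‖ = l + 1 := by
      rw [← Nat.cast_one, ← Nat.cast_add, Complex.norm_natCast]; push_cast; ring
    rw [norm_mul, norm_mul, norm_mul, norm_mul, Complex.norm_I, Complex.norm_real,
      Complex.norm_real, norm_pow, norm_pow, Real.norm_eq_abs, Real.norm_eq_abs, h4, mul_one]
    calc |Real.sin θ| ^ (2 * l) * (((l : ℝ) + 1) * |Real.cos θ| ^ 2 * _)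
        ≤ 1 * (((l : ℝ) + 1) * 1 * 1) := by gcongr
      _ = l + 1 := by ring
  · exact intervalIntegrable_const
  · refine Eventually.of_forall fun θ _ y _ => ?_
    have hne := lobe_denom_ne_zero y (Real.cos θ ^ 2)
    have h0 : HasDerivAt (fun y : ℝ => 1 - Complex.I * (y : ℂ) * ((Real.cos θ ^ 2 : ℝ) : ℂ))
        (-(Complex.I * ((Real.cos θ ^ 2 : ℝ) : ℂ))) y := by
      have := (((hasDerivAt_id y).ofReal_comp.const_mul Complex.I).mul_const
        ((Real.cos θ ^ 2 : ℝ) : ℂ)).const_sub 1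
      simpa using this
    refine (((h0.fun_pow (l + 1)).fun_inv (pow_ne_zero _ hne)).const_mul
      ((Real.sin θ ^ (2 * l) : ℝ) : ℂ)).congr_deriv ?_
    rw [Nat.add_sub_cancel]
    field_simp
    push_cast
    ring

/-- The integrand is the derivative of -sin^(2l+1) θ cos θ / (1 - jy cos² θ)^(l+1), which vanishes
at 0 and π. The identity is the differential equation L + 2j(1 - jy) L' = 0 for L = `lobeInt l`. -/
lemma integral_lobe_total_deriv (l : ℕ) (y : ℝ) :
    ∫ θ in (0 : ℝ)..Real.pi, (((Real.sin θ ^ (2 * l) : ℝ) : ℂ) *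
        ((1 - Complex.I * y * ((Real.cos θ ^ 2 : ℝ) : ℂ)) ^ (l + 1))⁻¹ +
      (2 * Complex.I * (1 - Complex.I * y)) * (((Real.sin θ ^ (2 * l) : ℝ) : ℂ) *
      ((l + 1) * Complex.I * ((Real.cos θ ^ 2 : ℝ) : ℂ) *
        ((1 - Complex.I * y * ((Real.cos θ ^ 2 : ℝ) : ℂ)) ^ (l + 2))⁻¹))) = 0 := by
  have key := intervalIntegral.integral_eq_sub_of_hasDerivAt (a := 0) (b := Real.pi)
    (f := fun θ : ℝ => -(((Real.sin θ ^ (2 * l + 1) * Real.cos θ : ℝ) : ℂ) *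
      ((1 - Complex.I * y * ((Real.cos θ ^ 2 : ℝ) : ℂ)) ^ (l + 1))⁻¹))
    (f' := fun θ : ℝ => (((Real.sin θ ^ (2 * l) : ℝ) : ℂ) *
        ((1 - Complex.I * y * ((Real.cos θ ^ 2 : ℝ) : ℂ)) ^ (l + 1))⁻¹ +
      (2 * Complex.I * (1 - Complex.I * y)) * (((Real.sin θ ^ (2 * l) : ℝ) : ℂ) *
      ((l + 1) * Complex.I * ((Real.cos θ ^ 2 : ℝ) : ℂ) *
        ((1 - Complex.I * y * ((Real.cos θ ^ 2 : ℝ) : ℂ)) ^ (l + 2))⁻¹)))) ?_ ?_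
  · rw [key]; simp
  · intro θ _
    have hne := lobe_denom_ne_zero y (Real.cos θ ^ 2)
    have hc : HasDerivAt (fun θ : ℝ => Real.cos θ ^ 2)
        (-(2 * Real.cos θ * Real.sin θ)) θ := by
      refine ((Real.hasDerivAt_cos θ).fun_pow 2).congr_deriv ?_
      push_cast; ring
    have h0 : HasDerivAt (fun θ : ℝ => 1 - Complex.I * (y : ℂ) * ((Real.cos θ ^ 2 : ℝ) : ℂ))
        (Complex.I * y * ((2 * Real.cos θ * Real.sin θ : ℝ) : ℂ)) θ := by
      refine ((hc.ofReal_comp.const_mul (Complex.I * (y : ℂ))).const_sub 1).congr_deriv ?_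
      push_cast; ring
    have h1 : HasDerivAt (fun θ : ℝ => Real.sin θ ^ (2 * l + 1) * Real.cos θ)
        ((2 * l + 1) * Real.sin θ ^ (2 * l) * Real.cos θ ^ 2 - Real.sin θ ^ (2 * l) *
          Real.sin θ ^ 2) θ := by
      refine (((Real.hasDerivAt_sin θ).fun_pow (2 * l + 1)).fun_mul
        (Real.hasDerivAt_cos θ)).congr_deriv ?_
      rw [Nat.add_sub_cancel]
      push_cast; ring
    refine ((h1.ofReal_comp.fun_mul ((h0.fun_pow (l + 1)).fun_inv
      (pow_ne_zero _ hne))).fun_neg).congr_deriv ?_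
    rw [Nat.add_sub_cancel]
    have hsc : ((Real.sin θ : ℝ) : ℂ) ^ 2 + ((Real.cos θ : ℝ) : ℂ) ^ 2 = 1 := by
      exact_mod_cast Real.sin_sq_add_cos_sq θ
    push_cast at hne hsc ⊢
    rw [pow_succ (Complex.sin θ) (2 * l)]
    generalize Complex.sin θ ^ (2 * l) = Z
    generalize Complex.sin (θ : ℂ) = S at *
    generalize Complex.cos (θ : ℂ) = C at *
    have hI : Complex.I ^ 2 = -1 := Complex.I_sq
    have a1 : ((1 - Complex.I * y * C ^ 2) ^ (l + 1))⁻¹ =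
        (1 - Complex.I * y * C ^ 2) * ((1 - Complex.I * y * C ^ 2) ^ (l + 2))⁻¹ := by
      field_simp
      ring
    have a2 (w : ℂ) : -((l + 1) * (1 - Complex.I * y * C ^ 2) ^ l * w) /
        ((1 - Complex.I * y * C ^ 2) ^ (l + 1)) ^ 2 =
        -((l + 1) * w) * ((1 - Complex.I * y * C ^ 2) ^ (l + 2))⁻¹ := by
      field_simp
      ring
    rw [a1, a2]
    generalize ((1 - Complex.I * y * C ^ 2) ^ (l + 2))⁻¹ = E
    linear_combination (Z * E * (1 - Complex.I * y * C ^ 2 + 2 * (l + 1) * (Complex.I * y) * C ^ 2)) *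
      hsc - (Z * E * (2 * (l + 1) * (1 - Complex.I * y) * C ^ 2)) * hI
  · refine Continuous.intervalIntegrable ?_ _ _
    have h1 := continuous_lobe_pow_inv y (l + 1)
    have h2 := continuous_lobe_pow_inv y (l + 2)
    exact ((by fun_prop : Continuous fun θ : ℝ => ((Real.sin θ ^ (2 * l) : ℝ) : ℂ)).mul h1).add
      (continuous_const.mul ((by fun_prop : Continuous fun θ : ℝ =>
        ((Real.sin θ ^ (2 * l) : ℝ) : ℂ)).mul
      ((by fun_prop : Continuous fun θ : ℝ =>
        ((l + 1 : ℂ) * Complex.I * ((Real.cos θ ^ 2 : ℝ) : ℂ))).mul h2)))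

/-- The differential equation makes the left side constant in y; at y = 0 it is Wallis' integral of
sin^(2l). -/
lemma sqrt_mul_lobeInt (l : ℕ) (y : ℝ) :
    (1 - Complex.I * y) ^ (1 / 2 : ℂ) * lobeInt l y =
      Real.pi * ∏ i ∈ Finset.range l, ((2 * (i : ℂ) + 1) / (2 * i + 2)) := by
  have hd (y : ℝ) : HasDerivAt (fun y : ℝ => (1 - Complex.I * (y : ℂ)) ^ (1 / 2 : ℂ) * lobeInt l y)
      0 y := by
    have h1 : HasDerivAt (fun y : ℝ => (1 - Complex.I * (y : ℂ)) ^ (1 / 2 : ℂ))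
        ((1 / 2) * (1 - Complex.I * (y : ℂ)) ^ ((1 / 2 : ℂ) - 1) * (-Complex.I)) y := by
      have := hasDerivAt_one_sub_cpow (w := Complex.I) Complex.I_re (1 / 2) y
      simpa only [mul_comm] using this
    refine (h1.fun_mul (hasDerivAt_lobeInt l y)).congr_deriv ?_
    have hne : 1 - Complex.I * (y : ℂ) ≠ 0 := one_sub_ne_zero (by simp)
    have h3 := integral_lobe_total_deriv l y
    rw [intervalIntegral.integral_add, intervalIntegral.integral_const_mul] at h3
    · have h4 : (1 - Complex.I * (y : ℂ)) ^ (1 / 2 : ℂ) =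
          (1 - Complex.I * (y : ℂ)) ^ ((1 / 2 : ℂ) - 1) * (1 - Complex.I * (y : ℂ)) := by
        rw [Complex.cpow_sub _ _ hne, Complex.cpow_one, div_mul_cancel₀ _ hne]
      rw [h4, lobeInt]
      linear_combination (-(Complex.I / 2) * (1 - Complex.I * (y : ℂ)) ^ ((1 / 2 : ℂ) - 1)) * h3 -
        (1 - Complex.I * (y : ℂ)) ^ ((1 / 2 : ℂ) - 1) * (1 - Complex.I * (y : ℂ)) * (∫ θ in (0 : ℝ)..Real.pi, ((Real.sin θ ^ (2 * l) : ℝ) : ℂ) *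
      ((l + 1) * Complex.I * ((Real.cos θ ^ 2 : ℝ) : ℂ) *
        ((1 - Complex.I * y * ((Real.cos θ ^ 2 : ℝ) : ℂ)) ^ (l + 2))⁻¹)) * (-Complex.I_sq)
    · exact Continuous.intervalIntegrable ((by fun_prop : Continuous fun θ : ℝ =>
        ((Real.sin θ ^ (2 * l) : ℝ) : ℂ)).mul (continuous_lobe_pow_inv y _)) _ _
    · exact Continuous.intervalIntegrable (continuous_const.mul ((by fun_prop : Continuous fun θ : ℝ =>
        ((Real.sin θ ^ (2 * l) : ℝ) : ℂ)).mul
      ((by fun_prop : Continuous fun θ : ℝ =>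
        ((l + 1 : ℂ) * Complex.I * ((Real.cos θ ^ 2 : ℝ) : ℂ))).mul
          (continuous_lobe_pow_inv y _)))) _ _
  have hconst := is_const_of_deriv_eq_zero (fun y => (hd y).differentiableAt)
    (fun y => (hd y).deriv) y 0
  rw [hconst]
  simp only [lobeInt, Complex.ofReal_zero, mul_zero, sub_zero, Complex.one_cpow, one_mul, zero_mul,
    one_pow, inv_one, mul_one]
  rw [intervalIntegral.integral_ofReal, integral_sin_pow_even]
  push_cast
  rfl

/-- Identifies the Wallis products with the coefficients of the closed form, up to a sign that is
absorbed by (-x)^l. -/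
lemma genBinom_neg_half (l : ℕ) : genBinom (-1 / 2) l =
    (-1) ^ l * ∏ i ∈ Finset.range l, ((2 * (i : ℝ) + 1) / (2 * i + 2)) := by
  rw [genBinom, ← Finset.prod_range_add_one_eq_factorial, Nat.cast_prod, ← Finset.prod_div_distrib,
    ← Finset.card_range l, ← Finset.prod_const, Finset.card_range, ← Finset.prod_mul_distrib]
  refine Finset.prod_congr rfl fun i _ => ?_
  push_cast
  field_simp
  ring

/-- With x = jy and D = 1 - x cos² θ one has 1 - x = D - x sin² θ. Expanding (1 - x)^(m-1)
binomially and dividing by D^m leaves the integrands sin^(2l) θ / D^(l+1) of `lobeInt`. -/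
lemma integral_lobe_pow (m : ℕ) (hm : 1 ≤ m) (y : ℝ) :
    ∫ θ in (0 : ℝ)..Real.pi, ((1 - Complex.I * y * ((Real.cos θ ^ 2 : ℝ) : ℂ)) ^ m)⁻¹ =
      Real.pi * ∑ l ∈ Finset.range m, ((genBinom (-1 / 2) l * ((m - 1).choose l : ℝ) : ℝ) : ℂ) *
        ((Complex.I * y) ^ l * (1 - Complex.I * y) ^ (-((m - 1 / 2 : ℝ) : ℂ))) := by
  obtain ⟨n, rfl⟩ : ∃ n, m = n + 1 := ⟨m - 1, by omega⟩
  have hne : 1 - Complex.I * (y : ℂ) ≠ 0 := one_sub_ne_zero (by simp)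
  have hpt (θ : ℝ) : ((1 - Complex.I * y * ((Real.cos θ ^ 2 : ℝ) : ℂ)) ^ (n + 1))⁻¹ =
      ∑ l ∈ Finset.range (n + 1), ((1 - Complex.I * y) ^ n)⁻¹ * (n.choose l * (-(Complex.I * y)) ^ l) *
        (((Real.sin θ ^ (2 * l) : ℝ) : ℂ) *
          ((1 - Complex.I * y * ((Real.cos θ ^ 2 : ℝ) : ℂ)) ^ (l + 1))⁻¹) := by
    have hD := lobe_denom_ne_zero y (Real.cos θ ^ 2)
    have hsc : ((Real.sin θ : ℝ) : ℂ) ^ 2 + ((Real.cos θ : ℝ) : ℂ) ^ 2 = 1 := by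
      exact_mod_cast Real.sin_sq_add_cos_sq θ
    have hc : 1 - Complex.I * (y : ℂ) = -(Complex.I * y) * ((Real.sin θ ^ 2 : ℝ) : ℂ) +
        (1 - Complex.I * y * ((Real.cos θ ^ 2 : ℝ) : ℂ)) := by
      rw [Complex.ofReal_pow, Complex.ofReal_pow]
      linear_combination (Complex.I * y) * hsc
    have hbin := add_pow (-(Complex.I * y) * ((Real.sin θ ^ 2 : ℝ) : ℂ))
      (1 - Complex.I * y * ((Real.cos θ ^ 2 : ℝ) : ℂ)) n
    rw [← hc] at hbin
    have hcn : (1 - Complex.I * (y : ℂ)) ^ n ≠ 0 := pow_ne_zero _ hne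
    have e : ((1 - Complex.I * y * ((Real.cos θ ^ 2 : ℝ) : ℂ)) ^ (n + 1))⁻¹ =
        ((1 - Complex.I * y) ^ n)⁻¹ * ((1 - Complex.I * y) ^ n *
          ((1 - Complex.I * y * ((Real.cos θ ^ 2 : ℝ) : ℂ)) ^ (n + 1))⁻¹) := by
      rw [← mul_assoc, inv_mul_cancel₀ hcn, one_mul]
    rw [e, hbin, Finset.sum_mul, Finset.mul_sum]
    refine Finset.sum_congr rfl fun l hl => ?_
    rw [Finset.mem_range] at hl
    obtain ⟨j, rfl⟩ : ∃ j, n = l + j := ⟨n - l, by omega⟩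
    rw [Nat.add_sub_cancel_left]
    generalize 1 - Complex.I * y * ((Real.cos θ ^ 2 : ℝ) : ℂ) = D at *
    have e3 : (D ^ (l + j + 1))⁻¹ * D ^ j = (D ^ (l + 1))⁻¹ := by
      rw [show l + j + 1 = (l + 1) + j by ring, pow_add, mul_inv, mul_assoc,
        inv_mul_cancel₀ (pow_ne_zero _ hD), mul_one]
    rw [← e3, mul_pow, Complex.ofReal_pow, Complex.ofReal_pow, pow_mul]
    ring
  simp only [hpt]
  rw [intervalIntegral.integral_finsetSum]
  · rw [Finset.mul_sum]
    refine Finset.sum_congr rfl fun l _ => ?_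
    rw [intervalIntegral.integral_const_mul]
    have h := sqrt_mul_lobeInt l y
    rw [lobeInt] at h
    have hsq : (1 - Complex.I * (y : ℂ)) ^ (1 / 2 : ℂ) ≠ 0 := by
      rw [Complex.cpow_ne_zero_iff]; exact Or.inl hne
    have hexp : (1 - Complex.I * (y : ℂ)) ^ (-(((n + 1 : ℕ) : ℝ) - 1 / 2 : ℝ) : ℂ) =
        ((1 - Complex.I * y) ^ n)⁻¹ * ((1 - Complex.I * (y : ℂ)) ^ (1 / 2 : ℂ))⁻¹ := by
      rw [← Complex.cpow_natCast, ← mul_inv, ← Complex.cpow_add _ _ hne, ← Complex.cpow_neg]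
      congr 1
      push_cast
      ring
    rw [hexp, Nat.add_sub_cancel, genBinom_neg_half]
    push_cast at h ⊢
    rw [neg_pow (Complex.I * (y : ℂ))]
    generalize (∏ i ∈ Finset.range l, ((2 * (i : ℂ) + 1) / (2 * i + 2))) = Q at *
    generalize (∫ (θ : ℝ) in (0 : ℝ)..Real.pi, Complex.sin ↑θ ^ (2 * l) *
      ((1 - Complex.I * ↑y * Complex.cos ↑θ ^ 2) ^ (l + 1))⁻¹) = J at *
    field_simp
    linear_combination ((n.choose l : ℂ) * (Complex.I * y) ^ l) * h
  · intro l _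
    exact Continuous.intervalIntegrable (continuous_const.mul ((by fun_prop : Continuous fun θ : ℝ =>
        ((Real.sin θ ^ (2 * l) : ℝ) : ℂ)).mul (continuous_lobe_pow_inv y _))) _ _

end EMFE


namespace EMFE

/-! ### Levels of the side lobes -/

namespace Params

variable (P : Params)

/-- From √3/4 < 1/2. It places every kept interval (kπ/N, (k+1)π/N) below π/2, where sine and cosine
are positive. -/
lemma succ_kmax_lt : ((P.kmax : ℝ) + 1) * 2 < P.N := by
  have h := P.kmax_le
  have h3 : √3 < 2 := by
    rw [Real.sqrt_lt' (by norm_num)]; norm_num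
  have := P.N_pos
  nlinarith

/-- The point x_k is defined as an infimum, so it has to be shown that solutions exist and that the
infimum stays inside the open interval between two zeros of sin(Nx). After clearing denominators the
equation becomes g = 0 with g continuous, g nonzero at the left end and of opposite sign at the
midpoint. -/
lemma chi_pos {k : ℕ} (hk : k ≤ P.kmax) : 0 < P.chi k := by
  rw [chi]
  split_ifs with hk0
  · exact one_pos
  have hN := P.N_pos
  have hpi := Real.pi_pos
  have hk1 : (1 : ℝ) ≤ k := by exact_mod_cast Nat.one_le_iff_ne_zero.2 hk0
  have hkm : (k : ℝ) ≤ P.kmax := by exact_mod_cast hk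
  have h2 := P.succ_kmax_lt
  set N : ℝ := (P.N : ℝ) with hNdef
  set a : ℝ := k * Real.pi / N with ha
  set c : ℝ := (k + 1) * Real.pi / N with hc
  have hac : a < c := by rw [ha, hc]; gcongr; linarith
  have ha0 : 0 < a := by rw [ha]; positivity
  have hc2 : c < Real.pi / 2 := by
    rw [hc, div_lt_div_iff₀ hN two_pos]
    nlinarith
  set g : ℝ → ℝ := fun x => N * Real.sin x * Real.cos (N * x) - Real.cos x * Real.sin (N * x)
    with hg
  have hgc : Continuous g := by fun_prop
  have hNa : N * a = k * Real.pi := by rw [ha]; field_simp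
  have hsol {x : ℝ} (hx : x ∈ Set.Ioo a c) : (N * Real.tan x = Real.tan (N * x)) ↔ g x = 0 := by
    have hx0 : 0 < x := ha0.trans hx.1
    have hx2 : x < Real.pi / 2 := hx.2.trans hc2
    have hcx : 0 < Real.cos x := Real.cos_pos_of_mem_Ioo ⟨by linarith, hx2⟩
    have hsx : 0 < Real.sin x := Real.sin_pos_of_pos_of_lt_pi hx0 (by linarith)
    -- Where cos(Nx) = 0 the tangent takes the default value 0, while N tan x > 0 and g x ≠ 0; both
    -- sides of the equivalence are false there.
    rcases eq_or_ne (Real.cos (N * x)) 0 with h0 | h0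
    · have hs : Real.sin (N * x) ≠ 0 := by
        intro h
        have := Real.sin_sq_add_cos_sq (N * x)
        rw [h0, h] at this
        norm_num at this
      constructor
      · intro h
        rw [Real.tan_eq_sin_div_cos (N * x), h0, div_zero, Real.tan_eq_sin_div_cos] at h
        have : 0 < N * (Real.sin x / Real.cos x) := by positivity
        linarith
      · intro h
        rw [hg] at h
        simp only [h0, mul_zero, zero_sub, neg_eq_zero] at h
        exact absurd h (mul_ne_zero hcx.ne' hs)
    · rw [Real.tan_eq_sin_div_cos, Real.tan_eq_sin_div_cos, ← mul_div_assoc,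
        div_eq_div_iff hcx.ne' h0, hg]
      constructor <;> intro h <;> linarith
  have hga : g a ≠ 0 := by
    have hs : 0 < Real.sin a := Real.sin_pos_of_pos_of_lt_pi ha0 (by linarith)
    rw [hg]
    simp only [hNa, Real.sin_nat_mul_pi, mul_zero, sub_zero]
    refine mul_ne_zero (mul_ne_zero hN.ne' hs.ne') ?_
    rw [Real.cos_nat_mul_pi]
    exact pow_ne_zero _ (by norm_num)
  have hne : ({x : ℝ | x ∈ Set.Ioo a c ∧ N * Real.tan x = Real.tan (N * x)}).Nonempty := by
    -- The midpoint of the interval, where cos(Nb) = 0 and only the term -cos b sin(Nb) of g is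
    -- left.
    set b : ℝ := (k + 1 / 2) * Real.pi / N with hb
    have hab : a < b := by rw [ha, hb]; gcongr; linarith
    have hbc : b < c := by rw [hb, hc]; gcongr; linarith
    have hNb : N * b = k * Real.pi + Real.pi / 2 := by rw [hb]; field_simp
    have hgb : g b = -Real.cos b * (-1) ^ k := by
      rw [hg]
      simp only [hNb, Real.cos_add_pi_div_two, Real.sin_nat_mul_pi, Real.sin_add_pi_div_two,
        Real.cos_nat_mul_pi]
      ring
    have hga' : g a = N * Real.sin a * (-1) ^ k := by
      rw [hg]
      simp only [hNa, Real.sin_nat_mul_pi, Real.cos_nat_mul_pi]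
      ring
    have hs : 0 < Real.sin a := Real.sin_pos_of_pos_of_lt_pi ha0 (by linarith)
    have hcb : 0 < Real.cos b := Real.cos_pos_of_mem_Ioo ⟨by linarith, by linarith⟩
    have hiv : (0 : ℝ) ∈ g '' Set.uIcc a b := by
      refine intermediate_value_uIcc hgc.continuousOn ?_
      rw [Set.mem_uIcc, hga', hgb]
      rcases neg_one_pow_eq_or ℝ k with h | h <;> rw [h]
      · right
        constructor
        · linarith
        · have : 0 < N * Real.sin a := by positivity
          linarith
      · left
        constructor
        · have : 0 < N * Real.sin a := by positivity
          linarith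
        · linarith
    obtain ⟨x, hx, hgx⟩ := hiv
    rw [Set.uIcc_of_le hab.le] at hx
    have hxa : a ≠ x := by rintro rfl; exact hga hgx
    have hx' : x ∈ Set.Ioo a c := ⟨lt_of_le_of_ne hx.1 hxa, hx.2.trans_lt hbc⟩
    exact ⟨x, hx', (hsol hx').2 hgx⟩
  have hx0 : P.lobePoint k ∈ Set.Ioo a c := by
    have hdef : P.lobePoint k = sInf {x : ℝ | x ∈ Set.Ioo a c ∧ N * Real.tan x = Real.tan (N * x)} :=
      rfl
    have hbdd : BddBelow {x : ℝ | x ∈ Set.Ioo a c ∧ N * Real.tan x = Real.tan (N * x)} :=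
      ⟨a, fun x hx => hx.1.1.le⟩
    rw [hdef]
    refine ⟨?_, ?_⟩
    · have hle := le_csInf hne (fun x (hx : x ∈ Set.Ioo a c ∧ _) => hx.1.1.le)
      -- If the infimum were a, there would be zeros of g arbitrarily close to a, against g a ≠ 0.
      refine lt_of_le_of_ne hle fun heq => ?_
      have hev : ∀ᶠ x in 𝓝 a, g x ≠ 0 := hgc.continuousAt.eventually_ne hga
      obtain ⟨δ, hδ, hball⟩ := Metric.eventually_nhds_iff.1 hev
      obtain ⟨x, hx, hxlt⟩ := exists_lt_of_csInf_lt hne (b := a + δ) (by linarith)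
      refine hball (y := x) ?_ ((hsol hx.1).1 hx.2)
      rw [Real.dist_eq, abs_lt]
      constructor <;> linarith [hx.1.1]
    · obtain ⟨x, hx⟩ := hne
      exact (csInf_le hbdd hx).trans_lt hx.1.2
  have hs : Real.sin (P.lobePoint k) ≠ 0 :=
    (Real.sin_pos_of_pos_of_lt_pi (ha0.trans hx0.1) (by linarith [hx0.2])).ne'
  have hsN : Real.sin (N * P.lobePoint k) ≠ 0 := by
    intro h
    obtain ⟨n, hn⟩ := Real.sin_eq_zero_iff.1 h
    have h1 : (k : ℝ) * Real.pi < n * Real.pi := by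
      rw [hn, ← hNa]; exact mul_lt_mul_of_pos_left hx0.1 hN
    have h3 : (n : ℝ) * Real.pi < (k + 1) * Real.pi := by
      have : N * c = (k + 1) * Real.pi := by rw [hc]; field_simp
      rw [hn, ← this]; exact mul_lt_mul_of_pos_left hx0.2 hN
    have h1' := lt_of_mul_lt_mul_right h1 hpi.le
    have h3' := lt_of_mul_lt_mul_right h3 hpi.le
    have h1'' : (k : ℤ) < n := by exact_mod_cast h1'
    have h3'' : n < (k : ℤ) + 1 := by exact_mod_cast h3'
    omega
  positivity

/-! ### The gain -/

lemma measurable_gain : Measurable P.gain := by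
  unfold gain
  refine Measurable.ite (measurableSet_le measurable_norm measurable_const) (by fun_prop) ?_
  refine Finset.measurable_fun_sum _ fun k _ => Measurable.ite ?_ (by fun_prop) measurable_const
  exact (measurableSet_lt measurable_const measurable_norm).inter
    (measurableSet_le measurable_norm measurable_const)

lemma gain_neg (x : ℝ) : P.gain (-x) = P.gain x := by
  unfold gain
  simp only [abs_neg, mul_neg, neg_div, Real.cos_neg, Real.sin_neg, neg_sq]

lemma gain_main {x : ℝ} (h0 : 0 ≤ x) (hx : x ≤ 2 / P.N) :
    P.gain x = Real.cos (P.N * Real.pi * x / 4) ^ 2 := by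
  rw [gain, if_pos (by rwa [abs_of_nonneg h0])]

lemma gain_side {k : ℕ} (hk1 : 1 ≤ k) (hk : k ≤ P.kmax) {x : ℝ} (h1 : 2 * (k : ℝ) / P.N < x)
    (h2 : x ≤ (2 * (k : ℝ) + 2) / P.N) :
    P.gain x = P.chi k * Real.sin (P.N * Real.pi * x / 2) ^ 2 := by
  have hN := P.N_pos
  have hk1' : (1 : ℝ) ≤ k := by exact_mod_cast hk1
  have h0 : 0 ≤ x := le_trans (by positivity) h1.le
  have h3 : 2 / (P.N : ℝ) < x := lt_of_le_of_lt (by gcongr; linarith) h1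
  rw [gain, abs_of_nonneg h0, if_neg (not_le.2 h3), Finset.sum_eq_single k]
  · rw [if_pos ⟨h1, h2⟩]
  · intro j _ hjk
    rw [if_neg]
    rintro ⟨h4, h5⟩
    have h6 := h4.trans_le h2
    have h7 := h1.trans_le h5
    rw [div_lt_div_iff_of_pos_right hN] at h6 h7
    have h6' : (j : ℝ) < k + 1 := by linarith
    have h7' : (k : ℝ) < j + 1 := by linarith
    have h6'' : j < k + 1 := by exact_mod_cast h6'
    have h7'' : k < j + 1 := by exact_mod_cast h7'
    omega
  · intro h
    exact absurd (Finset.mem_Icc.2 ⟨hk1, hk⟩) h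

lemma gain_outside {x : ℝ} (hx : (2 * (P.kmax : ℝ) + 2) / P.N < x) : P.gain x = 0 := by
  have hN := P.N_pos
  have h0 : 0 ≤ x := le_trans (by positivity) hx.le
  have h3 : 2 / (P.N : ℝ) < x :=
    lt_of_le_of_lt (by gcongr; linarith [Nat.cast_nonneg (α := ℝ) P.kmax]) hx
  rw [gain, abs_of_nonneg h0, if_neg (not_le.2 h3)]
  refine Finset.sum_eq_zero fun k hk => ?_
  rw [if_neg]
  rintro ⟨-, h⟩
  have hk' : (k : ℝ) ≤ P.kmax := by exact_mod_cast (Finset.mem_Icc.1 hk).2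
  have := hx.trans_le h
  rw [div_lt_div_iff_of_pos_right hN] at this
  linarith

lemma gain_nonneg (x : ℝ) : 0 ≤ P.gain x := by
  unfold gain
  split_ifs
  · positivity
  · refine Finset.sum_nonneg fun k hk => ?_
    split_ifs
    · exact mul_nonneg (P.chi_pos (Finset.mem_Icc.1 hk).2).le (sq_nonneg _)
    · exact le_rfl

/-- An upper bound of the gain. -/
noncomputable def gainBound : ℝ := 1 + ∑ k ∈ Finset.Icc 1 P.kmax, P.chi k

lemma gainBound_nonneg : 0 ≤ P.gainBound :=
  add_nonneg zero_le_one (Finset.sum_nonneg fun _ hk => (P.chi_pos (Finset.mem_Icc.1 hk).2).le)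

lemma gain_le (x : ℝ) : P.gain x ≤ P.gainBound := by
  have hS : 0 ≤ ∑ k ∈ Finset.Icc 1 P.kmax, P.chi k :=
    Finset.sum_nonneg fun k hk => (P.chi_pos (Finset.mem_Icc.1 hk).2).le
  unfold gain gainBound
  split_ifs
  · have := Real.cos_sq_le_one (P.N * Real.pi * x / 4)
    linarith
  · refine le_trans (Finset.sum_le_sum fun k hk => ?_) (le_add_of_nonneg_left zero_le_one)
    have hc := (P.chi_pos (Finset.mem_Icc.1 hk).2).le
    split_ifs
    · exact mul_le_of_le_one_right hc (Real.sin_sq_le_one _)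
    · exact hc

end Params

/-! ### Averages of functions of the gain over the sector. -/

lemma integral_cos_sq_half (Φ : ℝ → ℂ) (hΦ : Continuous Φ) :
    ∫ θ in (0 : ℝ)..Real.pi / 2, Φ (Real.cos θ ^ 2) =
      (1 / 2) * ∫ θ in (0 : ℝ)..Real.pi, Φ (Real.cos θ ^ 2) := by
  have hc : Continuous fun θ : ℝ => Φ (Real.cos θ ^ 2) := by fun_prop
  have h := intervalIntegral.integral_comp_sub_left (a := 0) (b := Real.pi / 2)
    (fun θ : ℝ => Φ (Real.cos θ ^ 2)) Real.pi
  simp only [Real.cos_pi_sub, neg_sq, sub_zero] at h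
  rw [show Real.pi - Real.pi / 2 = Real.pi / 2 by ring] at h
  have h2 := intervalIntegral.integral_add_adjacent_intervals
    (hc.intervalIntegrable (μ := volume) 0 (Real.pi / 2))
    (hc.intervalIntegrable (μ := volume) (Real.pi / 2) Real.pi)
  rw [← h] at h2
  rw [← h2]
  ring

lemma integral_sin_sq_period (Φ : ℝ → ℂ) (k : ℕ) :
    ∫ θ in (k * Real.pi : ℝ)..((k : ℝ) * Real.pi + Real.pi), Φ (Real.sin θ ^ 2) =
      ∫ θ in (0 : ℝ)..Real.pi, Φ (Real.cos θ ^ 2) := by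
  have hper : Function.Periodic (fun θ : ℝ => Φ (Real.sin θ ^ 2)) Real.pi := by
    intro θ
    simp only [Real.sin_add_pi, neg_sq]
  rw [hper.intervalIntegral_add_eq _ (Real.pi / 2)]
  have h := intervalIntegral.integral_comp_add_right (a := 0) (b := Real.pi)
    (fun θ : ℝ => Φ (Real.sin θ ^ 2)) (Real.pi / 2)
  simp only [Real.sin_add_pi_div_two, zero_add] at h
  rw [h, add_comm]

namespace Params

variable (P : Params)

/-- The main lobe is mapped by θ = Nπx/4 onto half a period of cos², a side lobe by θ = Nπx/2 onto a
whole period of sin². After symmetrization both carry the same weight 2/(Nπ), so that main and side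
lobes enter alike. -/
lemma integral_gain_lobe {Φ : ℝ → ℂ} (hΦ : Continuous Φ) {k : ℕ} (hk : k ≤ P.kmax) :
    ∫ x in (2 * (k : ℝ) / P.N)..(2 * ((k + 1 : ℕ) : ℝ) / P.N), Φ (P.gain x) =
      ((2 / (P.N * Real.pi) : ℝ) : ℂ) *
        ∫ θ in (0 : ℝ)..Real.pi, Φ (P.chi k * Real.cos θ ^ 2) := by
  have hN := P.N_pos
  have hpi := Real.pi_pos
  have hle : 2 * (k : ℝ) / P.N ≤ 2 * ((k + 1 : ℕ) : ℝ) / P.N := by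
    gcongr; exact Nat.le_succ k
  rcases Nat.eq_zero_or_pos k with rfl | hk0
  · have h1 : ∫ x in (2 * ((0 : ℕ) : ℝ) / P.N)..(2 * ((0 + 1 : ℕ) : ℝ) / P.N), Φ (P.gain x) =
        ∫ x in (0 : ℝ)..(2 / P.N), Φ (Real.cos (P.N * Real.pi / 4 * x) ^ 2) := by
      simp only [Nat.cast_zero, mul_zero, zero_div, zero_add, Nat.cast_one, mul_one]
      refine intervalIntegral.integral_congr fun x hx => ?_
      rw [Set.uIcc_of_le (by positivity)] at hx
      simp only [P.gain_main hx.1 hx.2]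
      rw [show P.N * Real.pi * x / 4 = P.N * Real.pi / 4 * x by ring]
    have hne : (P.N : ℝ) * Real.pi / 4 ≠ 0 := by positivity
    rw [h1, intervalIntegral.integral_comp_mul_left (fun θ => Φ (Real.cos θ ^ 2)) hne, mul_zero,
      show P.N * Real.pi / 4 * (2 / P.N) = Real.pi / 2 by field_simp; ring,
      integral_cos_sq_half Φ hΦ, Complex.real_smul]
    simp only [chi, if_true, one_mul]
    push_cast
    field_simp
    ring
  · have h1 : ∫ x in (2 * (k : ℝ) / P.N)..(2 * ((k + 1 : ℕ) : ℝ) / P.N), Φ (P.gain x) =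
        ∫ x in (2 * (k : ℝ) / P.N)..(2 * ((k + 1 : ℕ) : ℝ) / P.N),
          Φ (P.chi k * Real.sin (P.N * Real.pi / 2 * x) ^ 2) := by
      refine intervalIntegral.integral_congr_ae (Eventually.of_forall fun x hx => ?_)
      rw [Set.uIoc_of_le hle] at hx
      rw [P.gain_side hk0 hk hx.1 (hx.2.trans_eq (by push_cast; ring)),
        show P.N * Real.pi * x / 2 = P.N * Real.pi / 2 * x by ring]
    have hne : (P.N : ℝ) * Real.pi / 2 ≠ 0 := by positivity
    rw [h1, intervalIntegral.integral_comp_mul_left (fun θ => Φ (P.chi k * Real.sin θ ^ 2)) hne,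
      show P.N * Real.pi / 2 * (2 * (k : ℝ) / P.N) = k * Real.pi by field_simp,
      show P.N * Real.pi / 2 * (2 * ((k + 1 : ℕ) : ℝ) / P.N) = k * Real.pi + Real.pi by
        push_cast; field_simp,
      integral_sin_sq_period (fun s => Φ (P.chi k * s)), Complex.real_smul]
    push_cast
    field_simp

lemma intervalIntegrable_comp_gain {Φ : ℝ → ℂ} (hΦ : Continuous Φ) (hb : ∀ s, ‖Φ s‖ ≤ 1)
    (a b : ℝ) : IntervalIntegrable (fun x => Φ (P.gain x)) volume a b := by
  refine (intervalIntegrable_const (c := (1 : ℝ))).mono_fun'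
    (hΦ.measurable.comp P.measurable_gain).aestronglyMeasurable
    (Eventually.of_forall fun x => hb _)

lemma integral_comp_gain {Φ : ℝ → ℂ} (hΦ : Continuous Φ) (hb : ∀ s, ‖Φ s‖ ≤ 1) :
    ∫ x in (-(Real.pi / 3))..(Real.pi / 3), Φ (P.gain x) =
      2 * ((∑ k ∈ Finset.range (P.kmax + 1), ((2 / (P.N * Real.pi) : ℝ) : ℂ) *
        ∫ θ in (0 : ℝ)..Real.pi, Φ (P.chi k * Real.cos θ ^ 2)) +
        ((Real.pi / 3 - 2 * (P.kmax + 1) / P.N : ℝ) : ℂ) * Φ 0) := by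
  have hint := P.intervalIntegrable_comp_gain hΦ hb
  have hN := P.N_pos
  have hneg : ∫ x in (-(Real.pi / 3))..0, Φ (P.gain x) = ∫ x in (0 : ℝ)..(Real.pi / 3), Φ (P.gain x) := by
    have := intervalIntegral.integral_comp_neg (a := 0) (b := Real.pi / 3) (fun x => Φ (P.gain x))
    simp only [P.gain_neg, neg_zero] at this
    exact this.symm
  rw [← intervalIntegral.integral_add_adjacent_intervals (hint _ 0) (hint 0 _), hneg, ← two_mul]
  congr 1
  rw [← intervalIntegral.integral_add_adjacent_intervals
    (hint 0 (2 * ((P.kmax + 1 : ℕ) : ℝ) / P.N)) (hint _ _)]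
  congr 1
  · have := intervalIntegral.sum_integral_adjacent_intervals
      (f := fun x => Φ (P.gain x)) (μ := volume) (a := fun k : ℕ => 2 * (k : ℝ) / P.N)
      (n := P.kmax + 1) (fun k _ => hint _ _)
    simp only [Nat.cast_zero, mul_zero, zero_div] at this
    rw [← this]
    refine Finset.sum_congr rfl fun k hk => ?_
    exact P.integral_gain_lobe hΦ (Nat.lt_succ_iff.1 (Finset.mem_range.1 hk))
  · have hle : 2 * ((P.kmax + 1 : ℕ) : ℝ) / P.N ≤ Real.pi / 3 := by
      rw [div_le_div_iff₀ hN (by norm_num)]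
      have h := P.kmax_le
      have h3 : √3 ≤ 2 := by
        rw [Real.sqrt_le_left (by norm_num)]; norm_num
      have hpi := Real.pi_gt_three
      push_cast
      nlinarith
    have h1 : ∫ x in (2 * ((P.kmax + 1 : ℕ) : ℝ) / P.N)..(Real.pi / 3), Φ (P.gain x) =
        ∫ x in (2 * ((P.kmax + 1 : ℕ) : ℝ) / P.N)..(Real.pi / 3), Φ 0 := by
      refine intervalIntegral.integral_congr_ae (Eventually.of_forall fun x hx => ?_)
      rw [Set.uIoc_of_le hle] at hx
      rw [P.gain_outside]
      refine lt_of_eq_of_lt ?_ hx.1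
      push_cast; ring
    rw [h1, intervalIntegral.integral_const, Complex.real_smul]
    push_cast
    ring

end Params

end EMFE


namespace EMFE

/-! ### The gamma distribution -/

lemma norm_exp_neg_mul (r : ℂ) (x : ℝ) : ‖Complex.exp (-(r * x))‖ = Real.exp (-(r.re * x)) := by
  rw [Complex.norm_exp]; simp

lemma integrableOn_pow_mul_exp_neg_mul {b : ℝ} (hb : 0 < b) (k : ℕ) :
    IntegrableOn (fun x : ℝ => x ^ k * Real.exp (-(b * x))) (Set.Ioi 0) := by
  have h := integrableOn_rpow_mul_exp_neg_mul_rpow (p := 1) (s := k) (b := b)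
    (by have : (0 : ℝ) ≤ k := Nat.cast_nonneg k
        linarith) one_pos hb
  simpa only [Real.rpow_natCast, Real.rpow_one, neg_mul] using h

lemma integrableOn_pow_mul_cexp_neg_mul {r : ℂ} (hr : 0 < r.re) (k : ℕ) :
    IntegrableOn (fun x : ℝ => (x : ℂ) ^ k * Complex.exp (-(r * x))) (Set.Ioi 0) := by
  refine (integrableOn_pow_mul_exp_neg_mul hr k).mono'
    (Continuous.aestronglyMeasurable (by fun_prop)) ?_
  filter_upwards [ae_restrict_mem measurableSet_Ioi] with x hx
  rw [norm_mul, norm_exp_neg_mul, norm_pow, Complex.norm_real, Real.norm_of_nonneg (le_of_lt hx)]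

lemma tendsto_pow_mul_cexp_neg_mul {r : ℂ} (hr : 0 < r.re) (k : ℕ) :
    Tendsto (fun x : ℝ => (x : ℂ) ^ k * Complex.exp (-(r * x))) atTop (𝓝 0) := by
  rw [tendsto_zero_iff_norm_tendsto_zero]
  refine (tendsto_rpow_mul_exp_neg_mul_atTop_nhds_zero k r.re hr).congr' ?_
  filter_upwards [eventually_ge_atTop 0] with x hx
  rw [norm_mul, norm_exp_neg_mul, norm_pow, Complex.norm_real, Real.norm_of_nonneg hx,
    Real.rpow_natCast, neg_mul]

lemma hasDerivAt_cexp_neg_mul (r : ℂ) (x : ℝ) :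
    HasDerivAt (fun x : ℝ => Complex.exp (-(r * x))) (-r * Complex.exp (-(r * x))) x := by
  have h : HasDerivAt (fun x : ℝ => -(r * (x : ℂ))) (-r) x := by
    simpa using ((hasDerivAt_id x).ofReal_comp.const_mul r).fun_neg
  exact h.cexp.congr_deriv (by ring)

/-- Induction on k by integrating the derivative of x^(k+1) e^{-rx}, whose boundary values vanish
because Re r > 0. -/
lemma integral_pow_mul_cexp_neg_mul {r : ℂ} (hr : 0 < r.re) (k : ℕ) :
    ∫ x : ℝ in Set.Ioi 0, (x : ℂ) ^ k * Complex.exp (-(r * x)) = k.factorial / r ^ (k + 1) := by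
  have hr0 : r ≠ 0 := by rintro rfl; simp at hr
  induction k with
  | zero =>
    have h := integral_exp_mul_complex_Ioi (a := -r) (by simpa using hr) 0
    simp only [pow_zero, one_mul, neg_mul] at h ⊢
    rw [h]
    simp
  | succ k ih =>
    have h := integral_Ioi_of_hasDerivAt_of_tendsto' (a := 0)
      (f := fun x : ℝ => (x : ℂ) ^ (k + 1) * Complex.exp (-(r * x)))
      (f' := fun x : ℝ => (k + 1) * ((x : ℂ) ^ k * Complex.exp (-(r * x))) -
        r * ((x : ℂ) ^ (k + 1) * Complex.exp (-(r * x)))) (fun x _ => by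
        have h1 : HasDerivAt (fun x : ℝ => (x : ℂ) ^ (k + 1)) ((k + 1) * (x : ℂ) ^ k) x := by
          have := (hasDerivAt_pow (k + 1) (x : ℂ)).comp_ofReal
          simpa using this
        exact (h1.fun_mul (hasDerivAt_cexp_neg_mul r x)).congr_deriv (by ring))
      (((integrableOn_pow_mul_cexp_neg_mul hr k).const_mul _).sub
        ((integrableOn_pow_mul_cexp_neg_mul hr (k + 1)).const_mul _))
      (tendsto_pow_mul_cexp_neg_mul hr (k + 1))
    rw [integral_sub ((integrableOn_pow_mul_cexp_neg_mul hr k).const_mul _)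
      ((integrableOn_pow_mul_cexp_neg_mul hr (k + 1)).const_mul _), integral_const_mul,
      integral_const_mul, ih] at h
    simp only [Complex.ofReal_zero, zero_pow (Nat.succ_ne_zero k), zero_mul, sub_zero] at h
    rw [Nat.factorial_succ]
    push_cast
    field_simp at h ⊢
    linear_combination -h

lemma gammaPDFReal_natCast {m : ℕ} (hm : 1 ≤ m) {x : ℝ} (hx : 0 ≤ x) :
    gammaPDFReal m m x = (m : ℝ) ^ m / (m - 1).factorial * (x ^ (m - 1) * Real.exp (-(m * x))) := by
  rw [gammaPDFReal, if_pos hx]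
  obtain ⟨n, rfl⟩ : ∃ n, m = n + 1 := ⟨m - 1, by omega⟩
  rw [Real.rpow_natCast, Nat.add_sub_cancel]
  have h : (((n + 1 : ℕ) : ℝ) - 1) = n := by push_cast; ring
  rw [h, Real.rpow_natCast]
  have h2 : Real.Gamma ((n + 1 : ℕ) : ℝ) = n.factorial := by
    push_cast
    exact Real.Gamma_nat_eq_factorial n
  rw [h2]
  ring

lemma measurable_gammaPDF (a r : ℝ) : Measurable (gammaPDF a r) :=
  (measurable_gammaPDFReal a r).ennreal_ofReal

lemma integral_gammaMeasure {m : ℕ} (hm : 1 ≤ m) (f : ℝ → ℂ) :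
    ∫ x, f x ∂gammaMeasure m m = ∫ x in Set.Ioi 0,
      (((m : ℝ) ^ m / (m - 1).factorial * (x ^ (m - 1) * Real.exp (-(m * x))) : ℝ) : ℂ) * f x := by
  have hm' : (0 : ℝ) < m := by exact_mod_cast hm
  rw [gammaMeasure, integral_withDensity_eq_integral_toReal_smul (measurable_gammaPDF _ _)
    (Eventually.of_forall fun x => ENNReal.ofReal_lt_top), ← integral_Ici_eq_integral_Ioi,
    ← integral_indicator measurableSet_Ici]
  refine integral_congr_ae (Eventually.of_forall fun x => ?_)
  by_cases hx : 0 ≤ x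
  · simp only [Set.indicator_of_mem (Set.mem_Ici.2 hx)]
    rw [gammaPDF, ENNReal.toReal_ofReal (gammaPDFReal_nonneg hm' hm' x), gammaPDFReal_natCast hm hx,
      Complex.real_smul]
  · simp only [Set.indicator_of_notMem (fun h => hx (Set.mem_Ici.1 h))]
    rw [gammaPDF_of_neg (not_le.1 hx)]
    simp

lemma charFun_gamma {m : ℕ} (hm : 1 ≤ m) (t : ℝ) :
    ∫ x, Complex.exp (Complex.I * ((t * x : ℝ) : ℂ)) ∂gammaMeasure m m =
      ((1 - Complex.I * ((t / m : ℝ) : ℂ)) ^ m)⁻¹ := by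
  have hm' : (0 : ℝ) < m := by exact_mod_cast hm
  have hmC : (m : ℂ) ≠ 0 := by exact_mod_cast hm'.ne'
  rw [integral_gammaMeasure hm]
  have hre : 0 < ((m : ℂ) - Complex.I * t).re := by
    simpa using Nat.lt_of_lt_of_le Nat.one_pos hm
  have h := integral_pow_mul_cexp_neg_mul hre (m - 1)
  have e (x : ℝ) : (((m : ℝ) ^ m / (m - 1).factorial * (x ^ (m - 1) * Real.exp (-(m * x))) : ℝ) : ℂ)
      * Complex.exp (Complex.I * ((t * x : ℝ) : ℂ)) =
      ((m : ℂ) ^ m / (m - 1).factorial) *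
        ((x : ℂ) ^ (m - 1) * Complex.exp (-(((m : ℂ) - Complex.I * t) * x))) := by
    have : Complex.exp (-(((m : ℂ) - Complex.I * t) * x)) =
        Complex.exp (-(m * x)) * Complex.exp (Complex.I * (t * x)) := by
      rw [← Complex.exp_add]; congr 1; ring
    rw [this]
    push_cast
    ring
  simp only [e]
  rw [integral_const_mul, h, Nat.sub_add_cancel hm]
  have hf : ((m - 1).factorial : ℂ) ≠ 0 := by exact_mod_cast (Nat.factorial_pos _).ne'
  have hne : (m : ℂ) - Complex.I * t ≠ 0 := by
    intro h0; rw [h0] at hre; simp at hre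
  have e2 : 1 - Complex.I * ((t / m : ℝ) : ℂ) = ((m : ℂ) - Complex.I * t) / m := by
    push_cast; field_simp
  rw [e2, div_pow]
  field_simp

lemma integrable_id_gammaMeasure {m : ℕ} (hm : 1 ≤ m) :
    Integrable (fun x : ℝ => x) (gammaMeasure m m) := by
  have hm' : (0 : ℝ) < m := by exact_mod_cast hm
  rw [gammaMeasure, integrable_withDensity_iff (measurable_gammaPDF _ _)
    (Eventually.of_forall fun x => ENNReal.ofReal_lt_top)]
  have h := (integrableOn_pow_mul_exp_neg_mul hm' m).const_mul ((m : ℝ) ^ m / (m - 1).factorial)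
  have h' := (integrable_indicator_iff measurableSet_Ioi).2 h
  refine h'.congr (Eventually.of_forall fun x => ?_)
  by_cases hx : 0 < x
  · simp only [Set.indicator_of_mem (Set.mem_Ioi.2 hx)]
    rw [gammaPDF, ENNReal.toReal_ofReal (gammaPDFReal_nonneg hm' hm' x),
      gammaPDFReal_natCast hm hx.le]
    have : x ^ m = x ^ (m - 1) * x := by rw [← pow_succ, Nat.sub_add_cancel hm]
    rw [this]; ring
  · simp only [Set.indicator_of_notMem (fun h => hx (Set.mem_Ioi.1 h))]
    rcases lt_or_eq_of_le (not_lt.1 hx) with hx' | rfl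
    · rw [gammaPDF_of_neg hx']; simp
    · simp

lemma gammaMeasure_singleton (a r x : ℝ) : gammaMeasure a r {x} = 0 :=
  withDensity_absolutelyContinuous _ _ (by simp)

/-! ### The law of one mark -/

namespace Network

variable {Ω : Type*} (S : Network Ω) (P : Params)

/-- `G(ξ_i) |h_i|²`. -/
noncomputable def mark (i : ℕ) (ω : Ω) : ℝ := P.gain (S.xi i ω) * ‖S.h i ω‖ ^ 2

variable {S P} [MeasurableSpace Ω] {μ : Measure Ω}

lemma IsModel.measurable_mark (hS : S.IsModel P μ) (i : ℕ) : Measurable (S.mark P i) :=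
  (P.measurable_gain.comp (hS.measurable_xi i)).mul ((hS.measurable_h i).norm.pow_const 2)

/-- The mean of `|h_i|²`, up to the bound of the gain. -/
noncomputable def markMean (P : Params) : ℝ :=
  P.gainBound * ∫ x, |x| ∂gammaMeasure P.m P.m

lemma IsModel.integrable_mark (hS : S.IsModel P μ) (i : ℕ) :
    Integrable (S.mark P i) μ ∧ ∫ ω, |S.mark P i ω| ∂μ ≤ markMean P := by
  have hX : AEMeasurable (fun ω => ‖S.h i ω‖ ^ 2) μ := (hS.gamma_h i).aemeasurable
  have h0 : Integrable (fun ω => ‖S.h i ω‖ ^ 2) μ := by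
    have h := integrable_id_gammaMeasure P.one_le_m
    rw [← (hS.gamma_h i).map_eq] at h
    exact (integrable_map_measure measurable_id.aestronglyMeasurable hX).1 h
  have hle (ω : Ω) : |S.mark P i ω| ≤ P.gainBound * |‖S.h i ω‖ ^ 2| := by
    rw [mark, abs_mul, abs_of_nonneg (P.gain_nonneg _)]
    exact mul_le_mul_of_nonneg_right (P.gain_le _) (abs_nonneg _)
  have h1 : Integrable (S.mark P i) μ :=
    (h0.abs.const_mul P.gainBound).mono' (hS.measurable_mark i).aestronglyMeasurable
      (Eventually.of_forall hle)
  refine ⟨h1, ?_⟩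
  refine (integral_mono h1.abs (h0.abs.const_mul P.gainBound) hle).trans_eq ?_
  rw [integral_const_mul, markMean, ← (hS.gamma_h i).map_eq,
    integral_map hX (continuous_abs.aestronglyMeasurable)]

variable [IsProbabilityMeasure μ]

/-- The uniform law of the angles. -/
noncomputable def angleLaw : Measure ℝ :=
  ProbabilityTheory.cond volume (Set.Ico (-(Real.pi / 3)) (Real.pi / 3))

lemma IsModel.map_angle_fading (hS : S.IsModel P μ) (i : ℕ) :
    μ.map (fun ω => (S.xi i ω, ‖S.h i ω‖ ^ 2)) = angleLaw.prod (gammaMeasure P.m P.m) := by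
  have h : IndepFun (S.xi i) (fun ω => ‖S.h i ω‖ ^ 2) μ :=
    (hS.indep_mark i).comp (φ := id) (ψ := fun z : ℂ => ‖z‖ ^ 2) measurable_id
      (measurable_norm.pow_const 2)
  rw [(indepFun_iff_map_prod_eq_prod_map_map (hS.measurable_xi i).aemeasurable
    ((hS.measurable_h i).norm.pow_const 2).aemeasurable).1 h, (hS.uniform_xi i).map_eq,
    (hS.gamma_h i).map_eq]
  rfl

instance : IsProbabilityMeasure angleLaw := by
  unfold angleLaw
  refine cond_isProbabilityMeasure_of_finite ?_ ?_
  · rw [Real.volume_Ico]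
    have := Real.pi_pos
    simp only [ne_eq, ENNReal.ofReal_eq_zero, not_le]
    linarith
  · rw [Real.volume_Ico]; exact ENNReal.ofReal_ne_top

lemma integral_angleLaw (f : ℝ → ℂ) :
    ∫ x, f x ∂angleLaw = ((3 / (2 * Real.pi) : ℝ) : ℂ) *
      ∫ x in (-(Real.pi / 3))..(Real.pi / 3), f x := by
  have hpi := Real.pi_pos
  rw [angleLaw, ProbabilityTheory.cond, integral_smul_measure, Real.volume_Ico,
    intervalIntegral.integral_of_le (by linarith), integral_Ico_eq_integral_Ioc,
    ENNReal.toReal_inv, ENNReal.toReal_ofReal (by linarith), Complex.real_smul]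
  congr 2
  field_simp
  ring

/-- Integrating the fading first gives (1 - jyG)^(-m); the average over the angle then splits into
lobes. The explicit `stationChar` is thereby a genuine characteristic function. -/
lemma IsModel.integral_cexp_mark (hS : S.IsModel P μ) (i : ℕ) (q r : ℝ) :
    ∫ ω, Complex.exp (Complex.I * ((q * (P.Sbar r * S.mark P i ω) : ℝ) : ℂ)) ∂μ =
      P.stationChar q r := by
  have hm := P.one_le_m
  have hmp := P.m_pos
  have hN := P.N_pos
  have hpi := Real.pi_pos
  have : IsProbabilityMeasure (gammaMeasure P.m P.m) := isProbabilityMeasure_gammaMeasure hmp hmp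
  set g : ℝ × ℝ → ℂ := fun p => Complex.exp (Complex.I * ((q * P.Sbar r * P.gain p.1 * p.2 : ℝ) : ℂ))
    with hg
  have hgm : Measurable g := by
    have := P.measurable_gain
    refine Complex.measurable_exp.comp (measurable_const.mul (Complex.measurable_ofReal.comp ?_))
    exact (measurable_const.mul (this.comp measurable_fst)).mul measurable_snd
  have hgb (p : ℝ × ℝ) : ‖g p‖ ≤ 1 := by
    rw [hg]
    simp only
    rw [mul_comm, Complex.norm_exp_ofReal_mul_I]
  have hgi : Integrable g (angleLaw.prod (gammaMeasure P.m P.m)) :=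
    Integrable.of_bound hgm.aestronglyMeasurable 1 (Eventually.of_forall hgb)
  have h1 : ∫ ω, Complex.exp (Complex.I * ((q * (P.Sbar r * S.mark P i ω) : ℝ) : ℂ)) ∂μ =
      ∫ p, g p ∂(μ.map (fun ω => (S.xi i ω, ‖S.h i ω‖ ^ 2))) := by
    rw [integral_map ((hS.measurable_xi i).prodMk
      ((hS.measurable_h i).norm.pow_const 2)).aemeasurable hgm.aestronglyMeasurable]
    refine integral_congr_ae (Eventually.of_forall fun ω => ?_)
    simp only [hg, mark]
    congr 3
    ring
  rw [h1, hS.map_angle_fading i, integral_prod _ hgi]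
  simp only [hg, charFun_gamma hm]
  rw [integral_angleLaw]
  set y : ℝ := q * P.Sbar r / P.m with hy
  have e (x : ℝ) : 1 - Complex.I * ((q * P.Sbar r * P.gain x / P.m : ℝ) : ℂ) =
      1 - Complex.I * y * ((P.gain x : ℝ) : ℂ) := by
    rw [hy]; push_cast; ring
  simp only [e]
  rw [P.integral_comp_gain (Φ := fun s => ((1 - Complex.I * y * (s : ℂ)) ^ P.m)⁻¹)
    (Continuous.inv₀ (by fun_prop) fun s => pow_ne_zero _ (lobe_denom_ne_zero _ _))
    (fun s => norm_lobe_pow_inv_le _ _ _)]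
  have e2 (k : ℕ) : ∫ θ in (0 : ℝ)..Real.pi,
      ((1 - Complex.I * y * ((P.chi k * Real.cos θ ^ 2 : ℝ) : ℂ)) ^ P.m)⁻¹ =
      Real.pi * P.lobeChar k q r := by
    have := integral_lobe_pow P.m hm (y * P.chi k)
    have e3 : Complex.I * ((y * P.chi k : ℝ) : ℂ) = P.jarg k r q := by
      rw [Params.jarg, hy]; push_cast; ring
    rw [e3] at this
    rw [Params.lobeChar]
    refine Eq.trans ?_ (this.trans rfl)
    refine intervalIntegral.integral_congr fun θ _ => ?_
    simp only [← e3]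
    push_cast
    ring_nf
  simp only [e2]
  rw [Params.stationChar, Params.lobeProb, ← Finset.mul_sum, ← Finset.mul_sum]
  have hNC : (P.N : ℂ) ≠ 0 := by exact_mod_cast hN.ne'
  have hpiC : (Real.pi : ℂ) ≠ 0 := by exact_mod_cast hpi.ne'
  push_cast
  simp only [mul_zero, sub_zero, one_pow, inv_one]
  field_simp
  ring

/-- For a fixed angle, G s = t ≠ 0 pins s to at most one point, which is null for the gamma law. The
value 0 is excluded because the gain vanishes beyond the kept lobes. -/
lemma IsModel.mark_ne (hS : S.IsModel P μ) (i : ℕ) {t : ℝ} (ht : t ≠ 0) :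
    μ {ω | S.mark P i ω = t} = 0 := by
  have hmp := P.m_pos
  have : IsProbabilityMeasure (gammaMeasure P.m P.m) := isProbabilityMeasure_gammaMeasure hmp hmp
  have hmeas : MeasurableSet {p : ℝ × ℝ | P.gain p.1 * p.2 = t} :=
    measurableSet_eq_fun ((P.measurable_gain.comp measurable_fst).mul measurable_snd)
      measurable_const
  have h1 : μ {ω | S.mark P i ω = t} =
      (μ.map (fun ω => (S.xi i ω, ‖S.h i ω‖ ^ 2))) {p : ℝ × ℝ | P.gain p.1 * p.2 = t} := by
    rw [Measure.map_apply ((hS.measurable_xi i).prodMk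
      ((hS.measurable_h i).norm.pow_const 2)) hmeas]
    rfl
  rw [h1, hS.map_angle_fading i, Measure.measure_prod_null hmeas]
  refine Eventually.of_forall fun x => ?_
  have hsub : Prod.mk x ⁻¹' {p : ℝ × ℝ | P.gain p.1 * p.2 = t} ⊆ {t / P.gain x} := by
    intro s hs
    have hs' : P.gain x * s = t := hs
    have h0 : P.gain x ≠ 0 := by
      intro h0; rw [h0, zero_mul] at hs'; exact ht hs'.symm
    rw [Set.mem_singleton_iff, eq_div_iff h0, mul_comm]
    exact hs'
  exact measure_mono_null hsub (gammaMeasure_singleton _ _ _)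

lemma markMean_nonneg (P : Params) : 0 ≤ markMean P :=
  mul_nonneg P.gainBound_nonneg (integral_nonneg fun _ => abs_nonneg _)

end Network

end EMFE


namespace EMFE

/-! ### Functionals of point processes -/

section PointProcess

variable {Ω E : Type*} [MeasurableSpace E]

lemma measurable_comp_nat {Ω β : Type*} [MeasurableSpace Ω] [MeasurableSpace β] {n : Ω → ℕ}
    (hn : Measurable n) {f : ℕ → Ω → β} (hf : ∀ k, Measurable (f k)) : Measurable fun ω => f (n ω) ω := by
  have h : Measurable fun p : ℕ × Ω => f p.1 p.2 := measurable_from_prod_countable_right hf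
  exact h.comp (hn.prodMk measurable_id)

lemma measurable_count [MeasurableSpace Ω] {n : Ω → ℕ} (hn : Measurable n) {X : ℕ → Ω → E}
    (hX : ∀ i, Measurable (X i)) {B : Set E} (hB : MeasurableSet B) : Measurable (count n X B) := by
  classical
  have h (k : ℕ) : Measurable fun ω => ((Finset.range k).filter (fun i => X i ω ∈ B)).card := by
    simp only [Finset.card_filter]
    exact Finset.measurable_fun_sum _ fun i _ =>
      Measurable.ite (hX i hB) measurable_const measurable_const
  have := measurable_comp_nat hn h
  convert this using 1
  funext ω
  rw [count]

lemma pointSigma_le [mΩ : MeasurableSpace Ω] {n : Ω → ℕ} (hn : Measurable n) {X : ℕ → Ω → E}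
    (hX : ∀ i, Measurable (X i)) : pointSigma n X ≤ mΩ :=
  iSup₂_le fun _ hB => (measurable_count hn hX hB).comap_le

lemma measurable_count_pointSigma (n : Ω → ℕ) (X : ℕ → Ω → E) {B : Set E} (hB : MeasurableSet B) :
    Measurable[pointSigma n X] (count n X B) := by
  rw [measurable_iff_comap_le]
  exact le_iSup₂_of_le B hB le_rfl

/-- Grouping the points by the value of g writes the product through the counts of the fibres, which
are the only quantities that the Poisson axioms and `pointSigma` speak of. -/
lemma prod_simpleFunc (n : Ω → ℕ) (X : ℕ → Ω → E) (g : SimpleFunc E ℂ) (ω : Ω) :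
    ∏ i ∈ Finset.range (n ω), g (X i ω) = ∏ v ∈ g.range, v ^ count n X (g ⁻¹' {v}) ω := by
  classical
  rw [← Finset.prod_fiberwise_of_maps_to (s := Finset.range (n ω)) (t := g.range)
    (g := fun i => g (X i ω)) (fun i _ => g.mem_range_self _)]
  refine Finset.prod_congr rfl fun v _ => ?_
  rw [Finset.prod_congr rfl (g := fun _ => v) (fun i hi => (Finset.mem_filter.1 hi).2),
    Finset.prod_const, count]
  congr 2

lemma tendsto_prod_approx (n : Ω → ℕ) (X : ℕ → Ω → E) {g : E → ℂ} (hg : StronglyMeasurable g)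
    (hb : ∀ x, ‖g x‖ ≤ 1) (ω : Ω) :
    Tendsto (fun k => ∏ i ∈ Finset.range (n ω), hg.approxBounded 1 k (X i ω)) atTop
      (𝓝 (∏ i ∈ Finset.range (n ω), g (X i ω))) :=
  tendsto_finsetProd _ fun _ _ => hg.tendsto_approxBounded_of_norm_le (hb _)

/-- The σ-algebra of the process does not see the enumeration of the points, but the product is
symmetric in them: it is a limit of products over simple functions, each a function of counts. -/
lemma stronglyMeasurable_prod_pointSigma (n : Ω → ℕ) (X : ℕ → Ω → E) {g : E → ℂ}
    (hg : Measurable g) (hb : ∀ x, ‖g x‖ ≤ 1) :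
    StronglyMeasurable[pointSigma n X] fun ω => ∏ i ∈ Finset.range (n ω), g (X i ω) := by
  have hg' := hg.stronglyMeasurable
  refine stronglyMeasurable_of_tendsto (m := pointSigma n X) atTop (fun k => ?_)
    (tendsto_pi_nhds.2 (tendsto_prod_approx n X hg' hb))
  simp only [prod_simpleFunc]
  refine Measurable.stronglyMeasurable ?_
  refine Finset.measurable_fun_prod _ fun v _ => ?_
  exact (measurable_from_top (f := fun j : ℕ => v ^ j)).comp
    (measurable_count_pointSigma n X (SimpleFunc.measurableSet_fiber _ _))

lemma count_univ {Ω E : Type*} (n : Ω → ℕ) (X : ℕ → Ω → E) : count n X Set.univ = n := by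
  funext ω
  simp [count]

lemma norm_prod_le {Ω E : Type*} (n : Ω → ℕ) (X : ℕ → Ω → E) {g : E → ℂ} (hb : ∀ x, ‖g x‖ ≤ 1)
    (ω : Ω) : ‖∏ i ∈ Finset.range (n ω), g (X i ω)‖ ≤ 1 := by
  rw [norm_prod]
  exact Finset.prod_le_one (fun _ _ => norm_nonneg _) fun _ _ => hb _

end PointProcess

lemma integral_pow_poissonMeasure (r : NNReal) (v : ℂ) :
    ∫ k, v ^ k ∂poissonMeasure r = Complex.exp (r * (v - 1)) := by
  rw [integral_poissonMeasure]
  have h := (NormedSpace.expSeries_div_hasSum_exp ((r : ℂ) * v)).mul_left (Complex.exp (-r))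
  rw [← Complex.exp_eq_exp_ℂ, ← Complex.exp_add] at h
  rw [show (r : ℂ) * (v - 1) = -r + r * v by ring, ← h.tsum_eq]
  refine tsum_congr fun k => ?_
  rw [Complex.real_smul]
  push_cast
  rw [mul_pow]
  ring

namespace IsPoissonProcess

variable {Ω E : Type*} [mΩ : MeasurableSpace Ω] [MeasurableSpace E] {μ : Measure Ω}
  {L : Measure E} {n : Ω → ℕ} {X : ℕ → Ω → E}

lemma isFiniteMeasure (h : IsPoissonProcess μ L n X) : IsFiniteMeasure L := ⟨h.finite_intensity⟩

lemma measurable_prod (h : IsPoissonProcess μ L n X) {g : E → ℂ} (hg : Measurable g) :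
    Measurable fun ω => ∏ i ∈ Finset.range (n ω), g (X i ω) :=
  measurable_comp_nat h.measurable_card fun _ =>
    Finset.measurable_fun_prod _ fun i _ => hg.comp (h.measurable_point i)

/-- The fibres of g are disjoint, so their counts are independent Poisson variables, and each
contributes its probability generating function. -/
lemma integral_prod_simpleFunc [IsProbabilityMeasure μ] (h : IsPoissonProcess μ L n X)
    (g : SimpleFunc E ℂ) :
    ∫ ω, ∏ i ∈ Finset.range (n ω), g (X i ω) ∂μ = Complex.exp (∫ x, (g x - 1) ∂L) := by
  have := h.isFiniteMeasure
  simp only [prod_simpleFunc]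
  set e := g.range.equivFin with he
  have hB (j : Fin g.range.card) : MeasurableSet (g ⁻¹' {((e.symm j : g.range) : ℂ)}) :=
    g.measurableSet_fiber _
  have hind := h.indep_count g.range.card (fun j => g ⁻¹' {((e.symm j : g.range) : ℂ)}) hB
    (by
      intro i j hij
      refine Disjoint.preimage _ (Set.disjoint_singleton.2 fun hc => hij ?_)
      exact e.symm.injective (Subtype.ext hc))
  have hre (F : ℂ → ℂ) : ∏ v ∈ g.range, F v = ∏ j : Fin g.range.card, F (e.symm j : g.range) := by
    rw [← Finset.prod_coe_sort, ← e.symm.prod_comp]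
  have hint := hind.integral_fun_prod_comp
    (f := fun j (k : ℕ) => ((e.symm j : g.range) : ℂ) ^ k)
    (fun j => (h.hasLaw_count _ (hB j)).aemeasurable)
    (fun j => (measurable_from_top).aestronglyMeasurable)
  have h1 (ω : Ω) : ∏ v ∈ g.range, v ^ count n X (g ⁻¹' {v}) ω =
      ∏ j : Fin g.range.card, ((e.symm j : g.range) : ℂ) ^
        count n X (g ⁻¹' {((e.symm j : g.range) : ℂ)}) ω :=
    hre fun v => v ^ count n X (g ⁻¹' {v}) ω
  simp only [h1]
  rw [hint]
  have h2 (v : ℂ) : ∫ ω, v ^ count n X (g ⁻¹' {v}) ω ∂μ =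
      Complex.exp (L.real (g ⁻¹' {v}) * (v - 1)) := by
    have hl := h.hasLaw_count _ (g.measurableSet_fiber v)
    have := integral_map hl.aemeasurable (f := fun k : ℕ => v ^ k)
      (measurable_from_top).aestronglyMeasurable
    rw [← this, hl.map_eq, integral_pow_poissonMeasure]
    rfl
  have h3 : ∏ j : Fin g.range.card, ∫ ω, ((e.symm j : g.range) : ℂ) ^
        count n X (g ⁻¹' {((e.symm j : g.range) : ℂ)}) ω ∂μ =
      ∏ v ∈ g.range, Complex.exp (L.real (g ⁻¹' {v}) * (v - 1)) := by
    rw [hre]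
    exact Finset.prod_congr rfl fun j _ => h2 _
  refine h3.trans ?_
  rw [← Complex.exp_sum]
  congr 1
  have hgi : Integrable (fun x => g x) L := g.integrable_of_isFiniteMeasure
  rw [integral_sub hgi (integrable_const _), ← SimpleFunc.integral_eq_integral _ hgi,
    SimpleFunc.integral_eq, integral_const]
  simp only [mul_sub, mul_one, Finset.sum_sub_distrib, Complex.real_smul]
  congr 1
  have hs := g.sum_range_measure_preimage_singleton L
  have : L.real Set.univ = ∑ v ∈ g.range, L.real (g ⁻¹' {v}) := by
    rw [measureReal_def, ← hs, ENNReal.toReal_sum fun v _ => measure_ne_top _ _]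
    rfl
  rw [this]
  push_cast
  rfl

/-- The probability generating functional of a Poisson process. -/
lemma integral_prod_eq [IsProbabilityMeasure μ] (h : IsPoissonProcess μ L n X) {g : E → ℂ}
    (hg : Measurable g) (hb : ∀ x, ‖g x‖ ≤ 1) :
    ∫ ω, ∏ i ∈ Finset.range (n ω), g (X i ω) ∂μ = Complex.exp (-∫ x, (1 - g x) ∂L) := by
  have := h.isFiniteMeasure
  have hg' := hg.stronglyMeasurable
  have hb' (k : ℕ) (x : E) : ‖hg'.approxBounded 1 k x‖ ≤ 1 :=
    hg'.norm_approxBounded_le zero_le_one k x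
  have h1 : Tendsto (fun k => ∫ ω, ∏ i ∈ Finset.range (n ω), hg'.approxBounded 1 k (X i ω) ∂μ)
      atTop (𝓝 (∫ ω, ∏ i ∈ Finset.range (n ω), g (X i ω) ∂μ)) := by
    refine tendsto_integral_of_dominated_convergence (fun _ => (1 : ℝ)) (fun k => ?_)
      (integrable_const _) (fun k => ?_) ?_
    · exact (h.measurable_prod (SimpleFunc.measurable _)).aestronglyMeasurable
    · exact Eventually.of_forall fun ω => norm_prod_le n X (hb' k) ω
    · exact Eventually.of_forall fun ω => tendsto_prod_approx n X hg' hb ω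
  have h2 : Tendsto (fun k => ∫ x, (hg'.approxBounded 1 k x - 1) ∂L) atTop
      (𝓝 (∫ x, (g x - 1) ∂L)) := by
    refine tendsto_integral_of_dominated_convergence (fun _ => (2 : ℝ)) (fun k => ?_)
      (integrable_const _) (fun k => ?_) ?_
    · exact ((SimpleFunc.measurable _).sub measurable_const).aestronglyMeasurable
    · refine Eventually.of_forall fun x => (norm_sub_le _ _).trans ?_
      have := hb' k x
      simp only [norm_one]
      linarith
    · exact Eventually.of_forall fun x =>
        (hg'.tendsto_approxBounded_of_norm_le (hb x)).sub_const 1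
  have h3 : (-∫ x, (1 - g x) ∂L) = ∫ x, (g x - 1) ∂L := by
    rw [← integral_neg]
    simp
  simp only [h.integral_prod_simpleFunc] at h1
  rw [h3]
  exact tendsto_nhds_unique h1 ((Complex.continuous_exp.tendsto _).comp h2)

/-- Provides the dominating function for the double frequency integral; (k + 1)² ≤ 4^k compares the
moment with an exponential series. -/
lemma integrable_card_add_one_sq (h : IsPoissonProcess μ L n X) :
    Integrable (fun ω => ((n ω : ℝ) + 1) ^ 2) μ := by
  have hl := h.hasLaw_count Set.univ MeasurableSet.univ
  rw [count_univ] at hl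
  have hp : Integrable (fun k : ℕ => ((k : ℝ) + 1) ^ 2) (poissonMeasure (L Set.univ).toNNReal) := by
    rw [integrable_poissonMeasure_iff]
    set r := (L Set.univ).toNNReal
    have hs := (Real.summable_pow_div_factorial (4 * (r : ℝ))).mul_left (Real.exp (-r))
    refine hs.of_nonneg_of_le (fun k => by positivity) fun k => ?_
    rw [mul_pow, Real.norm_of_nonneg (by positivity)]
    have hk : ((k : ℝ) + 1) ^ 2 ≤ 4 ^ k := by
      have h1 : (k : ℝ) + 1 ≤ 2 ^ k := by exact_mod_cast Nat.lt_two_pow_self (n := k)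
      calc ((k : ℝ) + 1) ^ 2 ≤ (2 ^ k) ^ 2 := by gcongr
        _ = 4 ^ k := by rw [← pow_mul, mul_comm, pow_mul]; norm_num
    calc Real.exp (-r) * r ^ k / k.factorial * ((k : ℝ) + 1) ^ 2
        ≤ Real.exp (-r) * r ^ k / k.factorial * 4 ^ k := by gcongr
      _ = _ := by ring
  rw [← hl.map_eq] at hp
  exact (integrable_map_measure measurable_from_top.aestronglyMeasurable hl.aemeasurable).1 hp

/-- The number of points in the complement of B is Poisson with mean 0, hence almost surely zero. -/
lemma ae_mem [IsProbabilityMeasure μ] (h : IsPoissonProcess μ L n X) {B : Set E}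
    (hB : MeasurableSet B) (h0 : L Bᶜ = 0) :
    ∀ᵐ ω ∂μ, ∀ i < n ω, X i ω ∈ B := by
  have hl := h.hasLaw_count Bᶜ hB.compl
  rw [h0, ENNReal.toNNReal_zero] at hl
  have hz : ∀ᵐ ω ∂μ, count n X Bᶜ ω = 0 := by
    rw [hl.ae_iff (p := fun k => k = 0) measurable_from_top, ae_iff_measure_eq]
    · have : {k : ℕ | k = 0} = {0} := rfl
      rw [this, poissonMeasure_singleton, measure_univ]
      simp
    · exact (MeasurableSet.of_discrete).nullMeasurableSet
  filter_upwards [hz] with ω hω i hi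
  by_contra hn
  rw [count, Finset.card_eq_zero] at hω
  have hmem := Finset.eq_empty_iff_forall_notMem.1 hω i
  simp only [Finset.mem_filter, Finset.mem_range] at hmem
  exact hmem ⟨hi, hn⟩

end IsPoissonProcess

end EMFE


namespace EMFE

/-! ### The sine integral -/

/-- `∫₀^A sin (q x) / q dq`. -/
noncomputable def sinInt (A x : ℝ) : ℝ := ∫ q in Set.Ioc 0 A, Real.sin (q * x) * q⁻¹

lemma abs_sin_mul_inv_le {q : ℝ} (hq : 0 < q) (x : ℝ) : |Real.sin (q * x) * q⁻¹| ≤ |x| := by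
  rw [abs_mul, abs_of_pos (inv_pos.2 hq)]
  calc |Real.sin (q * x)| * q⁻¹ ≤ |q * x| * q⁻¹ :=
        mul_le_mul_of_nonneg_right Real.abs_sin_le_abs (inv_nonneg.2 hq.le)
    _ = |x| := by rw [abs_mul, abs_of_pos hq]; field_simp

lemma integrableOn_sin_mul_inv (A x : ℝ) :
    IntegrableOn (fun q : ℝ => Real.sin (q * x) * q⁻¹) (Set.Ioc 0 A) := by
  refine Measure.integrableOn_of_bounded (M := |x|) (by simp)
    (Measurable.aestronglyMeasurable (by fun_prop)) ?_
  filter_upwards [ae_restrict_mem measurableSet_Ioc] with q hq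
  exact abs_sin_mul_inv_le hq.1 x

lemma integral_sin_mul_exp (A u : ℝ) :
    ∫ t in (0 : ℝ)..A, Real.sin t * Real.exp (-(u * t)) =
      (1 + u ^ 2)⁻¹ - Real.exp (-(u * A)) * (Real.cos A + u * Real.sin A) * (1 + u ^ 2)⁻¹ := by
  have hne : 1 + u ^ 2 ≠ 0 := by positivity
  have hd (t : ℝ) : HasDerivAt (fun t => -(Real.exp (-(u * t)) * (Real.cos t + u * Real.sin t) *
      (1 + u ^ 2)⁻¹)) (Real.sin t * Real.exp (-(u * t))) t := by
    have h1 : HasDerivAt (fun t => Real.exp (-(u * t))) (-u * Real.exp (-(u * t))) t := by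
      have h : HasDerivAt (fun t : ℝ => -(u * t)) (-u) t := by
        simpa using ((hasDerivAt_id t).const_mul u).fun_neg
      exact h.exp.congr_deriv (by ring)
    have h2 := (Real.hasDerivAt_cos t).fun_add ((Real.hasDerivAt_sin t).const_mul u)
    refine (((h1.fun_mul h2).mul_const (1 + u ^ 2)⁻¹).fun_neg).congr_deriv ?_
    field_simp
    ring
  rw [intervalIntegral.integral_eq_sub_of_hasDerivAt (fun t _ => hd t)
    (Continuous.intervalIntegrable (by fun_prop) _ _)]
  simp
  ring

lemma integral_exp_neg_mul_Ioi_zero {t : ℝ} (ht : 0 < t) :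
    ∫ u in Set.Ioi (0 : ℝ), Real.exp (-(u * t)) = t⁻¹ := by
  have h := integral_exp_mul_Ioi (a := -t) (by linarith) 0
  have e (u : ℝ) : -(u * t) = -t * u := by ring
  simp only [e]
  rw [h]
  simp

lemma integrableOn_exp_neg_mul {t : ℝ} (ht : 0 < t) :
    IntegrableOn (fun u : ℝ => Real.exp (-(u * t))) (Set.Ioi 0) := by
  have h := integrableOn_exp_mul_Ioi (a := -t) (by linarith) 0
  have e (u : ℝ) : -(u * t) = -t * u := by ring
  simpa only [e] using h

lemma dirichlet_remainder {A u : ℝ} (hu : 0 < u) :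
    |Real.exp (-(u * A)) * (Real.cos A + u * Real.sin A) * (1 + u ^ 2)⁻¹| ≤
      2 * Real.exp (-(u * A)) := by
  have h1 : |Real.cos A + u * Real.sin A| ≤ 1 + u := by
    refine (abs_add_le _ _).trans ?_
    rw [abs_mul, abs_of_pos hu]
    have := Real.abs_cos_le_one A
    have := mul_le_mul_of_nonneg_left (Real.abs_sin_le_one A) hu.le
    linarith
  have h2 : (1 + u) * (1 + u ^ 2)⁻¹ ≤ 2 := by
    rw [← div_eq_mul_inv, div_le_iff₀ (by positivity)]
    nlinarith [sq_nonneg (u - 1), sq_nonneg u]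
  rw [abs_mul, abs_mul, abs_of_pos (Real.exp_pos _), abs_of_pos (a := (1 + u ^ 2)⁻¹) (by positivity)]
  calc Real.exp (-(u * A)) * |Real.cos A + u * Real.sin A| * (1 + u ^ 2)⁻¹
      ≤ Real.exp (-(u * A)) * (1 + u) * (1 + u ^ 2)⁻¹ := by gcongr
    _ = Real.exp (-(u * A)) * ((1 + u) * (1 + u ^ 2)⁻¹) := by ring
    _ ≤ Real.exp (-(u * A)) * 2 := by gcongr
    _ = _ := by ring

/-- Quantitative form of the Dirichlet integral. -/
lemma abs_sinInt_one_sub_le {A : ℝ} (hA : 0 < A) : |sinInt A 1 - Real.pi / 2| ≤ 2 / A := by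
  -- Fubini with 1/t = ∫₀^∞ e^{-ut} du: the inner integral over t is 1/(1 + u²), which integrates to
  -- π/2, minus a remainder of size at most 2e^{-uA}, which integrates to at most 2/A.
  have hF : Integrable (Function.uncurry fun t u : ℝ => Real.sin t * Real.exp (-(u * t)))
      ((volume.restrict (Set.Ioc 0 A)).prod (volume.restrict (Set.Ioi 0))) := by
    have hmeas : AEStronglyMeasurable
        (Function.uncurry fun t u : ℝ => Real.sin t * Real.exp (-(u * t)))
        ((volume.restrict (Set.Ioc 0 A)).prod (volume.restrict (Set.Ioi 0))) := by
      refine Continuous.aestronglyMeasurable ?_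
      exact (Real.continuous_sin.comp continuous_fst).mul
        (Real.continuous_exp.comp ((continuous_snd.mul continuous_fst).neg))
    rw [integrable_prod_iff hmeas]
    constructor
    · filter_upwards [ae_restrict_mem measurableSet_Ioc] with t ht
      exact Integrable.const_mul (integrableOn_exp_neg_mul ht.1) (Real.sin t)
    · have h1 : IntegrableOn (fun t : ℝ => |Real.sin (t * 1) * t⁻¹|) (Set.Ioc 0 A) :=
        (integrableOn_sin_mul_inv A 1).abs
      refine h1.congr ?_
      filter_upwards [ae_restrict_mem measurableSet_Ioc] with t ht
      simp only [Function.uncurry, norm_mul, Real.norm_eq_abs, Real.abs_exp]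
      rw [integral_const_mul, integral_exp_neg_mul_Ioi_zero ht.1, mul_one, abs_mul,
        abs_of_pos (inv_pos.2 ht.1)]
  have hswap := integral_integral_swap hF
  have hl : (∫ t in Set.Ioc 0 A, ∫ u in Set.Ioi (0 : ℝ), Real.sin t * Real.exp (-(u * t))) =
      sinInt A 1 := by
    rw [sinInt]
    refine setIntegral_congr_fun measurableSet_Ioc fun t ht => ?_
    rw [integral_const_mul, integral_exp_neg_mul_Ioi_zero ht.1, mul_one]
  have hR : IntegrableOn (fun u : ℝ =>
      Real.exp (-(u * A)) * (Real.cos A + u * Real.sin A) * (1 + u ^ 2)⁻¹) (Set.Ioi 0) := by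
    refine ((integrableOn_exp_neg_mul hA).const_mul 2).mono' ?_ ?_
    · exact Measurable.aestronglyMeasurable (by fun_prop)
    · filter_upwards [ae_restrict_mem measurableSet_Ioi] with u hu
      exact dirichlet_remainder hu
  have hr : (∫ u in Set.Ioi (0 : ℝ), ∫ t in Set.Ioc 0 A, Real.sin t * Real.exp (-(u * t))) =
      Real.pi / 2 - ∫ u in Set.Ioi (0 : ℝ),
        Real.exp (-(u * A)) * (Real.cos A + u * Real.sin A) * (1 + u ^ 2)⁻¹ := by
    have e (u : ℝ) : ∫ t in Set.Ioc 0 A, Real.sin t * Real.exp (-(u * t)) =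
        (1 + u ^ 2)⁻¹ - Real.exp (-(u * A)) * (Real.cos A + u * Real.sin A) * (1 + u ^ 2)⁻¹ := by
      rw [← integral_sin_mul_exp, intervalIntegral.integral_of_le hA.le]
    simp only [e]
    rw [integral_sub integrable_inv_one_add_sq.integrableOn hR, integral_Ioi_inv_one_add_sq]
    simp
  rw [← hl, hswap, hr, sub_sub_cancel_left, abs_neg, ← Real.norm_eq_abs]
  refine (norm_integral_le_of_norm_le ((integrableOn_exp_neg_mul hA).const_mul 2) ?_).trans_eq ?_
  · filter_upwards [ae_restrict_mem measurableSet_Ioi] with u hu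
    exact dirichlet_remainder hu
  · rw [integral_const_mul, integral_exp_neg_mul_Ioi_zero hA, div_eq_mul_inv]

lemma sinInt_of_pos {A x : ℝ} (hA : 0 ≤ A) (hx : 0 < x) : sinInt A x = sinInt (A * x) 1 := by
  have hAx : 0 ≤ A * x := mul_nonneg hA hx.le
  have h := intervalIntegral.smul_integral_comp_mul_right (a := 0) (b := A)
    (fun t : ℝ => Real.sin (t * 1) * t⁻¹) x
  rw [zero_mul, intervalIntegral.integral_of_le hAx, intervalIntegral.integral_of_le hA,
    smul_eq_mul, ← integral_const_mul] at h
  rw [sinInt, sinInt, ← h]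
  refine integral_congr_ae (Eventually.of_forall fun q => ?_)
  simp only [mul_one, mul_inv]
  field_simp

lemma sinInt_neg (A x : ℝ) : sinInt A (-x) = -sinInt A x := by
  rw [sinInt, sinInt, ← integral_neg]
  simp

/-- For A ≤ 1 the integrand is at most 1; for A > 1 the quantitative Dirichlet integral gives π/2 +
2 < 4. -/
lemma abs_sinInt_one_le {A : ℝ} (hA : 0 ≤ A) : |sinInt A 1| ≤ 4 := by
  rcases le_or_gt A 1 with h | h
  · have h1 : ‖∫ q in Set.Ioc 0 A, Real.sin (q * 1) * q⁻¹‖ ≤ 1 * volume.real (Set.Ioc 0 A) := by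
      refine norm_setIntegral_le_of_norm_le_const (by simp) fun q hq => ?_
      simpa using abs_sin_mul_inv_le hq.1 1
    rw [Real.volume_real_Ioc_of_le hA] at h1
    rw [sinInt, ← Real.norm_eq_abs]
    linarith
  · have h1 := abs_le.1 (abs_sinInt_one_sub_le (zero_lt_one.trans h))
    have h2 : 2 / A ≤ 2 := by
      rw [div_le_iff₀ (zero_lt_one.trans h)]; linarith
    have h3 := Real.pi_lt_four
    have h4 := Real.pi_pos
    rw [abs_le]
    constructor <;> linarith [h1.1, h1.2]

/-- Scaling and oddness reduce to x = 1. Uniformity in A and x is what permits dominated convergence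
for the conditional expectations. -/
lemma abs_sinInt_le {A : ℝ} (hA : 0 ≤ A) (x : ℝ) : |sinInt A x| ≤ 4 := by
  rcases lt_trichotomy x 0 with h | rfl | h
  · have h1 : sinInt A x = -sinInt (A * -x) 1 := by
      rw [← sinInt_of_pos hA (by linarith), sinInt_neg, neg_neg]
    rw [h1, abs_neg]
    exact abs_sinInt_one_le (mul_nonneg hA (by linarith))
  · simp [sinInt]
  · rw [sinInt_of_pos hA h]
    exact abs_sinInt_one_le (mul_nonneg hA h.le)

lemma tendsto_sinInt_one : Tendsto (fun A => sinInt A 1) atTop (𝓝 (Real.pi / 2)) := by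
  rw [tendsto_iff_dist_tendsto_zero]
  have h : Tendsto (fun A : ℝ => 2 / A) atTop (𝓝 0) := tendsto_const_nhds.div_atTop tendsto_id
  refine squeeze_zero' (Eventually.of_forall fun _ => dist_nonneg) ?_ h
  filter_upwards [eventually_gt_atTop 0] with A hA
  exact abs_sinInt_one_sub_le hA

lemma tendsto_sinInt_of_pos {x : ℝ} (hx : 0 < x) :
    Tendsto (fun A => sinInt A x) atTop (𝓝 (Real.pi / 2)) := by
  have h := tendsto_sinInt_one.comp (tendsto_id.atTop_mul_const hx)
  refine h.congr' ?_
  filter_upwards [eventually_ge_atTop 0] with A hA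
  exact (sinInt_of_pos hA hx).symm

lemma tendsto_sinInt_of_neg {x : ℝ} (hx : x < 0) :
    Tendsto (fun A => sinInt A x) atTop (𝓝 (-(Real.pi / 2))) := by
  have h := (tendsto_sinInt_of_pos (x := -x) (by linarith)).neg
  refine h.congr fun A => ?_
  rw [sinInt_neg, neg_neg]

lemma measurable_sinInt (A : ℝ) : Measurable (sinInt A) := by
  have h : Measurable (Function.uncurry fun x q : ℝ => Real.sin (q * x) * q⁻¹) := by
    unfold Function.uncurry
    fun_prop
  exact (h.stronglyMeasurable.integral_prod_right).measurable

end EMFE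


namespace EMFE

/-! ### Conditioning on one of two independent random variables -/

section Independence

variable {Ω α β E : Type*} {m mΩ : MeasurableSpace Ω} [MeasurableSpace α] [MeasurableSpace β]
  {μ : Measure Ω} [IsProbabilityMeasure μ] {U : Ω → α} {V : Ω → β}
  [NormedAddCommGroup E] [NormedSpace ℝ E]

lemma integral_comp_of_indepFun (h : IndepFun U V μ) (hU : Measurable U) (hV : Measurable V)
    {F : α × β → E} (hF : StronglyMeasurable F) {C : ℝ} (hC : ∀ p, ‖F p‖ ≤ C) :
    ∫ ω, F (U ω, V ω) ∂μ = ∫ ω, ∫ ω', F (U ω, V ω') ∂μ ∂μ := by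
  have := Measure.isProbabilityMeasure_map (μ := μ) hU.aemeasurable
  have := Measure.isProbabilityMeasure_map (μ := μ) hV.aemeasurable
  have hmap := (indepFun_iff_map_prod_eq_prod_map_map hU.aemeasurable hV.aemeasurable).1 h
  have h1 := integral_map (hU.prodMk hV).aemeasurable (μ := μ) hF.aestronglyMeasurable
  rw [← h1, hmap, integral_prod _ (Integrable.of_bound hF.aestronglyMeasurable C
    (Eventually.of_forall hC)), integral_map hU.aemeasurable
    hF.integral_prod_right'.aestronglyMeasurable]
  refine integral_congr_ae (Eventually.of_forall fun ω => ?_)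
  exact integral_map hV.aemeasurable
    (hF.comp_measurable measurable_prodMk_left).aestronglyMeasurable

lemma ae_of_indepFun (h : IndepFun U V μ) (hU : Measurable U) (hV : Measurable V)
    {p : α × β → Prop} (hp : MeasurableSet {x | p x}) (hae : ∀ u, ∀ᵐ ω ∂μ, p (u, V ω)) :
    ∀ᵐ ω ∂μ, p (U ω, V ω) := by
  have hmap := (indepFun_iff_map_prod_eq_prod_map_map hU.aemeasurable hV.aemeasurable).1 h
  have hp' : MeasurableSet {x | ¬p x} := hp.compl
  have h1 : ∀ᵐ x ∂(μ.map fun ω => (U ω, V ω)), p x := by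
    have := Measure.isProbabilityMeasure_map (μ := μ) hV.aemeasurable
    rw [hmap, ae_iff, Measure.measure_prod_null hp']
    refine Eventually.of_forall fun u => ?_
    change (μ.map V) (Prod.mk u ⁻¹' {x | ¬p x}) = 0
    rw [Measure.map_apply hV (hp'.preimage measurable_prodMk_left)]
    exact ae_iff.1 (hae u)
  exact (ae_map_iff (hU.prodMk hV).aemeasurable hp).1 h1

/-- Averaging over V with U frozen gives the conditional expectation given U. It also serves any
smaller σ-algebra m for which that average has an m-measurable version. This is needed because U
carries the enumeration of the points, while m will know only the counts. -/
lemma condExp_of_indepFun [CompleteSpace E] (h : IndepFun U V μ) (hU : Measurable U)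
    (hV : Measurable V) {F : α × β → E} (hF : StronglyMeasurable F) {C : ℝ} (hC : ∀ p, ‖F p‖ ≤ C)
    (hm : m ≤ MeasurableSpace.comap U inferInstance) {g : Ω → E}
    (hg : StronglyMeasurable[m] g) (hgF : g =ᵐ[μ] fun ω => ∫ ω', F (U ω, V ω') ∂μ) :
    μ[fun ω => F (U ω, V ω) | m] =ᵐ[μ] g := by
  have hmΩ : m ≤ mΩ := hm.trans hU.comap_le
  have hFU : Integrable (fun ω => F (U ω, V ω)) μ :=
    Integrable.of_bound (hF.comp_measurable (hU.prodMk hV)).aestronglyMeasurable C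
      (Eventually.of_forall fun ω => hC _)
  have hgi : Integrable g μ := by
    refine Integrable.of_bound (hg.mono hmΩ).aestronglyMeasurable C ?_
    filter_upwards [hgF] with ω hω
    rw [hω]
    exact (norm_integral_le_of_norm_le_const (Eventually.of_forall fun ω' => hC _)).trans_eq
      (by simp)
  refine (ae_eq_condExp_of_forall_setIntegral_eq hmΩ hFU (fun s _ _ => hgi.integrableOn)
    (fun s hs _ => ?_) hg.aestronglyMeasurable).symm
  -- A set of m is the preimage of some t under U, so its indicator can be absorbed into F as a
  -- function of the first variable.
  obtain ⟨t, ht, rfl⟩ := hm s hs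
  have h1 := integral_comp_of_indepFun (F := (t ×ˢ Set.univ).indicator F) h hU hV
    (hF.indicator (ht.prod MeasurableSet.univ))
    (fun p => (norm_indicator_le_norm_self _ _).trans (hC p))
  rw [← integral_indicator (hU ht), ← integral_indicator (hU ht)]
  have e1 : (fun ω => (t ×ˢ Set.univ).indicator F (U ω, V ω)) =
      (U ⁻¹' t).indicator fun ω => F (U ω, V ω) := by
    funext ω
    by_cases hω : U ω ∈ t <;> simp [Set.indicator, hω]
  rw [← e1, h1]
  refine integral_congr_ae ?_
  filter_upwards [hgF] with ω hω
  by_cases hω' : U ω ∈ t <;> simp [Set.indicator, hω', hω]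

end Independence

/-! ### The exposure given the base stations -/

/-- The exposure generated by `u.1` stations at the points `u.2 i`, with marks `v i`. -/
noncomputable def Params.exposureOf (P : Params) (p : (ℕ × (ℕ → Plane)) × (ℕ → ℝ × ℂ)) : ℝ :=
  ∑ i ∈ Finset.range p.1.1, P.Sbar ‖p.1.2 i‖ * (P.gain (p.2 i).1 * ‖(p.2 i).2‖ ^ 2)

lemma Params.measurable_Sbar (P : Params) : Measurable P.Sbar := by
  have h (r : ℝ) : P.Sbar r = _ := P.Sbar_eq r
  rw [funext h]
  fun_prop

lemma Params.measurable_exposureOf (P : Params) : Measurable P.exposureOf := by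
  have hn : Measurable fun p : (ℕ × (ℕ → Plane)) × (ℕ → ℝ × ℂ) => p.1.1 := by fun_prop
  refine measurable_comp_nat hn (f := fun k p =>
    ∑ i ∈ Finset.range k, P.Sbar ‖p.1.2 i‖ * (P.gain (p.2 i).1 * ‖(p.2 i).2‖ ^ 2)) fun k => ?_
  have := P.measurable_Sbar
  have := P.measurable_gain
  fun_prop

namespace Network

variable {Ω : Type*} (S : Network Ω) (P : Params)

/-- The base stations as a single random variable. -/
def points (ω : Ω) : ℕ × (ℕ → Plane) := (S.n ω, fun i => S.X i ω)

/-- The marks as a single random variable. -/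
def marks (ω : Ω) : ℕ → ℝ × ℂ := fun i => (S.xi i ω, S.h i ω)

lemma exposure_eq (ω : Ω) : S.exposure P ω = P.exposureOf (S.points ω, S.marks ω) :=
  Finset.sum_congr rfl fun _ _ => mul_assoc _ _ _

lemma exposureOf_marks (u : ℕ × (ℕ → Plane)) (ω : Ω) :
    P.exposureOf (u, S.marks ω) =
      ∑ i ∈ Finset.range u.1, P.Sbar ‖u.2 i‖ * S.mark P i ω := rfl

lemma sigmaPsi_le_comap_points : S.sigmaPsi ≤ MeasurableSpace.comap S.points inferInstance := by
  refine iSup₂_le fun B hB => ?_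
  rw [← measurable_iff_comap_le]
  have h : Measurable (count (fun u : ℕ × (ℕ → Plane) => u.1) (fun i u => u.2 i) B) :=
    measurable_count measurable_fst (fun i => by fun_prop) hB
  exact h.comp (comap_measurable S.points)

variable {S P} [MeasurableSpace Ω] {μ : Measure Ω}

lemma IsModel.sigmaPsi_le (hS : S.IsModel P μ) : S.sigmaPsi ≤ ‹MeasurableSpace Ω› :=
  pointSigma_le hS.poisson.measurable_card hS.poisson.measurable_point

lemma IsModel.measurable_points (hS : S.IsModel P μ) : Measurable S.points :=
  hS.poisson.measurable_card.prodMk (measurable_pi_lambda _ hS.poisson.measurable_point)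

lemma IsModel.measurable_marks (hS : S.IsModel P μ) : Measurable S.marks :=
  measurable_pi_lambda _ fun i => (hS.measurable_xi i).prodMk (hS.measurable_h i)

lemma IsModel.measurable_exposure (hS : S.IsModel P μ) : Measurable (S.exposure P) := by
  rw [funext (S.exposure_eq P)]
  exact P.measurable_exposureOf.comp (hS.measurable_points.prodMk hS.measurable_marks)

lemma IsModel.iIndepFun_mark (hS : S.IsModel P μ) : iIndepFun (S.mark P) μ :=
  hS.indep_marks.comp (fun _ (p : ℝ × ℂ) => P.gain p.1 * ‖p.2‖ ^ 2) fun _ => by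
    have := P.measurable_gain
    fun_prop

variable [IsProbabilityMeasure μ]

/-- Read off from the representation as the characteristic function of the mark of index 0; the
conjugation symmetry, measurability and continuity below come from the same representation, not from
the closed form. -/
lemma IsModel.norm_stationChar_le (hS : S.IsModel P μ) (q r : ℝ) : ‖P.stationChar q r‖ ≤ 1 := by
  rw [← hS.integral_cexp_mark 0 q r]
  refine (norm_integral_le_of_norm_le_const (C := 1) (Eventually.of_forall fun ω => ?_)).trans_eq
    (by simp)
  rw [mul_comm, Complex.norm_exp_ofReal_mul_I]

lemma IsModel.stationChar_neg (hS : S.IsModel P μ) (q r : ℝ) :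
    P.stationChar (-q) r = starRingEnd ℂ (P.stationChar q r) := by
  rw [← hS.integral_cexp_mark 0 q r, ← hS.integral_cexp_mark 0 (-q) r, ← integral_conj]
  refine integral_congr_ae (Eventually.of_forall fun ω => ?_)
  simp only [← Complex.exp_conj, map_mul, Complex.conj_I, Complex.conj_ofReal]
  congr 1
  push_cast
  ring

lemma IsModel.measurable_stationChar (hS : S.IsModel P μ) (q : ℝ) :
    Measurable (P.stationChar q) := by
  have h := hS.measurable_mark 0
  have h' := P.measurable_Sbar
  have hm : Measurable fun p : ℝ × Ω =>
      Complex.exp (Complex.I * ((q * (P.Sbar p.1 * S.mark P 0 p.2) : ℝ) : ℂ)) := by fun_prop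
  rw [funext fun r => (hS.integral_cexp_mark 0 q r).symm]
  exact hm.stronglyMeasurable.integral_prod_right'.measurable

lemma IsModel.continuous_stationChar (hS : S.IsModel P μ) (r : ℝ) :
    Continuous fun q => P.stationChar q r := by
  have h := hS.measurable_mark 0
  rw [funext fun q => (hS.integral_cexp_mark 0 q r).symm]
  refine continuous_of_dominated (bound := fun _ => 1) (fun q => ?_) (fun q => ?_)
    (integrable_const _) (Eventually.of_forall fun ω => by fun_prop)
  · exact Measurable.aestronglyMeasurable (by fun_prop)
  · refine Eventually.of_forall fun ω => ?_
    rw [mul_comm, Complex.norm_exp_ofReal_mul_I]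

lemma IsModel.integral_cexp_exposureOf (hS : S.IsModel P μ) (q : ℝ) (u : ℕ × (ℕ → Plane)) :
    ∫ ω, Complex.exp (Complex.I * ((q * P.exposureOf (u, S.marks ω) : ℝ) : ℂ)) ∂μ =
      ∏ i ∈ Finset.range u.1, P.stationChar q ‖u.2 i‖ := by
  have hi : iIndepFun (fun i : Fin u.1 => S.mark P i) μ :=
    hS.iIndepFun_mark.precomp Fin.val_injective
  have h := iIndepFun.integral_fun_prod_comp (X := fun i : Fin u.1 => S.mark P i) hi
    (f := fun i (x : ℝ) => Complex.exp (Complex.I * ((q * (P.Sbar ‖u.2 i‖ * x) : ℝ) : ℂ)))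
    (fun i => (hS.measurable_mark i).aemeasurable)
    (fun i => Continuous.aestronglyMeasurable (by fun_prop))
  rw [Finset.prod_range]
  refine Eq.trans ?_ (h.trans (Finset.prod_congr rfl fun i _ => hS.integral_cexp_mark i q _))
  refine integral_congr_ae (Eventually.of_forall fun ω => ?_)
  simp only [exposureOf_marks]
  rw [← Complex.exp_sum, Finset.sum_range]
  congr 1
  push_cast
  simp only [Finset.mul_sum]

/-- The conditional characteristic function of the exposure, as a product over stations. -/
noncomputable def charProd (S : Network Ω) (P : Params) (q : ℝ) (ω : Ω) : ℂ :=
  ∏ i ∈ Finset.range (S.n ω), P.stationChar q ‖S.X i ω‖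

lemma IsModel.stronglyMeasurable_charProd (hS : S.IsModel P μ) (q : ℝ) :
    StronglyMeasurable[S.sigmaPsi] (S.charProd P q) :=
  stronglyMeasurable_prod_pointSigma S.n S.X (g := fun x => P.stationChar q ‖x‖)
    ((hS.measurable_stationChar q).comp measurable_norm) fun _ => hS.norm_stationChar_le _ _

lemma IsModel.measurable_charProd (hS : S.IsModel P μ) (q : ℝ) : Measurable (S.charProd P q) :=
  ((hS.stronglyMeasurable_charProd q).mono hS.sigmaPsi_le).measurable

lemma IsModel.norm_charProd_le (hS : S.IsModel P μ) (q : ℝ) (ω : Ω) : ‖S.charProd P q ω‖ ≤ 1 :=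
  norm_prod_le S.n S.X (g := fun x => P.stationChar q ‖x‖) (fun _ => hS.norm_stationChar_le _ _) ω

lemma IsModel.continuous_charProd (hS : S.IsModel P μ) (ω : Ω) :
    Continuous fun q => S.charProd P q ω :=
  continuous_finsetProd _ fun _ _ => hS.continuous_stationChar _

lemma IsModel.charProd_neg (hS : S.IsModel P μ) (q : ℝ) (ω : Ω) :
    S.charProd P (-q) ω = starRingEnd ℂ (S.charProd P q ω) := by
  rw [charProd, charProd, map_prod]
  exact Finset.prod_congr rfl fun i _ => hS.stationChar_neg _ _

/-- With the stations frozen the marks are independent, so the average factorizes; the resulting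
product is measurable for the σ-algebra of counts, as `condExp_of_indepFun` requires. -/
lemma IsModel.condChar_ae_eq (hS : S.IsModel P μ) (q : ℝ) :
    S.condChar P μ q =ᵐ[μ] S.charProd P q := by
  have hm := P.measurable_exposureOf
  have h := condExp_of_indepFun (E := ℂ) hS.indep_points hS.measurable_points hS.measurable_marks
    (F := fun p => Complex.exp (Complex.I * ((q * P.exposureOf p : ℝ) : ℂ))) (C := 1)
    (Measurable.stronglyMeasurable (by fun_prop))
    (fun p => by rw [mul_comm, Complex.norm_exp_ofReal_mul_I])
    S.sigmaPsi_le_comap_points (hS.stronglyMeasurable_charProd q)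
    (Eventually.of_forall fun ω => (hS.integral_cexp_exposureOf q (S.points ω)).symm)
  rw [condChar, funext (S.exposure_eq P)]
  exact h

end Network

end EMFE


namespace EMFE

/-! ### Mixed moments of the conditional characteristic function -/

namespace Params

variable (P : Params)

lemma measurableSet_annulus : MeasurableSet {x : Plane | P.rE ≤ ‖x‖ ∧ ‖x‖ ≤ P.tau} :=
  measurable_norm measurableSet_Icc

lemma integral_intensity (F : ℝ → ℂ) :
    ∫ x, F ‖x‖ ∂P.intensity = 2 * Real.pi * P.lam * ∫ r in P.rE..P.tau, (r : ℂ) * F r := by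
  have hpolar := integral_fun_norm_addHaar (volume : Measure Plane)
    ((Set.Icc P.rE P.tau).indicator F)
  have hvol : (volume : Measure Plane).real (Metric.ball 0 1) = Real.pi := by
    rw [measureReal_def, EuclideanSpace.volume_ball_fin_two]
    simp [Real.pi_nonneg]
  rw [hvol, finrank_euclideanSpace_fin] at hpolar
  have h1 : ∫ x, (Set.Icc P.rE P.tau).indicator F ‖x‖ ∂(volume : Measure Plane) =
      ∫ x in {x : Plane | P.rE ≤ ‖x‖ ∧ ‖x‖ ≤ P.tau}, F ‖x‖ := by
    rw [← integral_indicator P.measurableSet_annulus]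
    rfl
  have h2 : ∫ y in Set.Ioi (0 : ℝ), y ^ (2 - 1) • (Set.Icc P.rE P.tau).indicator F y =
      ∫ r in P.rE..P.tau, (r : ℂ) * F r := by
    rw [intervalIntegral.integral_of_le P.rE_lt_tau.le, ← integral_indicator measurableSet_Ioi,
      ← integral_indicator measurableSet_Ioc]
    refine integral_congr_ae ?_
    -- The closed annulus and the half-open interval of integration differ only at the inner radius.
    have hne : ∀ᵐ r : ℝ, r ≠ P.rE := by simp [ae_iff]
    filter_upwards [hne] with r hr
    have h0 := P.rE_nonneg
    by_cases hr2 : r ∈ Set.Ioc P.rE P.tau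
    · rw [Set.indicator_of_mem (Set.mem_Ioi.2 (h0.trans_lt hr2.1)), Set.indicator_of_mem hr2,
        Set.indicator_of_mem (Set.Ioc_subset_Icc_self hr2)]
      simp
    · have hr3 : r ∉ Set.Icc P.rE P.tau := fun h => hr2 ⟨lt_of_le_of_ne h.1 hr.symm, h.2⟩
      rw [Set.indicator_of_notMem hr2]
      simp [Set.indicator_of_notMem hr3]
  rw [intensity, integral_smul_measure, ← h1, hpolar, h2, ENNReal.toReal_ofReal P.lam_pos.le,
    Complex.real_smul, Complex.real_smul]
  simp only [nsmul_eq_mul]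
  push_cast
  ring

end Params

namespace Network

variable {Ω : Type*} {S : Network Ω} {P : Params} [MeasurableSpace Ω] {μ : Measure Ω}
  [IsProbabilityMeasure μ]

lemma IsModel.integral_charProd_mul (hS : S.IsModel P μ) {e : ℝ} (he : e = 1 ∨ e = -1) {q q' : ℝ}
    (hq : 0 < q) (hq' : 0 < q') :
    ∫ ω, S.charProd P q ω * S.charProd P (e * q') ω ∂μ = P.gammaSigned e q q' := by
  have hb (x : Plane) : ‖P.stationChar q ‖x‖ * P.stationChar (e * q') ‖x‖‖ ≤ 1 := by
    rw [norm_mul]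
    exact mul_le_one₀ (hS.norm_stationChar_le _ _) (norm_nonneg _) (hS.norm_stationChar_le _ _)
  have h := hS.poisson.integral_prod_eq
    (g := fun x => P.stationChar q ‖x‖ * P.stationChar (e * q') ‖x‖)
    (((hS.measurable_stationChar q).comp measurable_norm).mul
      ((hS.measurable_stationChar (e * q')).comp measurable_norm)) hb
  simp only [Finset.prod_mul_distrib] at h
  rw [P.gammaSigned_eq he hq hq' fun k hk => P.chi_pos hk]
  refine h.trans ?_
  rw [P.integral_intensity fun r => 1 - P.stationChar q r * P.stationChar (e * q') r]

lemma IsModel.integral_condChar_mul (hS : S.IsModel P μ) {q q' : ℝ} (hq : 0 < q) (hq' : 0 < q') :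
    ∫ ω, S.condChar P μ q ω * S.condChar P μ q' ω ∂μ = P.gammaPlus q q' := by
  rw [Params.gammaPlus, ← hS.integral_charProd_mul (Or.inl rfl) hq hq']
  refine integral_congr_ae ?_
  filter_upwards [hS.condChar_ae_eq q, hS.condChar_ae_eq q'] with ω h1 h2
  rw [h1, h2, one_mul]

lemma IsModel.integral_condChar_mul_conj (hS : S.IsModel P μ) {q q' : ℝ} (hq : 0 < q)
    (hq' : 0 < q') :
    ∫ ω, S.condChar P μ q ω * starRingEnd ℂ (S.condChar P μ q' ω) ∂μ = P.gammaMinus q q' := by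
  rw [Params.gammaMinus, ← hS.integral_charProd_mul (Or.inr rfl) hq hq']
  refine integral_congr_ae ?_
  filter_upwards [hS.condChar_ae_eq q, hS.condChar_ae_eq q'] with ω h1 h2
  rw [h1, h2, neg_one_mul, hS.charProd_neg]

/-! ### The exposure has no positive atoms -/

/-- If the partial sum is w ≠ T, hitting T with the next independent term requires that mark to take
one particular nonzero value, a null event. -/
lemma IsModel.sum_mark_ne (hS : S.IsModel P μ) (a : ℕ → ℝ) {T : ℝ} (hT : T ≠ 0) (N : ℕ) :
    ∀ᵐ ω ∂μ, ∑ i ∈ Finset.range N, a i * S.mark P i ω ≠ T := by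
  induction N with
  | zero => exact Eventually.of_forall fun ω => by simpa using hT.symm
  | succ N ih =>
    have hind : IndepFun (fun ω => ∑ i ∈ Finset.range N, a i * S.mark P i ω) (S.mark P N) μ := by
      have h2 := hS.iIndepFun_mark.indepFun_finset (Finset.range N) {N}
        (by simp) hS.measurable_mark
      have hψ : Measurable fun x : ({N} : Finset ℕ) → ℝ => x ⟨N, by simp⟩ := by fun_prop
      have h3 := h2.comp (φ := fun x : Finset.range N → ℝ => ∑ i : Finset.range N, a (i : ℕ) * x i) (by fun_prop)
        hψ
      refine h3.congr (Eventually.of_forall fun ω => ?_) (Eventually.of_forall fun ω => rfl)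
      exact Finset.sum_coe_sort (Finset.range N) fun i => a i * S.mark P i ω
    -- The event is an implication because the new term can vanish: the sum then keeps its old
    -- value, which only the induction hypothesis keeps away from T.
    have hp : MeasurableSet {x : ℝ × ℝ | x.1 ≠ T → x.1 + a N * x.2 ≠ T} := by
      have h1 : MeasurableSet {x : ℝ × ℝ | x.1 = T} :=
        measurableSet_eq_fun measurable_fst measurable_const
      have h2 : MeasurableSet {x : ℝ × ℝ | x.1 + a N * x.2 = T} :=
        measurableSet_eq_fun (by fun_prop) measurable_const
      have : {x : ℝ × ℝ | x.1 ≠ T → x.1 + a N * x.2 ≠ T} =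
          {x : ℝ × ℝ | x.1 = T} ∪ {x : ℝ × ℝ | x.1 + a N * x.2 = T}ᶜ := by
        ext x
        simp only [Set.mem_ofPred_eq, Set.mem_union, Set.mem_compl_iff]
        tauto
      rw [this]
      exact h1.union h2.compl
    have h := ae_of_indepFun (p := fun x : ℝ × ℝ => x.1 ≠ T → x.1 + a N * x.2 ≠ T) hind
      (Finset.measurable_fun_sum _ fun i _ => (hS.measurable_mark i).const_mul _)
      (hS.measurable_mark N) hp fun w => by
        by_cases hw : w = T
        · exact Eventually.of_forall fun ω h => absurd hw h
        by_cases ha : a N = 0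
        · exact Eventually.of_forall fun ω h => by simpa [ha] using h
        have h0 : (T - w) / a N ≠ 0 := div_ne_zero (sub_ne_zero.2 (Ne.symm hw)) ha
        filter_upwards [measure_eq_zero_iff_ae_notMem.1 (hS.mark_ne N h0)] with ω hω _ hc
        refine hω ?_
        rw [eq_div_iff ha]
        linarith
    filter_upwards [ih, h] with ω h1 h2
    rw [Finset.sum_range_succ]
    exact h2 h1

lemma IsModel.exposure_ne (hS : S.IsModel P μ) {T : ℝ} (hT : T ≠ 0) :
    ∀ᵐ ω ∂μ, S.exposure P ω ≠ T := by
  have h := ae_of_indepFun (p := fun x => P.exposureOf x ≠ T) hS.indep_points hS.measurable_points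
    hS.measurable_marks (measurableSet_eq_fun P.measurable_exposureOf measurable_const).compl
    fun u => hS.sum_mark_ne (fun i => P.Sbar ‖u.2 i‖) hT u.1
  filter_upwards [h] with ω hω
  rw [exposure_eq]
  exact hω

end Network

end EMFE


namespace EMFE

/-! ### Inversion of the conditional characteristic function -/

/-- `Im (c e^{-jqT}) / q`, the integrand of the inversion formula for a characteristic function
with value `c` at `q`. -/
noncomputable def inversionKernel (T q : ℝ) (c : ℂ) : ℝ :=
  (c * Complex.exp (-Complex.I * ((T * q : ℝ) : ℂ))).im * q⁻¹

lemma inversionKernel_cexp (T q x : ℝ) :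
    inversionKernel T q (Complex.exp (Complex.I * ((q * x : ℝ) : ℂ))) =
      Real.sin (q * (x - T)) * q⁻¹ := by
  rw [inversionKernel, ← Complex.exp_add, ← Complex.exp_ofReal_mul_I_im]
  congr 3
  push_cast
  ring

lemma measurable_inversionKernel {β : Type*} [MeasurableSpace β] (T : ℝ) {Φ : ℝ → β → ℂ}
    (hc : ∀ x, Continuous fun q => Φ q x) (hm : ∀ q, StronglyMeasurable (Φ q)) :
    Measurable fun p : ℝ × β => inversionKernel T p.1 (Φ p.1 p.2) := by
  have h : Measurable (Function.uncurry Φ) :=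
    (stronglyMeasurable_uncurry_of_continuous_of_stronglyMeasurable hc hm).measurable
  have h' : Measurable fun p : ℝ × β => Φ p.1 p.2 := h
  have h2 : Measurable fun p : ℝ × β =>
      Φ p.1 p.2 * Complex.exp (-Complex.I * ((T * p.1 : ℝ) : ℂ)) :=
    h'.mul (by fun_prop)
  exact (Complex.measurable_im.comp h2).mul measurable_fst.inv

namespace Params

variable (P : Params)

lemma Sbar_nonneg (r : ℝ) : 0 ≤ P.Sbar r := by
  rw [Sbar_eq]
  have := P.Pt_pos
  have := Real.pi_pos
  positivity

lemma Sbar_le {r : ℝ} (hr : P.rE ≤ r) : P.Sbar r ≤ P.Sbar P.rE := by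
  rw [Sbar_eq, Sbar_eq]
  have := P.Pt_pos
  have := Real.pi_pos
  have := P.alpha_pos
  have h0 := P.rE_nonneg
  refine mul_le_mul_of_nonneg_left ?_ (by positivity)
  refine Real.rpow_le_rpow_of_nonpos
    (P.sq_add_pos_of_mem (Set.left_mem_Icc.2 P.rE_lt_tau.le)) ?_ (by linarith)
  gcongr

end Params

namespace Network

variable {Ω : Type*} (S : Network Ω) (P : Params)

/-- The inversion integral of the conditional characteristic function over `(0, A]`. -/
noncomputable def inversion (T A : ℝ) (ω : Ω) : ℝ :=
  ∫ q in Set.Ioc 0 A, inversionKernel T q (S.charProd P q ω)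

variable {S P} [MeasurableSpace Ω] {μ : Measure Ω}

lemma IsModel.integrable_exposureOf (hS : S.IsModel P μ) (u : ℕ × (ℕ → Plane)) :
    Integrable (fun ω => P.exposureOf (u, S.marks ω)) μ := by
  simp only [exposureOf_marks]
  exact integrable_finsetSum _ fun i _ => (hS.integrable_mark i).1.const_mul _

variable (S P) in
/-- An almost sure bound of the inversion kernel. -/
noncomputable def kernelBound (T : ℝ) (ω : Ω) : ℝ :=
  (P.Sbar P.rE * markMean P + T) * (S.n ω + 1)

lemma IsModel.integrable_kernelBound_sq (hS : S.IsModel P μ) (T : ℝ) :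
    Integrable (fun ω => S.kernelBound P T ω ^ 2) μ := by
  simp only [kernelBound, mul_pow]
  exact hS.poisson.integrable_card_add_one_sq.const_mul _

lemma IsModel.integral_abs_exposureOf_le (hS : S.IsModel P μ) (u : ℕ × (ℕ → Plane)) :
    ∫ ω, |P.exposureOf (u, S.marks ω)| ∂μ ≤
      ∑ i ∈ Finset.range u.1, P.Sbar ‖u.2 i‖ * markMean P := by
  have h (i : ℕ) : Integrable (fun ω => P.Sbar ‖u.2 i‖ * |S.mark P i ω|) μ :=
    (hS.integrable_mark i).1.abs.const_mul _
  calc ∫ ω, |P.exposureOf (u, S.marks ω)| ∂μ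
      ≤ ∫ ω, ∑ i ∈ Finset.range u.1, P.Sbar ‖u.2 i‖ * |S.mark P i ω| ∂μ := by
        refine integral_mono (hS.integrable_exposureOf u).abs
          (integrable_finsetSum _ fun i _ => h i) fun ω => ?_
        simp only [exposureOf_marks]
        refine (Finset.abs_sum_le_sum_abs _ _).trans_eq (Finset.sum_congr rfl fun i _ => ?_)
        rw [abs_mul, abs_of_nonneg (P.Sbar_nonneg _)]
    _ = ∑ i ∈ Finset.range u.1, P.Sbar ‖u.2 i‖ * ∫ ω, |S.mark P i ω| ∂μ := by
        rw [integral_finsetSum _ fun i _ => h i]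
        simp only [integral_const_mul]
    _ ≤ _ := Finset.sum_le_sum fun i _ =>
        mul_le_mul_of_nonneg_left (hS.integrable_mark i).2 (P.Sbar_nonneg _)

variable [IsProbabilityMeasure μ]

/-- Taking imaginary parts inside the average over the marks exhibits the kernel as a mean of
sin(q(𝒮 - T))/q with the stations frozen. -/
lemma IsModel.inversionKernel_eq (hS : S.IsModel P μ) (T q : ℝ) (ω : Ω) :
    inversionKernel T q (S.charProd P q ω) =
      ∫ ω', Real.sin (q * (P.exposureOf (S.points ω, S.marks ω') - T)) * q⁻¹ ∂μ := by
  have hm := P.measurable_exposureOf.comp (measurable_prodMk_left (x := S.points ω) |>.comp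
    hS.measurable_marks)
  have hi : Integrable (fun ω' => Complex.exp (Complex.I *
      ((q * P.exposureOf (S.points ω, S.marks ω') : ℝ) : ℂ)) *
      Complex.exp (-Complex.I * ((T * q : ℝ) : ℂ))) μ := by
    refine Integrable.mul_const ?_ _
    refine Integrable.of_bound (C := 1) ?_ (Eventually.of_forall fun ω' => ?_)
    · have hm' : Measurable fun ω' => P.exposureOf (S.points ω, S.marks ω') := hm
      exact Measurable.aestronglyMeasurable (by fun_prop)
    · rw [mul_comm, Complex.norm_exp_ofReal_mul_I]
  have h := hS.integral_cexp_exposureOf q (S.points ω)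
  simp only [← inversionKernel_cexp]
  simp only [inversionKernel]
  rw [show S.charProd P q ω = _ from h.symm, integral_mul_const q⁻¹,
    ← integral_mul_const (Complex.exp (-Complex.I * ((T * q : ℝ) : ℂ)))]
  congr 1
  exact (integral_im hi).symm

lemma IsModel.integrable_exposureOf_sub (hS : S.IsModel P μ) (T : ℝ) (u : ℕ × (ℕ → Plane)) :
    Integrable (fun ω => P.exposureOf (u, S.marks ω) - T) μ :=
  (hS.integrable_exposureOf u).sub (integrable_const T)

/-- Through |sin(qx)/q| ≤ |x| the kernel is bounded by a conditional mean of |𝒮 - T|, uniformly in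
q; this removes the singularity at q = 0. -/
lemma IsModel.abs_inversionKernel_le (hS : S.IsModel P μ) {T q : ℝ} (hT : 0 < T) (hq : 0 < q)
    (ω : Ω) : |inversionKernel T q (S.charProd P q ω)| ≤
      (∑ i ∈ Finset.range (S.n ω), P.Sbar ‖S.X i ω‖ * markMean P) + T := by
  rw [hS.inversionKernel_eq, ← Real.norm_eq_abs]
  refine (norm_integral_le_of_norm_le (hS.integrable_exposureOf_sub T (S.points ω)).abs
    (Eventually.of_forall fun ω' => abs_sin_mul_inv_le hq _)).trans ?_
  calc ∫ ω', |P.exposureOf (S.points ω, S.marks ω') - T| ∂μ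
      ≤ ∫ ω', (|P.exposureOf (S.points ω, S.marks ω')| + T) ∂μ := by
        refine integral_mono (hS.integrable_exposureOf_sub T _).abs
          ((hS.integrable_exposureOf _).abs.add (integrable_const T)) fun ω' => ?_
        exact (abs_sub _ _).trans_eq (by rw [abs_of_pos hT])
    _ = (∫ ω', |P.exposureOf (S.points ω, S.marks ω')| ∂μ) + T := by
        rw [integral_add (hS.integrable_exposureOf _).abs (integrable_const T)]
        simp
    _ ≤ _ := by
        have := hS.integral_abs_exposureOf_le (S.points ω)
        exact add_le_add_left this T

lemma IsModel.ae_abs_inversionKernel_le (hS : S.IsModel P μ) {T : ℝ} (hT : 0 < T) :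
    ∀ᵐ ω ∂μ, ∀ q, 0 < q → |inversionKernel T q (S.charProd P q ω)| ≤ S.kernelBound P T ω := by
  have h0 : P.intensity {x : Plane | P.rE ≤ ‖x‖ ∧ ‖x‖ ≤ P.tau}ᶜ = 0 := by
    rw [Params.intensity, Measure.smul_apply, Measure.restrict_apply P.measurableSet_annulus.compl]
    simp
  filter_upwards [hS.poisson.ae_mem P.measurableSet_annulus h0] with ω hω q hq
  refine (hS.abs_inversionKernel_le hT hq ω).trans ?_
  have h1 : ∑ i ∈ Finset.range (S.n ω), P.Sbar ‖S.X i ω‖ * markMean P ≤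
      ∑ i ∈ Finset.range (S.n ω), P.Sbar P.rE * markMean P :=
    Finset.sum_le_sum fun i hi => mul_le_mul_of_nonneg_right
      (P.Sbar_le (hω i (Finset.mem_range.1 hi)).1) (markMean_nonneg P)
  rw [Finset.sum_const, Finset.card_range, nsmul_eq_mul] at h1
  have h2 : 0 ≤ P.Sbar P.rE * markMean P := mul_nonneg (P.Sbar_nonneg _) (markMean_nonneg P)
  have h3 : 0 ≤ (S.n ω : ℝ) * T := by positivity
  rw [kernelBound]
  nlinarith

lemma IsModel.integral_sinInt (hS : S.IsModel P μ) (T A : ℝ) (ω : Ω) :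
    ∫ ω', sinInt A (P.exposureOf (S.points ω, S.marks ω') - T) ∂μ = S.inversion P T A ω := by
  have hm : Measurable fun ω' => P.exposureOf (S.points ω, S.marks ω') :=
    P.measurable_exposureOf.comp (measurable_prodMk_left (x := S.points ω) |>.comp
      hS.measurable_marks)
  simp only [sinInt, inversion, hS.inversionKernel_eq]
  refine integral_integral_swap ?_
  have hd := ((hS.integrable_exposureOf_sub T (S.points ω)).abs).comp_fst
    (ν := (volume : Measure ℝ).restrict (Set.Ioc 0 A))
  refine hd.mono' ?_ ?_
  · have hm' : Measurable fun p : Ω × ℝ => P.exposureOf (S.points ω, S.marks p.1) :=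
      hm.comp measurable_fst
    exact ((Real.measurable_sin.comp (measurable_snd.mul (hm'.sub_const T))).mul
      measurable_snd.inv).aestronglyMeasurable
  · have hq : ∀ᵐ p ∂μ.prod ((volume : Measure ℝ).restrict (Set.Ioc 0 A)), p.2 ∈ Set.Ioc 0 A :=
      Measure.quasiMeasurePreserving_snd.ae (ae_restrict_mem measurableSet_Ioc)
    filter_upwards [hq] with p hp
    exact abs_sin_mul_inv_le hp.1 _

lemma IsModel.stronglyMeasurable_inversion (hS : S.IsModel P μ) (T A : ℝ) :
    StronglyMeasurable[S.sigmaPsi] (S.inversion P T A) := by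
  have h := @measurable_inversionKernel Ω S.sigmaPsi T (fun q ω => S.charProd P q ω)
    hS.continuous_charProd hS.stronglyMeasurable_charProd
  exact @StronglyMeasurable.integral_prod_left' _ _ _ _ S.sigmaPsi
    ((volume : Measure ℝ).restrict (Set.Ioc 0 A)) _ _ _ _
    (@Measurable.stronglyMeasurable _ _ (_) _ _ _ _ _ _ h)

lemma IsModel.condExp_sinInt (hS : S.IsModel P μ) (T : ℝ) {A : ℝ} (hA : 0 ≤ A) :
    μ[fun ω => sinInt A (S.exposure P ω - T) | S.sigmaPsi] =ᵐ[μ] S.inversion P T A := by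
  have hm := P.measurable_exposureOf
  have h := condExp_of_indepFun (E := ℝ) hS.indep_points hS.measurable_points hS.measurable_marks
    (F := fun p => sinInt A (P.exposureOf p - T)) (C := 4)
    ((measurable_sinInt A).comp (hm.sub_const T)).stronglyMeasurable
    (fun p => abs_sinInt_le hA _)
    S.sigmaPsi_le_comap_points (hS.stronglyMeasurable_inversion T A)
    (Eventually.of_forall fun ω => (hS.integral_sinInt T A ω).symm)
  rw [funext fun ω => congrArg (fun x => sinInt A (x - T)) (S.exposure_eq P ω)]
  exact h

end Network

end EMFE


namespace EMFE

/-! ### Products of conditional expectations along a bounded convergent family -/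

section CondExp

variable {Ω : Type*} {m mΩ : MeasurableSpace Ω} {μ : Measure Ω} [IsProbabilityMeasure μ]

/-- Dominated convergence gives L¹ convergence of D, and conditional expectation contracts L¹. -/
lemma tendsto_integral_abs_condExp_sub {ι : Type*} {l : Filter ι} [l.IsCountablyGenerated]
    {D : ι → Ω → ℝ} {D₀ : Ω → ℝ} {C : ℝ} (hm : ∀ i, AEStronglyMeasurable (D i) μ)
    (hm₀ : AEStronglyMeasurable D₀ μ) (hb : ∀ᶠ i in l, ∀ ω, |D i ω| ≤ C) (hb₀ : ∀ ω, |D₀ ω| ≤ C)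
    (hlim : ∀ᵐ ω ∂μ, Tendsto (fun i => D i ω) l (𝓝 (D₀ ω))) :
    Tendsto (fun i => ∫ ω, |μ[D i | m] ω - μ[D₀ | m] ω| ∂μ) l (𝓝 0) := by
  have hi₀ : Integrable D₀ μ := Integrable.of_bound hm₀ C (Eventually.of_forall hb₀)
  have h1 : Tendsto (fun i => ∫ ω, |D i ω - D₀ ω| ∂μ) l (𝓝 (∫ _, (0 : ℝ) ∂μ)) := by
    refine tendsto_integral_filter_of_dominated_convergence (fun _ => C + C)
      (Eventually.of_forall fun i => ((hm i).sub hm₀).norm) ?_ (integrable_const _) ?_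
    · filter_upwards [hb] with i hi
      refine Eventually.of_forall fun ω => ?_
      rw [Real.norm_eq_abs, abs_abs]
      exact (abs_sub _ _).trans (add_le_add (hi ω) (hb₀ ω))
    · filter_upwards [hlim] with ω hω
      simpa using (hω.sub_const (D₀ ω)).abs
  rw [integral_zero] at h1
  refine squeeze_zero' (Eventually.of_forall fun i => integral_nonneg fun ω => abs_nonneg _) ?_ h1
  filter_upwards [hb] with i hi
  have hi' : Integrable (D i) μ := Integrable.of_bound (hm i) C (Eventually.of_forall hi)
  refine le_trans (le_of_eq ?_) (integral_abs_condExp_le (m := m) fun ω => D i ω - D₀ ω)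
  refine integral_congr_ae ?_
  filter_upwards [condExp_sub hi' hi₀ m] with ω hω
  have : μ[fun ω => D i ω - D₀ ω | m] ω = (μ[D i | m] - μ[D₀ | m]) ω := hω
  rw [this, Pi.sub_apply]

/-- With J the conditional expectations, J_A J_B - J₀² = J_B (J_A - J₀) + J₀ (J_B - J₀) and all
factors are bounded by C. The two cut-offs are separated, hence the limit is taken independently in
each. -/
lemma tendsto_integral_condExp_mul {D : ℝ → Ω → ℝ} {D₀ : Ω → ℝ} {C : ℝ}
    (hm : ∀ i, AEStronglyMeasurable (D i) μ) (hm₀ : AEStronglyMeasurable D₀ μ)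
    (hb : ∀ᶠ i in atTop, ∀ ω, |D i ω| ≤ C) (hb₀ : ∀ ω, |D₀ ω| ≤ C)
    (hlim : ∀ᵐ ω ∂μ, Tendsto (fun i => D i ω) atTop (𝓝 (D₀ ω))) :
    Tendsto (fun b : ℝ × ℝ => ∫ ω, μ[D b.1 | m] ω * μ[D b.2 | m] ω ∂μ) (atTop ×ˢ atTop)
      (𝓝 (∫ ω, μ[D₀ | m] ω ^ 2 ∂μ)) := by
  have h := tendsto_integral_abs_condExp_sub (m := m) hm hm₀ hb hb₀ hlim
  have h1 := ((h.comp tendsto_fst).add (h.comp (tendsto_snd (f := (atTop : Filter ℝ))))).const_mul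
    C
  rw [add_zero, mul_zero] at h1
  rw [tendsto_iff_norm_sub_tendsto_zero]
  refine squeeze_zero' (Eventually.of_forall fun i => norm_nonneg _) ?_ h1
  filter_upwards [hb.prod_inl (atTop : Filter ℝ), hb.prod_inr (atTop : Filter ℝ)] with b h1 h2
  have hJ₀ : ∀ᵐ ω ∂μ, |μ[D₀ | m] ω| ≤ C := ae_bdd_abs_condExp_of_ae_bdd_abs (Eventually.of_forall hb₀)
  have hJ (i : ℝ) (hi : ∀ ω, |D i ω| ≤ C) : ∀ᵐ ω ∂μ, |μ[D i | m] ω| ≤ C :=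
    ae_bdd_abs_condExp_of_ae_bdd_abs (Eventually.of_forall hi)
  have hint (f g : Ω → ℝ) (hg : ∀ᵐ ω ∂μ, |μ[g | m] ω| ≤ C) :
      Integrable (fun ω => μ[f | m] ω * μ[g | m] ω) μ :=
    Integrable.mul_bdd integrable_condExp integrable_condExp.aestronglyMeasurable hg
  have hsub (f g : Ω → ℝ) : Integrable (fun ω => |μ[f | m] ω - μ[g | m] ω|) μ :=
    (integrable_condExp.sub integrable_condExp).abs
  simp only [pow_two]
  rw [← integral_sub (hint _ _ (hJ _ h2)) (hint _ _ hJ₀)]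
  refine (norm_integral_le_of_norm_le (((hsub (D b.1) D₀).add (hsub (D b.2) D₀)).const_mul C)
    ?_).trans_eq ?_
  · filter_upwards [hJ₀, hJ _ h2] with ω hω₀ hω
    have e : μ[D b.1 | m] ω * μ[D b.2 | m] ω - μ[D₀ | m] ω * μ[D₀ | m] ω =
        μ[D b.2 | m] ω * (μ[D b.1 | m] ω - μ[D₀ | m] ω) +
          μ[D₀ | m] ω * (μ[D b.2 | m] ω - μ[D₀ | m] ω) := by ring
    rw [e, Real.norm_eq_abs, Pi.add_apply, mul_add]
    refine (abs_add_le _ _).trans (add_le_add ?_ ?_)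
    · rw [abs_mul]
      exact mul_le_mul_of_nonneg_right hω (abs_nonneg _)
    · rw [abs_mul]
      exact mul_le_mul_of_nonneg_right hω₀ (abs_nonneg _)
  · rw [integral_const_mul]
    simp only [Pi.add_apply]
    rw [integral_add (hsub _ _) (hsub _ _)]
    rfl

end CondExp

/-! ### The second moment of the conditional distribution -/

namespace Network

variable {Ω : Type*} {S : Network Ω} {P : Params} [MeasurableSpace Ω] {μ : Measure Ω}
  [IsProbabilityMeasure μ]

/-- From Im a · Im b = ½ Re(a b̄ - a b): the conjugate product has mean γ_- and the plain product
has mean γ_+. -/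
lemma IsModel.integral_inversionKernel_mul (hS : S.IsModel P μ) (T : ℝ) {q q' : ℝ} (hq : 0 < q)
    (hq' : 0 < q') :
    ∫ ω, inversionKernel T q (S.charProd P q ω) * inversionKernel T q' (S.charProd P q' ω) ∂μ =
      P.omegaKernel T q q' * q⁻¹ * q'⁻¹ := by
  have hb (e : ℝ) : Integrable (fun ω => S.charProd P q ω * S.charProd P (e * q') ω) μ := by
    refine Integrable.of_bound (C := 1)
      ((hS.measurable_charProd q).mul (hS.measurable_charProd _)).aestronglyMeasurable
      (Eventually.of_forall fun ω => ?_)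
    rw [norm_mul]
    exact mul_le_one₀ (hS.norm_charProd_le _ _) (norm_nonneg _) (hS.norm_charProd_le _ _)
  set u := Complex.exp (-Complex.I * ((T * (q - q') : ℝ) : ℂ)) with hu
  set v := Complex.exp (-Complex.I * ((T * (q + q') : ℝ) : ℂ)) with hv
  set a := Complex.exp (-Complex.I * ((T * q : ℝ) : ℂ)) with ha
  set b := Complex.exp (-Complex.I * ((T * q' : ℝ) : ℂ)) with hb'
  have hv' : v = a * b := by
    rw [hv, ha, hb', ← Complex.exp_add]; congr 1; push_cast; ring
  have hu' : u = a * starRingEnd ℂ b := by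
    rw [hu, ha, hb', ← Complex.exp_conj, ← Complex.exp_add]
    congr 1
    simp only [map_mul, map_neg, Complex.conj_I, Complex.conj_ofReal]
    push_cast
    ring
  have key (ω : Ω) : inversionKernel T q (S.charProd P q ω) *
      inversionKernel T q' (S.charProd P q' ω) =
      (1 / 2 * q⁻¹ * q'⁻¹) * (S.charProd P q ω * S.charProd P (-1 * q') ω * u -
        S.charProd P q ω * S.charProd P (1 * q') ω * v).re := by
    rw [neg_one_mul, one_mul, hS.charProd_neg, hu', hv', inversionKernel, inversionKernel, ← ha,
      ← hb']
    simp only [Complex.sub_re, Complex.mul_re, Complex.mul_im, Complex.conj_re, Complex.conj_im]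
    ring
  have hi : Integrable (fun ω => S.charProd P q ω * S.charProd P (-1 * q') ω * u -
      S.charProd P q ω * S.charProd P (1 * q') ω * v) μ :=
    ((hb (-1)).mul_const u).sub ((hb 1).mul_const v)
  simp only [key]
  rw [integral_const_mul]
  have hre : ∫ ω, (S.charProd P q ω * S.charProd P (-1 * q') ω * u -
      S.charProd P q ω * S.charProd P (1 * q') ω * v).re ∂μ = (∫ ω, (S.charProd P q ω *
      S.charProd P (-1 * q') ω * u - S.charProd P q ω * S.charProd P (1 * q') ω * v) ∂μ).re :=
    integral_re hi
  rw [hre, integral_sub ((hb (-1)).mul_const u) ((hb 1).mul_const v), integral_mul_const,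
    integral_mul_const, hS.integral_charProd_mul (Or.inr rfl) hq hq',
    hS.integral_charProd_mul (Or.inl rfl) hq hq', Params.omegaKernel, Params.gammaMinus,
    Params.gammaPlus]
  ring

/-- Both factors are almost surely below `kernelBound`, which does not depend on the frequencies and
is square integrable, while the rectangle has finite area. -/
lemma IsModel.integrable_inversionKernel_mul (hS : S.IsModel P μ) {T : ℝ} (hT : 0 < T) (A B : ℝ) :
    Integrable (fun x : (ℝ × ℝ) × Ω => inversionKernel T x.1.1 (S.charProd P x.1.1 x.2) *
      inversionKernel T x.1.2 (S.charProd P x.1.2 x.2))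
      (((volume : Measure (ℝ × ℝ)).restrict (Set.Ioc 0 A ×ˢ Set.Ioc 0 B)).prod μ) := by
  have hm := measurable_inversionKernel T (Φ := fun q ω => S.charProd P q ω)
    hS.continuous_charProd fun q => (hS.measurable_charProd q).stronglyMeasurable
  have hfin : IsFiniteMeasure ((volume : Measure (ℝ × ℝ)).restrict (Set.Ioc 0 A ×ˢ Set.Ioc 0 B)) := by
    refine ⟨?_⟩
    rw [Measure.restrict_apply_univ, Measure.volume_eq_prod, Measure.prod_prod]
    exact ENNReal.mul_lt_top (by simp) (by simp)
  refine ((hS.integrable_kernelBound_sq T).comp_snd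
    ((volume : Measure (ℝ × ℝ)).restrict (Set.Ioc 0 A ×ˢ Set.Ioc 0 B))).mono' ?_ ?_
  · have h1 : Measurable fun x : (ℝ × ℝ) × Ω => inversionKernel T x.1.1 (S.charProd P x.1.1 x.2) :=
      hm.comp (g := fun p : ℝ × Ω => inversionKernel T p.1 (S.charProd P p.1 p.2))
        (f := fun x : (ℝ × ℝ) × Ω => (x.1.1, x.2)) (by fun_prop)
    have h2 : Measurable fun x : (ℝ × ℝ) × Ω => inversionKernel T x.1.2 (S.charProd P x.1.2 x.2) :=
      hm.comp (g := fun p : ℝ × Ω => inversionKernel T p.1 (S.charProd P p.1 p.2))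
        (f := fun x : (ℝ × ℝ) × Ω => (x.1.2, x.2)) (by fun_prop)
    exact (h1.mul h2).aestronglyMeasurable
  · have h1 : ∀ᵐ x ∂((volume : Measure (ℝ × ℝ)).restrict (Set.Ioc 0 A ×ˢ Set.Ioc 0 B)).prod μ,
        x.1 ∈ Set.Ioc 0 A ×ˢ Set.Ioc 0 B :=
      Measure.quasiMeasurePreserving_fst.ae
        (ae_restrict_mem (measurableSet_Ioc.prod measurableSet_Ioc))
    have h2 := (Measure.quasiMeasurePreserving_snd (ν := μ)
      (μ := (volume : Measure (ℝ × ℝ)).restrict (Set.Ioc 0 A ×ˢ Set.Ioc 0 B))).ae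
      (hS.ae_abs_inversionKernel_le hT)
    filter_upwards [h1, h2] with x hx h
    rw [norm_mul, pow_two]
    exact mul_le_mul (h _ hx.1.1) (h _ hx.2.1) (norm_nonneg _)
      ((abs_nonneg _).trans (h _ hx.1.1))

lemma IsModel.integrableOn_omegaKernel (hS : S.IsModel P μ) {T : ℝ} (hT : 0 < T) (A B : ℝ) :
    IntegrableOn (fun p : ℝ × ℝ => P.omegaKernel T p.1 p.2 * p.1⁻¹ * p.2⁻¹)
      (Set.Ioc 0 A ×ˢ Set.Ioc 0 B) := by
  refine (hS.integrable_inversionKernel_mul hT A B).integral_prod_left.congr ?_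
  filter_upwards [ae_restrict_mem (measurableSet_Ioc.prod measurableSet_Ioc)] with p hp
  exact hS.integral_inversionKernel_mul T hp.1.1 hp.2.1

lemma IsModel.setIntegral_omegaKernel (hS : S.IsModel P μ) {T : ℝ} (hT : 0 < T) (A B : ℝ) :
    ∫ p in Set.Ioc 0 A ×ˢ Set.Ioc 0 B, P.omegaKernel T p.1 p.2 * p.1⁻¹ * p.2⁻¹ =
      ∫ ω, S.inversion P T A ω * S.inversion P T B ω ∂μ := by
  have h1 : ∫ p in Set.Ioc 0 A ×ˢ Set.Ioc 0 B, P.omegaKernel T p.1 p.2 * p.1⁻¹ * p.2⁻¹ =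
      ∫ p in Set.Ioc 0 A ×ˢ Set.Ioc 0 B, ∫ ω, inversionKernel T p.1 (S.charProd P p.1 ω) *
        inversionKernel T p.2 (S.charProd P p.2 ω) ∂μ :=
    setIntegral_congr_fun (measurableSet_Ioc.prod measurableSet_Ioc) fun p hp =>
      (hS.integral_inversionKernel_mul T hp.1.1 hp.2.1).symm
  rw [h1, integral_integral_swap (hS.integrable_inversionKernel_mul hT A B)]
  refine integral_congr_ae (Eventually.of_forall fun ω => ?_)
  exact setIntegral_prod_mul (μ := volume) (ν := volume)
    (fun q => inversionKernel T q (S.charProd P q ω))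
    (fun q => inversionKernel T q (S.charProd P q ω)) _ _

/-- Fourier approximation of `1{x < 0} - 1/2`. -/
lemma tendsto_sinInt_sign {x : ℝ} (hx : x ≠ 0) :
    Tendsto (fun A => -Real.pi⁻¹ * sinInt A x) atTop (𝓝 ((if x < 0 then 1 else 0) - 1 / 2)) := by
  have hpi := Real.pi_ne_zero
  rcases lt_or_gt_of_ne hx with h | h
  · refine ((tendsto_sinInt_of_neg h).const_mul _).trans_eq ?_
    rw [if_pos h]
    congr 1
    field_simp
    norm_num
  · refine ((tendsto_sinInt_of_pos h).const_mul _).trans_eq ?_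
    rw [if_neg h.not_gt]
    congr 1
    field_simp
    norm_num

lemma IsModel.integral_condCdf_sub_half_sq (hS : S.IsModel P μ) (T : ℝ) :
    ∫ ω, (S.condCdf P μ T ω - 1 / 2) ^ 2 ∂μ = S.secondMoment P μ T - S.cdf P μ T + 1 / 4 := by
  have hs : MeasurableSet {ω | S.exposure P ω < T} :=
    measurableSet_lt hS.measurable_exposure measurable_const
  have hi : Integrable (S.condCdf P μ T) μ := integrable_condExp
  have hb : ∀ᵐ ω ∂μ, |S.condCdf P μ T ω| ≤ 1 := by
    refine ae_bdd_abs_condExp_of_ae_bdd_abs (Eventually.of_forall fun ω => ?_)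
    by_cases h : S.exposure P ω < T <;> simp [Set.indicator, h]
  have hi2 : Integrable (fun ω => S.condCdf P μ T ω ^ 2) μ := by
    simp only [pow_two]
    exact hi.mul_bdd hi.aestronglyMeasurable hb
  have hmean : ∫ ω, S.condCdf P μ T ω ∂μ = S.cdf P μ T := by
    rw [condCdf, integral_condExp hS.sigmaPsi_le, integral_indicator hs, setIntegral_const, cdf]
    simp
  have e (ω : Ω) : (S.condCdf P μ T ω - 1 / 2) ^ 2 =
      S.condCdf P μ T ω ^ 2 - S.condCdf P μ T ω + 1 / 4 := by ring
  have hd : Integrable (fun ω => S.condCdf P μ T ω ^ 2 - S.condCdf P μ T ω) μ := hi2.sub hi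
  simp only [e]
  rw [integral_add hd (integrable_const _), integral_sub hi2 hi, hmean, secondMoment]
  simp

/-- The variables D_A are the Fourier approximations of 1{𝒮 < T} - 1/2; their conditional
expectations are -1/π times the inversion integrals, whence the factor π². -/
lemma IsModel.tendsto_integral_inversion_mul (hS : S.IsModel P μ) {T : ℝ} (hT : 0 < T) :
    Tendsto (fun b : ℝ × ℝ => ∫ ω, S.inversion P T b.1 ω * S.inversion P T b.2 ω ∂μ)
      (atTop ×ˢ atTop)
      (𝓝 (Real.pi ^ 2 * (S.secondMoment P μ T - S.cdf P μ T + 1 / 4))) := by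
  have hpi := Real.pi_pos
  have hE := hS.measurable_exposure
  have hs : MeasurableSet {ω | S.exposure P ω < T} := measurableSet_lt hE measurable_const
  set D : ℝ → Ω → ℝ := fun A ω => -Real.pi⁻¹ * sinInt A (S.exposure P ω - T) with hD
  set D₀ : Ω → ℝ := {ω | S.exposure P ω < T}.indicator (fun _ => (1 : ℝ)) - fun _ => 1 / 2
    with hD₀
  have hI : Integrable ({ω | S.exposure P ω < T}.indicator fun _ => (1 : ℝ)) μ :=
    (integrable_const _).indicator hs
  -- The constant 2 dominates both 4/π, the bound of the approximations, and 1/2, the modulus of the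
  -- limit.
  have h := tendsto_integral_condExp_mul (m := S.sigmaPsi) (μ := μ) (D := D) (D₀ := D₀) (C := 2)
    (fun A => (((measurable_sinInt A).comp (hE.sub_const T)).const_mul _).aestronglyMeasurable)
    (hI.sub (integrable_const _)).aestronglyMeasurable
    (by
      filter_upwards [eventually_ge_atTop 0] with A hA ω
      rw [hD]
      simp only [abs_mul, abs_neg, abs_inv, abs_of_pos hpi]
      have h1 := abs_sinInt_le hA (S.exposure P ω - T)
      have h2 := Real.pi_gt_three
      rw [inv_mul_le_iff₀ hpi]
      linarith)
    (fun ω => by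
      rw [hD₀, abs_le]
      by_cases h : S.exposure P ω < T <;> simp [Set.indicator, h] <;> norm_num)
    (by
      filter_upwards [hS.exposure_ne hT.ne'] with ω hω
      have := tendsto_sinInt_sign (sub_ne_zero.2 hω)
      refine this.trans_eq ?_
      congr 1
      by_cases h : S.exposure P ω < T <;> simp [hD₀, Set.indicator, h])
  have hlim : ∫ ω, μ[D₀ | S.sigmaPsi] ω ^ 2 ∂μ =
      S.secondMoment P μ T - S.cdf P μ T + 1 / 4 := by
    rw [← hS.integral_condCdf_sub_half_sq]
    refine integral_congr_ae ?_
    filter_upwards [condExp_sub hI (integrable_const (1 / 2 : ℝ)) S.sigmaPsi] with ω hω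
    rw [hω, Pi.sub_apply, condExp_const hS.sigmaPsi_le]
    rfl
  rw [hlim] at h
  refine (h.const_mul (Real.pi ^ 2)).congr' ?_
  have h0 : ∀ᶠ A : ℝ in atTop, 0 ≤ A := eventually_ge_atTop 0
  filter_upwards [h0.prod_inl (atTop : Filter ℝ), h0.prod_inr (atTop : Filter ℝ)] with b hb1 hb2
  have hc (A : ℝ) (hA : 0 ≤ A) : μ[D A | S.sigmaPsi] =ᵐ[μ]
      fun ω => -Real.pi⁻¹ * S.inversion P T A ω := by
    have h1 := condExp_smul (-Real.pi⁻¹) (fun ω => sinInt A (S.exposure P ω - T)) S.sigmaPsi (μ := μ)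
    filter_upwards [h1, hS.condExp_sinInt T hA] with ω h1 h2
    have : μ[D A | S.sigmaPsi] ω = _ := h1
    rw [this, Pi.smul_apply, h2, smul_eq_mul]
  rw [← integral_const_mul]
  refine integral_congr_ae ?_
  filter_upwards [hc _ hb1, hc _ hb2] with ω h1 h2
  rw [h1, h2]
  field_simp

lemma IsModel.hasImproperDoubleIntegral (hS : S.IsModel P μ) {T : ℝ} (hT : 0 < T) :
    HasImproperDoubleIntegral (fun q q' => P.omegaKernel T q q' * q⁻¹ * q'⁻¹)
      (Real.pi ^ 2 * (S.secondMoment P μ T - S.cdf P μ T + 1 / 4)) := by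
  refine ⟨fun A B => hS.integrableOn_omegaKernel hT A B, ?_⟩
  simp only [hS.setIntegral_omegaKernel hT]
  exact hS.tendsto_integral_inversion_mul hT

end Network

end EMFE

theorem theorem3 {Ω : Type*} [MeasurableSpace Ω] (μ : MeasureTheory.Measure Ω)
    [MeasureTheory.IsProbabilityMeasure μ] (P : EMFE.Params) (S : EMFE.Network Ω)
    (hS : S.IsModel P μ) :
    (∀ q q' : ℝ, 0 < q → 0 < q' →
      (∫ ω, S.condChar P μ q ω * S.condChar P μ q' ω ∂μ) = P.gammaPlus q q' ∧
      (∫ ω, S.condChar P μ q ω * starRingEnd ℂ (S.condChar P μ q' ω) ∂μ) =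
        P.gammaMinus q q') ∧
    ∀ T : ℝ, 0 < T → ∃ W : ℝ,
      EMFE.HasImproperDoubleIntegral (fun q q' => P.omegaKernel T q q' * q⁻¹ * q'⁻¹) W ∧
      S.secondMoment P μ T = -1 / 4 + S.cdf P μ T + (Real.pi ^ 2)⁻¹ * W := by
  -- The witness for W is π² (𝓜₂ - F + 1/4), the limit already identified; the asserted identity is
  -- this value solved for 𝓜₂.
  refine ⟨fun q q' hq hq' => ⟨hS.integral_condChar_mul hq hq',
    hS.integral_condChar_mul_conj hq hq'⟩, fun T hT => ⟨_, hS.hasImproperDoubleIntegral hT, ?_⟩⟩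
  have := Real.pi_ne_zero
  field_simp
  ring
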